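/- Let $p\ge 3$ be odd, let $0\le L<p$ be even, and let $0<t_1<t_0$, $\eta_0>0$. Let $S(t,\alpha)$ be $\mathcal C^\infty$ on $[-t_0,t_0]\times\mathbb R$ with $S(t,0)=0$ for all $t$, and such that every monomial $t^i\alpha^j$ occurring with nonzero coefficient in the Taylor series of $S$ at $(0,0)$ satisfies $i+(p-L+1)j>p+1$. Let $P(t,u,\alpha,\eta)$ be $\mathcal C^\infty$ on $[-t_0,t_0]\times\mathbb R\times\mathbb R\times[0,\eta_0)$. Consider the equation $$\eta^{p+2}\,\dot u=(p+1)\,\eta\, t^p u+\eta^{p-L+1}\alpha\, t^L+S\bigl(t,\eta^{p-L+1}\alpha\bigr)+\eta^{p+1}P\bigl(t,\eta u,\eta^{p-L+1}\alpha,\eta\bigr),\qquad t\in[-t_0,t_0]. \tag{2}$$ A canard solution of (2) is a family $(\alpha_\eta,u_\eta)$, with $\alpha_\eta\in\mathbb R$ and $u_\eta:[-t_0,t_0]\to\mathbb R$, which for all sufficiently small $\eta>0$ satisfies (2) and $u_\eta(-t_0)=0=u_\eta(t_0)$, and which is bounded as $\eta\to0^+$, that is, $\alpha_\eta=O(1)$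 and $\sup_{[-t_0,t_0]}|u_\eta|=O(1)$. Let $\mathcal D$ be the set of functions $\phi:\mathbb R\to\mathbb R$ for which there are real numbers $c_1,c_2,\dots$ such that, for every $N\ge 0$, $\phi(T)=\sum_{m=1}^{N}c_mT^{-m}+O(T^{-N-1})$ both as $T\to+\infty$ and as $T\to-\infty$ (with the same $c_m$). Then a canard solution $(\alpha_\eta,u_\eta)$ of (2) exists, and any two of them coincide for all sufficiently small $\eta>0$. It has an asymptotic expansion in powers of $\eta$ of the form $$\Bigl(\sum_{l\ge0}a_l\eta^l,\ \sum_{k\ge0}\bigl(u_k(t)+\phi_k(t/\eta)\bigr)\eta^k\Bigr),$$ where, for every $k$, $a_k\in\mathbb R$, $u_k\in\mathcal C^\infty([-t_1,t_1])$, and $\phi_k\in\mathcal D$ tends to $0$ at $\pm\infty$; that is, for every $K\ge0$, as $\eta\to0^+$, $$\Bigl|\alpha_\eta-\sum_{l=0}^{K}a_l\eta^l\Bigr|=O(\eta^{K+1}),\qquad \sup_{t\in[-t_1,t_1]}\Bigl|u_\eta(t)-\sum_{k=0}^{K}\bigl(u_k(t)+\phi_k(t/\eta)\bigr)\eta^k\Bigr|=O(\eta^{K+1}).$$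 Moreover this expansion is unique: the numbers $a_k$, the functions $u_k$ on $[-t_1,t_1]$ and the functions $\phi_k$ on $\mathbb R$ are uniquely determined. -/

import Mathlib

open Set Filter Topology Asymptotics
open scoped ContDiff

/-- The right-hand side of the singularly perturbed equation
`η^(p+2) u' = (p+1) η t^p u + η^(p-L+1) α t^L + S(t, η^(p-L+1) α) + η^(p+1) P(t, η u, η^(p-L+1) α, η)`. -/
def canardRHS (p L : ℕ) (S : ℝ → ℝ → ℝ) (P : ℝ → ℝ → ℝ → ℝ → ℝ) (η α t x : ℝ) : ℝ :=
  ((p : ℝ) + 1) * η * t ^ p * x + η ^ (p - L + 1) * α * t ^ L + S t (η ^ (p - L + 1) * α)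
    + η ^ (p + 1) * P t (η * x) (η ^ (p - L + 1) * α) η

/-- For one value of `η`: the parameter `α` and the function `u` solve the equation on
`[-t₀, t₀]` with `u(-t₀) = 0 = u(t₀)`. -/
structure SolvesCanardBVP (p L : ℕ) (S : ℝ → ℝ → ℝ) (P : ℝ → ℝ → ℝ → ℝ → ℝ) (t₀ η α : ℝ)
    (u : ℝ → ℝ) : Prop where
  ode : ∀ t ∈ Icc (-t₀) t₀, ∃ d : ℝ, HasDerivWithinAt u d (Icc (-t₀) t₀) t ∧
    η ^ (p + 2) * d = canardRHS p L S P η α t (u t)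
  left : u (-t₀) = 0
  right : u t₀ = 0

/-- A canard solution: a family `(α η, u η)`, solving the boundary value problem for all small
`η > 0` and bounded, uniformly on `[-t₀, t₀]`, as `η → 0⁺`. -/
structure IsCanardSolution (p L : ℕ) (S : ℝ → ℝ → ℝ) (P : ℝ → ℝ → ℝ → ℝ → ℝ) (t₀ : ℝ)
    (α : ℝ → ℝ) (u : ℝ → ℝ → ℝ) : Prop where
  solves : ∀ᶠ η in 𝓝[>] (0 : ℝ), SolvesCanardBVP p L S P t₀ η (α η) (u η)
  bounded : ∃ R : ℝ, ∀ᶠ η in 𝓝[>] (0 : ℝ), |α η| ≤ R ∧ ∀ t ∈ Icc (-t₀) t₀, |u η t| ≤ R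

/-- `φ(T) ~ ∑_{m ≥ 1} c m * T^(-m)` along the filter `l`. -/
def HasNegPowerExpansion (φ : ℝ → ℝ) (c : ℕ → ℝ) (l : Filter ℝ) : Prop :=
  ∀ N : ℕ, (fun T : ℝ => φ T - ∑ m ∈ Finset.Icc 1 N, c m * (T⁻¹) ^ m)
    =O[l] fun T : ℝ => (T⁻¹) ^ (N + 1)

/-- The functions with identical asymptotic expansions in negative powers of the variable at
`+∞` and at `-∞`. -/
def classD : Set (ℝ → ℝ) :=
  {φ | ∃ c : ℕ → ℝ, HasNegPowerExpansion φ c atTop ∧ HasNegPowerExpansion φ c atBot}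

/-- `(∑ a l η^l, ∑ (U k t + φ k (t/η)) η^k)` is an asymptotic expansion of `(α, u)`, uniform for
`t ∈ [-t₁, t₁]`, with `U k` smooth on `[-t₁, t₁]` and `φ k ∈ classD` tending to `0` at `±∞`. -/
structure IsCompositeExpansion (t₁ : ℝ) (α : ℝ → ℝ) (u : ℝ → ℝ → ℝ)
    (a : ℕ → ℝ) (U φ : ℕ → ℝ → ℝ) : Prop where
  smooth : ∀ k, ContDiffOn ℝ ∞ (U k) (Icc (-t₁) t₁)
  mem_classD : ∀ k, φ k ∈ classD
  tendsto_atTop : ∀ k, Tendsto (φ k) atTop (𝓝 0)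
  tendsto_atBot : ∀ k, Tendsto (φ k) atBot (𝓝 0)
  param : ∀ K : ℕ, (fun η : ℝ => α η - ∑ l ∈ Finset.range (K + 1), a l * η ^ l)
    =O[𝓝[>] (0 : ℝ)] fun η : ℝ => η ^ (K + 1)
  func : ∀ K : ℕ, ∃ C : ℝ, ∀ᶠ η in 𝓝[>] (0 : ℝ), ∀ t ∈ Icc (-t₁) t₁,
    |u η t - ∑ k ∈ Finset.range (K + 1), (U k t + φ k (t / η)) * η ^ k| ≤ C * η ^ (K + 1)

/-! In the stretched variable $T=t/\eta$, after division by $\eta^{p+1}$, the equation reads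
$du/dT=(p+1)T^pu+\alpha T^L+g$ on $[-M,M]$, $M=t_0/\eta$, where $g=S/\eta^{p+1}+P$ depends on
$(\alpha,u)$ only weakly: the valuation of $S$, and the factors $\eta$ and $\eta^{p-L+1}$ in the
arguments of $P$, make $g$ Lipschitz in $(\alpha,u)$ with constant $O(\eta)$ relative to the weight
$1+|T|^p$.

Everything rests on one linear estimate, uniform in $M$ (`exists_apriori_bound`). Multiplying by the
integrating factor $e^{-T^{p+1}}$ and integrating over $[-M,M]$ controls $\alpha$ by the forcing,
because $\int e^{-s^{p+1}}s^L\,ds>0$ for even $L$. Since $p$ is odd, solutions are then controlled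
by integrating from each endpoint towards $0$, where barriers bound them by the forcing; boundary
values contribute only $e^{T^{p+1}-M^{p+1}}$ and an exponentially small multiple. Existence follows
by contraction (`exists_nonlinear_bvp_solution`) and uniqueness by applying the estimate to a
difference.

The expansion is obtained by bootstrapping. Functions $U(t)+\phi(t/\eta)$, with $U$ smooth and
$\phi\in\mathcal D$, generate expansions stable under products and smooth composition:
$U(t)=U(0)+tW(t)$ and $t\phi(t/\eta)=\eta\,T\phi(T)$, where $T\phi(T)$ is a constant plus an element
of $\mathcal D$. If $(\alpha,u)$ has an expansion to order $n$, then $g$ has one to order $n+1$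
(`IsCanardProblem.sourceExpansion`). The linear equation with this source is solved approximately to
that order (`SourceExpansion.exists_approx_solution`): a term $T^pV(t)$ is cancelled by $-V/(p+1)$,
and a term $\psi(T)$ by the solution on $\mathbb R$ from `exists_inD_solution`, whose parameter is
fixed by a vanishing weighted integral. The linear estimate compares $(\alpha,u)$ with this
approximation; the mismatch at the endpoints is exponentially small on any smaller interval, which
is why $t_1<t_0$.

The coefficients are unique because at fixed $t\ne0$ the inner functions tend to $0$, which
determines $U_k$; then $t=\eta T$ determines $\phi_k$ (`ApproxUpTo.unique`). -/

/-! ### Two-sided asymptotic expansions in negative powers. -/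

theorem tendsto_inv_cocompact_real : Tendsto (fun T : ℝ => T⁻¹) (cocompact ℝ) (𝓝 0) := by
  rw [← Metric.cobounded_eq_cocompact]
  exact tendsto_inv₀_cobounded

theorem eventually_ne_zero_cocompact_real : ∀ᶠ T : ℝ in cocompact ℝ, T ≠ 0 := by
  have := (isCompact_singleton (x := (0 : ℝ))).compl_mem_cocompact
  filter_upwards [this] with T hT using hT

theorem isBigO_inv_pow_of_le {m n : ℕ} (h : m ≤ n) :
    (fun T : ℝ => (T⁻¹) ^ n) =O[cocompact ℝ] fun T : ℝ => (T⁻¹) ^ m := by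
  obtain ⟨k, rfl⟩ := Nat.exists_eq_add_of_le h
  have h1 : (fun T : ℝ => (T⁻¹) ^ k) =O[cocompact ℝ] fun _ : ℝ => (1 : ℝ) :=
    (tendsto_inv_cocompact_real.pow k).isBigO_one ℝ
  simpa [pow_add] using (isBigO_refl (fun T : ℝ => (T⁻¹) ^ m) (cocompact ℝ)).mul h1

/-- The truncation of `∑_{m ≥ 1} c m X^m` at degree `N`, as a polynomial. -/
noncomputable def truncPoly (c : ℕ → ℝ) (N : ℕ) : Polynomial ℝ :=
  ∑ m ∈ Finset.Icc 1 N, Polynomial.C (c m) * Polynomial.X ^ m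

theorem eval_truncPoly (c : ℕ → ℝ) (N : ℕ) (x : ℝ) :
    (truncPoly c N).eval x = ∑ m ∈ Finset.Icc 1 N, c m * x ^ m := by
  simp [truncPoly, Polynomial.eval_finsetSum]

theorem coeff_truncPoly (c : ℕ → ℝ) (N n : ℕ) :
    (truncPoly c N).coeff n = if 1 ≤ n ∧ n ≤ N then c n else 0 := by
  simp [truncPoly, Polynomial.coeff_X_pow]

theorem isBigO_eval_inv_of_coeff_eq_zero (Q : Polynomial ℝ) (N : ℕ)
    (h : ∀ n < N, Q.coeff n = 0) :
    (fun T : ℝ => Q.eval T⁻¹) =O[cocompact ℝ] fun T : ℝ => (T⁻¹) ^ N := by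
  obtain ⟨R, rfl⟩ := Polynomial.X_pow_dvd_iff.2 h
  have h1 : (fun T : ℝ => R.eval T⁻¹) =O[cocompact ℝ] fun _ : ℝ => (1 : ℝ) :=
    ((R.continuous.tendsto 0).comp tendsto_inv_cocompact_real).isBigO_one ℝ
  simpa using (isBigO_refl (fun T : ℝ => (T⁻¹) ^ N) (cocompact ℝ)).mul h1

/-- `φ` has a two-sided asymptotic expansion `∑_{m ≥ 1} c m T^(-m)`. -/
def HasInvExpansion (φ : ℝ → ℝ) : Prop :=
  ∃ c : ℕ → ℝ, HasNegPowerExpansion φ c (cocompact ℝ)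

/-- `cocompact ℝ` is the join of `atBot` and `atTop`, so a single filter encodes that the
coefficients agree at both ends. -/
theorem hasInvExpansion_iff_mem_classD {φ : ℝ → ℝ} : HasInvExpansion φ ↔ φ ∈ classD := by
  simp only [HasInvExpansion, classD, HasNegPowerExpansion, cocompact_eq_atBot_atTop,
    isBigO_sup, mem_ofPred_eq, forall_and]
  exact exists_congr fun c => and_comm

theorem HasNegPowerExpansion.isBigO_inv {φ : ℝ → ℝ} {c : ℕ → ℝ} {l : Filter ℝ}
    (h : HasNegPowerExpansion φ c l) : φ =O[l] fun T : ℝ => T⁻¹ := by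
  simpa using h 0

theorem HasInvExpansion.isBigO_inv {φ : ℝ → ℝ} (h : HasInvExpansion φ) :
    φ =O[cocompact ℝ] fun T : ℝ => T⁻¹ := h.choose_spec.isBigO_inv

theorem HasInvExpansion.tendsto {φ : ℝ → ℝ} (h : HasInvExpansion φ) :
    Tendsto φ (cocompact ℝ) (𝓝 0) :=
  h.isBigO_inv.trans_tendsto tendsto_inv_cocompact_real

theorem HasInvExpansion.congr' {φ ψ : ℝ → ℝ} (h : HasInvExpansion φ)
    (h' : φ =ᶠ[cocompact ℝ] ψ) : HasInvExpansion ψ := by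
  obtain ⟨c, hc⟩ := h
  refine ⟨c, fun N => (hc N).congr' ?_ EventuallyEq.rfl⟩
  filter_upwards [h'] with T hT
  rw [hT]

theorem HasInvExpansion.zero : HasInvExpansion fun _ => 0 :=
  ⟨fun _ => 0, fun N => (isBigO_zero (E' := ℝ) (fun T : ℝ => T⁻¹ ^ (N + 1)) _).congr_left
    fun T => by simp⟩

theorem HasInvExpansion.add {φ ψ : ℝ → ℝ} (hφ : HasInvExpansion φ) (hψ : HasInvExpansion ψ) :
    HasInvExpansion fun T => φ T + ψ T := by
  obtain ⟨c, hc⟩ := hφ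
  obtain ⟨d, hd⟩ := hψ
  refine ⟨fun m => c m + d m, fun N => ((hc N).add (hd N)).congr_left fun T => ?_⟩
  simp only [add_mul, Finset.sum_add_distrib]
  ring

theorem HasInvExpansion.const_mul {φ : ℝ → ℝ} (hφ : HasInvExpansion φ) (a : ℝ) :
    HasInvExpansion fun T => a * φ T := by
  obtain ⟨c, hc⟩ := hφ
  refine ⟨fun m => a * c m, fun N => ((hc N).const_mul_left a).congr_left fun T => ?_⟩
  simp only [mul_sub, Finset.mul_sum, mul_assoc]

theorem HasInvExpansion.mul {φ ψ : ℝ → ℝ} (hφ : HasInvExpansion φ) (hψ : HasInvExpansion ψ) :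
    HasInvExpansion fun T => φ T * ψ T := by
  have hφO := hφ.isBigO_inv.trans (tendsto_inv_cocompact_real.isBigO_one ℝ)
  obtain ⟨c, hc⟩ := hφ
  obtain ⟨d, hd⟩ := hψ
  -- Cauchy product. The guards discard `c 0` and `d 0`, which the expansions leave arbitrary.
  refine ⟨fun m => ∑ x ∈ Finset.HasAntidiagonal.antidiagonal m,
    (if 1 ≤ x.1 then c x.1 else 0) * (if 1 ≤ x.2 then d x.2 else 0), fun N => ?_⟩
  set e : ℕ → ℝ := fun m => ∑ x ∈ Finset.HasAntidiagonal.antidiagonal m,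
    (if 1 ≤ x.1 then c x.1 else 0) * (if 1 ≤ x.2 then d x.2 else 0) with he
  have hB : (fun T : ℝ => (truncPoly d N).eval T⁻¹) =O[cocompact ℝ] fun _ : ℝ => (1 : ℝ) :=
    (((truncPoly d N).continuous.tendsto 0).comp tendsto_inv_cocompact_real).isBigO_one ℝ
  have hQ : (fun T : ℝ => (truncPoly c N * truncPoly d N - truncPoly e N).eval T⁻¹)
      =O[cocompact ℝ] fun T : ℝ => (T⁻¹) ^ (N + 1) := by
    refine isBigO_eval_inv_of_coeff_eq_zero _ _ fun n hn => ?_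
    rw [Polynomial.coeff_sub, Polynomial.coeff_mul, coeff_truncPoly]
    have h1 : ∑ x ∈ Finset.HasAntidiagonal.antidiagonal n, (truncPoly c N).coeff x.1 * (truncPoly d N).coeff x.2
        = e n := by
      refine Finset.sum_congr rfl fun x hx => ?_
      have := Finset.HasAntidiagonal.mem_antidiagonal.1 hx
      rw [coeff_truncPoly, coeff_truncPoly]
      have h2 : x.1 ≤ N := by omega
      have h3 : x.2 ≤ N := by omega
      simp [h2, h3]
    rw [h1]
    rcases Nat.eq_zero_or_pos n with rfl | hpos
    · simp [he]
    · rw [if_pos ⟨hpos, by omega⟩, sub_self]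
  have h1 := hφO.mul (hd N)
  have h2 := (hc N).mul hB
  simp only [one_mul, mul_one] at h1 h2
  refine ((h1.add h2).add hQ).congr_left fun T => ?_
  simp only [← eval_truncPoly, Polynomial.eval_sub, Polynomial.eval_mul]
  ring

theorem HasInvExpansion.inv_mul {φ : ℝ → ℝ} (hφ : HasInvExpansion φ) :
    HasInvExpansion fun T => T⁻¹ * φ T := by
  obtain ⟨c, hc⟩ := hφ
  refine ⟨fun m => if 2 ≤ m then c (m - 1) else 0, fun N => ?_⟩
  have h1 := (isBigO_refl (fun T : ℝ => T⁻¹) (cocompact ℝ)).mul (hc N)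
  have h2 : (fun T : ℝ => T⁻¹ * (T⁻¹) ^ (N + 1)) =O[cocompact ℝ] fun T : ℝ => (T⁻¹) ^ (N + 1) :=
    (isBigO_inv_pow_of_le (show N + 1 ≤ N + 2 by omega)).congr_left fun T => by ring
  have h3 : (fun T : ℝ => T⁻¹ * ∑ m ∈ Finset.Icc 1 N, c m * (T⁻¹) ^ m
      - ∑ m ∈ Finset.Icc 1 N, (if 2 ≤ m then c (m - 1) else 0) * (T⁻¹) ^ m)
      =O[cocompact ℝ] fun T : ℝ => (T⁻¹) ^ (N + 1) := by
    refine (isBigO_eval_inv_of_coeff_eq_zero (Polynomial.X * truncPoly c N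
      - truncPoly (fun m => if 2 ≤ m then c (m - 1) else 0) N) (N + 1) fun n hn => ?_).congr_left
        fun T => by simp [eval_truncPoly]
    rcases n with _ | n
    · simp [coeff_truncPoly]
    · rw [Polynomial.coeff_sub, Polynomial.coeff_X_mul, coeff_truncPoly, coeff_truncPoly]
      by_cases h : 1 ≤ n
      · simp [h, show n ≤ N by omega, show n + 1 ≤ N by omega]
      · simp [h]
  refine ((h1.trans h2).add h3).congr_left fun T => ?_
  ring

theorem HasInvExpansion.inv_pow_mul {φ : ℝ → ℝ} (hφ : HasInvExpansion φ) (k : ℕ) :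
    HasInvExpansion fun T => T⁻¹ ^ k * φ T := by
  induction k with
  | zero => simpa using hφ
  | succ k ih =>
    refine ih.inv_mul.congr' (Eventually.of_forall fun T => ?_)
    simp only
    ring

theorem HasInvExpansion.inv : HasInvExpansion fun T => T⁻¹ := by
  refine ⟨fun m => if m = 1 then 1 else 0, fun N => ?_⟩
  refine (isBigO_eval_inv_of_coeff_eq_zero (Polynomial.X
      - truncPoly (fun m => if m = 1 then 1 else 0) N) (N + 1) fun n hn => ?_).congr_left
        fun T => by simp [eval_truncPoly]
  rw [Polynomial.coeff_sub, coeff_truncPoly, Polynomial.coeff_X]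
  by_cases h : n = 1
  · subst h; simp [show 1 ≤ N by omega]
  · simp [h, Ne.symm h]

theorem HasInvExpansion.inv_pow {k : ℕ} (hk : k ≠ 0) : HasInvExpansion fun T => T⁻¹ ^ k := by
  obtain ⟨k, rfl⟩ := Nat.exists_eq_succ_of_ne_zero hk
  refine (HasInvExpansion.inv.inv_pow_mul k).congr' (Eventually.of_forall fun T => ?_)
  simp only [pow_succ]

/-- Shifting the coefficients by one. This is what lets a factor $t=\eta T$ in front of
$\phi(t/\eta)$ be traded for a factor $\eta$. -/
theorem HasInvExpansion.exists_mul_sub {φ : ℝ → ℝ} (hφ : HasInvExpansion φ) :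
    ∃ c₁ : ℝ, HasInvExpansion fun T => T * φ T - c₁ := by
  obtain ⟨c, hc⟩ := hφ
  refine ⟨c 1, fun m => c (m + 1), fun N => ?_⟩
  refine ((isBigO_refl (fun T : ℝ => T) (cocompact ℝ)).mul (hc (N + 1))).congr' ?_ ?_
  · filter_upwards [eventually_ne_zero_cocompact_real] with T hT
    have h2 : T * ∑ m ∈ Finset.Icc 1 (N + 1), c m * T⁻¹ ^ m
        = c 1 + ∑ m ∈ Finset.Icc 1 N, c (m + 1) * T⁻¹ ^ m := by
      induction N with
      | zero => simp; field_simp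
      | succ N ih =>
        rw [Finset.sum_Icc_succ_top (by omega), mul_add, ih,
          Finset.sum_Icc_succ_top (by omega), pow_succ _ (N + 1)]
        field_simp
        ring
    rw [mul_sub, h2]
    ring
  · filter_upwards [eventually_ne_zero_cocompact_real] with T hT
    rw [pow_succ _ (N + 1)]
    field_simp

/-- The continuous functions in `classD`. -/
def InD (φ : ℝ → ℝ) : Prop := Continuous φ ∧ HasInvExpansion φ

/-- The continuous functions `ψ` such that `T^(-p) ψ` has an expansion in negative powers. -/
def InDPow (p : ℕ) (ψ : ℝ → ℝ) : Prop :=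
  Continuous ψ ∧ HasInvExpansion fun T => T⁻¹ ^ p * ψ T

theorem InD.zero : InD fun _ => 0 := ⟨continuous_const, HasInvExpansion.zero⟩

theorem InD.add {φ ψ : ℝ → ℝ} (hφ : InD φ) (hψ : InD ψ) : InD fun T => φ T + ψ T :=
  ⟨hφ.1.add hψ.1, hφ.2.add hψ.2⟩

theorem InD.mul {φ ψ : ℝ → ℝ} (hφ : InD φ) (hψ : InD ψ) : InD fun T => φ T * ψ T :=
  ⟨hφ.1.mul hψ.1, hφ.2.mul hψ.2⟩

theorem InD.const_mul {φ : ℝ → ℝ} (hφ : InD φ) (a : ℝ) : InD fun T => a * φ T :=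
  ⟨continuous_const.mul hφ.1, hφ.2.const_mul a⟩

theorem InD.exists_mul_sub {φ : ℝ → ℝ} (hφ : InD φ) : ∃ c₁ : ℝ, InD fun T => T * φ T - c₁ :=
  let ⟨c₁, h⟩ := hφ.2.exists_mul_sub
  ⟨c₁, (continuous_id.mul hφ.1).sub continuous_const, h⟩

theorem InD.exists_bound {φ : ℝ → ℝ} (hφ : InD φ) : ∃ C, ∀ T, |φ T| ≤ C := by
  have h := hφ.1.isBounded_range_iff_isBigO.2
    (hφ.2.isBigO_inv.trans (tendsto_inv_cocompact_real.isBigO_one ℝ))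
  obtain ⟨C, hC⟩ := isBounded_iff_forall_norm_le.1 h
  exact ⟨C, fun T => hC _ (mem_range_self T)⟩

theorem InDPow.zero {p : ℕ} : InDPow p fun _ => 0 :=
  ⟨continuous_const, by simpa using HasInvExpansion.zero⟩

theorem InDPow.add {p : ℕ} {φ ψ : ℝ → ℝ} (hφ : InDPow p φ) (hψ : InDPow p ψ) :
    InDPow p fun T => φ T + ψ T :=
  ⟨hφ.1.add hψ.1, (hφ.2.add hψ.2).congr' (Eventually.of_forall fun T => by simp only; ring)⟩

theorem InDPow.const_mul {p : ℕ} {φ : ℝ → ℝ} (hφ : InDPow p φ) (a : ℝ) :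
    InDPow p fun T => a * φ T :=
  ⟨continuous_const.mul hφ.1,
    (hφ.2.const_mul a).congr' (Eventually.of_forall fun T => by simp only; ring)⟩

theorem inDPow_pow {p i : ℕ} (hi : i < p) : InDPow p fun T => T ^ i := by
  refine ⟨continuous_pow i, (HasInvExpansion.inv_pow (k := p - i) (by omega)).congr' ?_⟩
  filter_upwards [eventually_ne_zero_cocompact_real] with T hT
  obtain ⟨k, rfl⟩ := Nat.exists_eq_add_of_le hi.le
  simp only [add_tsub_cancel_left]
  rw [pow_add, inv_pow, inv_pow]
  field_simp

theorem InD.pow_mul {p i : ℕ} (hi : i ≤ p) {φ : ℝ → ℝ} (hφ : InD φ) :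
    InDPow p fun T => T ^ i * φ T := by
  refine ⟨(continuous_pow i).mul hφ.1, (hφ.2.inv_pow_mul (p - i)).congr' ?_⟩
  filter_upwards [eventually_ne_zero_cocompact_real] with T hT
  obtain ⟨k, rfl⟩ := Nat.exists_eq_add_of_le hi
  simp only [add_tsub_cancel_left]
  rw [pow_add, inv_pow, inv_pow]
  field_simp

/-! ### Weighted a priori estimates for the linear equation. -/

/-- The growth weight `1 + |T|^p`. -/
def growthWeight (p : ℕ) (T : ℝ) : ℝ := 1 + |T| ^ p

theorem growthWeight_pos (p : ℕ) (T : ℝ) : 0 < growthWeight p T := by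
  unfold growthWeight; positivity

theorem one_le_growthWeight (p : ℕ) (T : ℝ) : 1 ≤ growthWeight p T := by
  unfold growthWeight; linarith [pow_nonneg (abs_nonneg T) p]

theorem abs_pow_le_growthWeight {p i : ℕ} (hi : i ≤ p) (T : ℝ) : |T| ^ i ≤ growthWeight p T := by
  unfold growthWeight
  rcases le_total |T| 1 with h | h
  · linarith [pow_le_one₀ (n := i) (abs_nonneg T) h, pow_nonneg (abs_nonneg T) p]
  · linarith [pow_le_pow_right₀ h hi]

theorem continuous_growthWeight (p : ℕ) : Continuous (growthWeight p) := by
  unfold growthWeight; fun_prop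

theorem exp_neg_pow_mul_growthWeight_le {p : ℕ} (hp : Odd p) (T : ℝ) :
    Real.exp (-T ^ (p + 1)) * growthWeight p T ≤ 8 * (1 + T ^ 2)⁻¹ := by
  have hev : Even (p + 1) := hp.add_one
  have hy : T ^ (p + 1) = |T| ^ (p + 1) := (hev.pow_abs T).symm
  rw [hy, Real.exp_neg, ← div_eq_mul_inv, le_div_iff₀ (by positivity), inv_mul_eq_div,
    div_mul_eq_mul_div, div_le_iff₀ (Real.exp_pos _)]
  unfold growthWeight
  rw [← sq_abs T]
  have hx := abs_nonneg T
  generalize |T| = x at hx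
  rcases le_total x 1 with h | h
  · have h1 : x ^ p ≤ 1 := pow_le_one₀ hx h
    have h2 : x ^ 2 ≤ 1 := pow_le_one₀ hx h
    have h3 : 1 ≤ Real.exp (x ^ (p + 1)) := Real.one_le_exp (by positivity)
    nlinarith [pow_nonneg hx p, pow_nonneg hx 2]
  -- With $y=x^{p+1}$: $(1+x^p)(1+x^2)\le 4x^{p+2}\le 4y^2\le 8e^y$, which gives the constant $8$.
  · have h1 : 1 ≤ x ^ p := one_le_pow₀ h
    have h2 : 1 ≤ x ^ 2 := one_le_pow₀ h
    have h3 := Real.pow_div_factorial_le_exp (x ^ (p + 1)) (by positivity) 2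
    have h4 : x ^ (p + 2) ≤ (x ^ (p + 1)) ^ 2 := by
      rw [← pow_mul]; exact pow_le_pow_right₀ h (by omega)
    have h5 : x ^ (p + 2) = x ^ p * x ^ 2 := pow_add _ _ _
    norm_num [Nat.factorial] at h3
    nlinarith

theorem integrable_exp_neg_pow_mul {p : ℕ} (hp : Odd p) {f : ℝ → ℝ} (hf : Continuous f) {C : ℝ}
    (hC : ∀ T, |f T| ≤ C * growthWeight p T) :
    MeasureTheory.Integrable fun T => Real.exp (-T ^ (p + 1)) * f T := by
  refine ((integrable_inv_one_add_sq.const_mul 8).const_mul C).mono'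
    (by fun_prop : Continuous _).aestronglyMeasurable (Eventually.of_forall fun T => ?_)
  have hC0 : 0 ≤ C := by
    have := (abs_nonneg _).trans (hC 0)
    exact nonneg_of_mul_nonneg_left this (growthWeight_pos p 0)
  rw [Real.norm_eq_abs, abs_mul, Real.abs_exp]
  calc Real.exp (-T ^ (p + 1)) * |f T|
      ≤ Real.exp (-T ^ (p + 1)) * (C * growthWeight p T) := by gcongr; exact hC T
    _ = C * (Real.exp (-T ^ (p + 1)) * growthWeight p T) := by ring
    _ ≤ _ := mul_le_mul_of_nonneg_left (exp_neg_pow_mul_growthWeight_le hp T) hC0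

theorem HasDerivWithinAt.exp_neg_pow_mul {p : ℕ} {d : ℝ → ℝ} {D T : ℝ} {s : Set ℝ}
    (h : HasDerivWithinAt d D s T) :
    HasDerivWithinAt (fun T => Real.exp (-T ^ (p + 1)) * d T)
      (Real.exp (-T ^ (p + 1)) * (D - ((p : ℝ) + 1) * T ^ p * d T)) s T := by
  have h1 : HasDerivWithinAt (fun T : ℝ => Real.exp (-T ^ (p + 1)))
      (Real.exp (-T ^ (p + 1)) * -(((p : ℝ) + 1) * T ^ p)) s T := by
    have := ((hasDerivAt_pow (p + 1) T).neg.exp).hasDerivWithinAt (s := s)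
    simpa using this
  exact (h1.mul h).congr_deriv (by ring)

theorem le_of_hasDerivWithinAt_le {F G F' G' : ℝ → ℝ} {a b : ℝ} (hab : a ≤ b)
    (hF : ∀ T ∈ Icc a b, HasDerivWithinAt F (F' T) (Icc a b) T)
    (hG : ∀ T ∈ Icc a b, HasDerivWithinAt G (G' T) (Icc a b) T)
    (h : ∀ T ∈ Icc a b, F' T ≤ G' T) : F b - F a ≤ G b - G a := by
  have hmono : MonotoneOn (fun T => G T - F T) (Icc a b) := by
    refine monotoneOn_of_hasDerivWithinAt_nonneg (convex_Icc a b)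
      (f' := fun T => G' T - F' T) ?_ ?_ ?_
    · exact fun T hT => ((hG T hT).sub (hF T hT)).continuousWithinAt
    · exact fun T hT => ((hG T (interior_subset hT)).sub (hF T (interior_subset hT))).mono
        interior_subset
    · exact fun T hT => sub_nonneg.2 (h T (interior_subset hT))
  have := hmono (left_mem_Icc.2 hab) (right_mem_Icc.2 hab) hab
  simp only at this
  linarith

/-- The hypothesis says that $e^{-T^{p+1}}(d-W)$ is nondecreasing, so an upper bound at the right
end propagates to the left. -/
theorem exp_mul_sub_le_of_comparison {p : ℕ} {d D W W' : ℝ → ℝ} {a b : ℝ} (hab : a ≤ b)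
    (hd : ∀ T ∈ Icc a b, HasDerivWithinAt d (D T) (Icc a b) T)
    (hW : ∀ T ∈ Icc a b, HasDerivWithinAt W (W' T) (Icc a b) T)
    (h : ∀ T ∈ Icc a b, W' T - ((p : ℝ) + 1) * T ^ p * W T ≤ D T - ((p : ℝ) + 1) * T ^ p * d T) :
    Real.exp (-a ^ (p + 1)) * (d a - W a) ≤ Real.exp (-b ^ (p + 1)) * (d b - W b) := by
  have := le_of_hasDerivWithinAt_le (F := fun _ => 0) (F' := fun _ => 0) hab
    (fun T _ => hasDerivWithinAt_const _ _ _)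
    (fun T hT => ((hd T hT).sub (hW T hT)).exp_neg_pow_mul (p := p))
    (fun T hT => mul_nonneg (Real.exp_pos _).le (by simp only [Pi.sub_apply]; linarith [h T hT]))
  simp only [Pi.sub_apply] at this
  linarith

/-- Comparison with the barrier $W=3k(1+e^{-x})$, started from $M$. No value at $0$ is needed, and
the value at $M$ is damped by $e^{T^{p+1}-M^{p+1}}$. Since $W\le 6k$ for $x\ge0$, the bound does not
depend on $M$. -/
theorem le_add_exp_of_hasDerivWithinAt {p : ℕ} {d f : ℝ → ℝ} {M k B : ℝ} (hk : 0 ≤ k)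
    (hd : ∀ T ∈ Icc 0 M, HasDerivWithinAt d (((p : ℝ) + 1) * T ^ p * d T + f T) (Icc 0 M) T)
    (hf : ∀ T ∈ Icc 0 M, |f T| ≤ k * growthWeight p T) (hM : d M ≤ B) {T : ℝ}
    (hT : T ∈ Icc 0 M) :
    d T ≤ 6 * k + B * Real.exp (T ^ (p + 1) - M ^ (p + 1)) := by
  have hsub : Icc T M ⊆ Icc 0 M := Icc_subset_Icc_left hT.1
  have hW : ∀ x : ℝ, HasDerivAt (fun x => 3 * k * (1 + Real.exp (-x)))
      (3 * k * (Real.exp (-x) * (-1))) x := fun x =>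
    (((hasDerivAt_neg x).exp).const_add 1).const_mul (3 * k)
  have key := exp_mul_sub_le_of_comparison (p := p) hT.2
    (fun x hx => (hd x (hsub hx)).mono hsub)
    (fun x hx => (hW x).hasDerivWithinAt) (fun x hx => by
      have h1 := (abs_le.1 (hf x (hsub hx))).1
      have hx0 : 0 ≤ x := (hsub hx).1
      unfold growthWeight at h1
      rw [abs_of_nonneg hx0] at h1
      -- For $x\le1$ the first term exceeds $1$ because $3/e>1$; for $x\ge1$ the second exceeds
      -- $2x^p$. The term $e^{-x}$ is there because $x^p$ gives nothing near $0$.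
      have h2 : 1 + x ^ p ≤ 3 * Real.exp (-x) + 3 * (((p : ℝ) + 1) * x ^ p) := by
        have h5 : x ^ p ≤ ((p : ℝ) + 1) * x ^ p := by nlinarith [pow_nonneg hx0 p, p.cast_nonneg (α := ℝ)]
        have h6 := pow_nonneg hx0 p
        rcases le_total x 1 with h | h
        · have h3 : Real.exp (-1) ≤ Real.exp (-x) := Real.exp_le_exp.2 (by linarith)
          have h4 := Real.exp_neg_one_gt_d9
          linarith
        · have := one_le_pow₀ (n := p) h
          linarith [Real.exp_pos (-x)]
      have h3 : 0 ≤ k * (((p : ℝ) + 1) * x ^ p) * Real.exp (-x) := by positivity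
      nlinarith)
  have h1 : Real.exp (T ^ (p + 1)) * (Real.exp (-T ^ (p + 1)) * (d T - 3 * k * (1 + Real.exp (-T))))
      ≤ Real.exp (T ^ (p + 1)) * (Real.exp (-M ^ (p + 1)) * (d M - 3 * k * (1 + Real.exp (-M)))) := by
    gcongr
  rw [← mul_assoc, ← mul_assoc, ← Real.exp_add, ← Real.exp_add, add_neg_cancel, Real.exp_zero,
    one_mul, ← sub_eq_add_neg] at h1
  have h2 : Real.exp (-T) ≤ 1 := Real.exp_le_one_iff.2 (by linarith [hT.1])
  have h3 : d M - 3 * k * (1 + Real.exp (-M)) ≤ B := by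
    have : 0 ≤ 3 * k * (1 + Real.exp (-M)) := by positivity
    linarith
  have h4 := mul_le_mul_of_nonneg_left h3 (Real.exp_pos (T ^ (p + 1) - M ^ (p + 1))).le
  nlinarith

theorem hasDerivWithinAt_comp_neg {d : ℝ → ℝ} {D T M : ℝ}
    (h : HasDerivWithinAt d D (Icc (-M) M) (-T)) :
    HasDerivWithinAt (fun x => d (-x)) (-D) (Icc (-M) M) T := by
  have := HasDerivWithinAt.scomp (g₁ := d) (h := fun x : ℝ => -x) (t' := Icc (-M) M) T h
    (hasDerivWithinAt_neg T (Icc (-M) M)) (fun x hx => ⟨neg_le_neg hx.2, neg_le.1 hx.1⟩)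
  simpa [Function.comp_def] using this

theorem abs_le_add_exp_of_hasDerivWithinAt {p : ℕ} (hp : Odd p) {d f : ℝ → ℝ} {M k B : ℝ}
    (hk : 0 ≤ k)
    (hd : ∀ T ∈ Icc (-M) M,
      HasDerivWithinAt d (((p : ℝ) + 1) * T ^ p * d T + f T) (Icc (-M) M) T)
    (hf : ∀ T ∈ Icc (-M) M, |f T| ≤ k * growthWeight p T) (hM : |d M| ≤ B) (hM' : |d (-M)| ≤ B)
    {T : ℝ} (hT : T ∈ Icc (-M) M) :
    |d T| ≤ 6 * k + B * Real.exp (T ^ (p + 1) - M ^ (p + 1)) := by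
  have hM0 : 0 ≤ M := by linarith [hT.1.trans hT.2]
  have hsub : Icc 0 M ⊆ Icc (-M) M := Icc_subset_Icc_left (by linarith)
  have right : ∀ d f : ℝ → ℝ, (∀ T ∈ Icc (-M) M,
      HasDerivWithinAt d (((p : ℝ) + 1) * T ^ p * d T + f T) (Icc (-M) M) T) →
      (∀ T ∈ Icc (-M) M, |f T| ≤ k * growthWeight p T) → |d M| ≤ B → ∀ T ∈ Icc 0 M,
      |d T| ≤ 6 * k + B * Real.exp (T ^ (p + 1) - M ^ (p + 1)) := by
    intro d f hd hf hM T hT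
    refine abs_le.2 ⟨?_, ?_⟩
    · have := le_add_exp_of_hasDerivWithinAt (B := B) (d := fun x => -d x) (f := fun x => -f x) hk
        (fun x hx => ((hd x (hsub hx)).mono hsub).neg.congr_deriv (by ring)) (fun x hx => by rw [abs_neg]; exact hf x (hsub hx))
          (by linarith [(abs_le.1 hM).1]) hT
      linarith
    · exact le_add_exp_of_hasDerivWithinAt hk (fun x hx => (hd x (hsub hx)).mono hsub)
        (fun x hx => hf x (hsub hx)) ((le_abs_self _).trans hM) hT
  rcases le_total 0 T with h0 | h0
  · exact right d f hd hf hM T ⟨h0, hT.2⟩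
  -- For odd $p$ the reflection $T\mapsto-T$ preserves the form of the equation and changes the sign
  -- of the forcing.
  · have := right (fun x => d (-x)) (fun x => -f (-x)) (fun x hx => by
      have hx' : -x ∈ Icc (-M) M := ⟨neg_le_neg hx.2, neg_le.1 hx.1⟩
      exact (hasDerivWithinAt_comp_neg (hd (-x) hx')).congr_deriv (by rw [hp.neg_pow]; ring)) (fun x hx => by
        have hx' : -x ∈ Icc (-M) M := ⟨neg_le_neg hx.2, neg_le.1 hx.1⟩
        have := hf (-x) hx'
        rw [abs_neg]
        simpa [growthWeight] using this) hM' (-T) ⟨by linarith, by linarith [hT.1]⟩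
    simpa [hp.add_one.neg_pow] using this

theorem integral_exp_neg_pow_mul_pow_pos {p L : ℕ} (hL : Even L) :
    0 < ∫ s in (-1 : ℝ)..1, Real.exp (-s ^ (p + 1)) * s ^ L := by
  refine intervalIntegral.integral_pos (by norm_num) (by fun_prop)
    (fun x _ => mul_nonneg (Real.exp_pos _).le (hL.pow_nonneg x))
    ⟨1, by norm_num, by positivity⟩

/-- Integrating $(e^{-T^{p+1}}d)'=e^{-T^{p+1}}(\delta T^L+r)$ over $[-M,M]$ isolates $\delta$: its
factor is at least the integral over $[-1,1]$, as $M\ge1$ and $L$ is even, while the weighted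
forcing is at most $\rho I$ and the boundary terms at most $2Be^{-M^{p+1}}$. -/
theorem exists_param_bound {p L : ℕ} (hp : Odd p) (hL : Even L) :
    ∃ A : ℝ, 0 ≤ A ∧ ∀ (M ρ B δ : ℝ) (d r : ℝ → ℝ), 1 ≤ M → 0 ≤ ρ →
      (∀ T ∈ Icc (-M) M, HasDerivWithinAt d
        (((p : ℝ) + 1) * T ^ p * d T + (δ * T ^ L + r T)) (Icc (-M) M) T) →
      (∀ T ∈ Icc (-M) M, |r T| ≤ ρ * growthWeight p T) → |d M| ≤ B → |d (-M)| ≤ B →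
      |δ| ≤ A * (ρ + B * Real.exp (-M ^ (p + 1))) := by
  set c := ∫ s in (-1 : ℝ)..1, Real.exp (-s ^ (p + 1)) * s ^ L with hc
  have hc0 : 0 < c := integral_exp_neg_pow_mul_pow_pos hL
  set I := ∫ s, Real.exp (-s ^ (p + 1)) * growthWeight p s with hI
  have hint := integrable_exp_neg_pow_mul hp (continuous_growthWeight p) (C := 1)
    (fun T => by rw [one_mul, abs_of_pos (growthWeight_pos p T)])
  have hI0 : 0 ≤ I := MeasureTheory.integral_nonneg fun s =>
    mul_nonneg (Real.exp_pos _).le (growthWeight_pos p s).le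
  have hcw := continuous_growthWeight p
  have pos : ∀ (M ρ B δ : ℝ) (d r : ℝ → ℝ), 1 ≤ M → 0 ≤ ρ → 0 ≤ δ →
      (∀ T ∈ Icc (-M) M, HasDerivWithinAt d
        (((p : ℝ) + 1) * T ^ p * d T + (δ * T ^ L + r T)) (Icc (-M) M) T) →
      (∀ T ∈ Icc (-M) M, |r T| ≤ ρ * growthWeight p T) → |d M| ≤ B → |d (-M)| ≤ B →
      δ ≤ (I + 2) / c * (ρ + B * Real.exp (-M ^ (p + 1))) := by
    intro M ρ B δ d r hM hρ hδ hd hr hdM hdM'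
    have hB : 0 ≤ B := (abs_nonneg _).trans hdM
    have hcont : Continuous fun s : ℝ =>
        Real.exp (-s ^ (p + 1)) * (δ * s ^ L - ρ * growthWeight p s) := by fun_prop
    have key := le_of_hasDerivWithinAt_le (a := -M) (b := M)
      (F := fun T => ∫ s in (-M)..T, Real.exp (-s ^ (p + 1)) * (δ * s ^ L - ρ * growthWeight p s))
      (by linarith)
      (fun T _ => (hcont.integral_hasStrictDerivAt (-M) T).hasDerivAt.hasDerivWithinAt)
      (fun T hT => (hd T hT).exp_neg_pow_mul (p := p))
      (fun T hT => mul_le_mul_of_nonneg_left (by linarith [(abs_le.1 (hr T hT)).1])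
        (Real.exp_pos _).le)
    simp only [intervalIntegral.integral_same, sub_zero, hp.add_one.neg_pow] at key
    have h1 : ∫ s in (-M)..M, Real.exp (-s ^ (p + 1)) * (δ * s ^ L - ρ * growthWeight p s)
        = δ * (∫ s in (-M)..M, Real.exp (-s ^ (p + 1)) * s ^ L)
          - ρ * ∫ s in (-M)..M, Real.exp (-s ^ (p + 1)) * growthWeight p s := by
      rw [← intervalIntegral.integral_const_mul, ← intervalIntegral.integral_const_mul,
        ← intervalIntegral.integral_sub (Continuous.intervalIntegrable (by fun_prop) _ _)
          (Continuous.intervalIntegrable (by fun_prop) _ _)]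
      exact intervalIntegral.integral_congr fun s _ => by ring
    have h2 : c ≤ ∫ s in (-M)..M, Real.exp (-s ^ (p + 1)) * s ^ L :=
      intervalIntegral.integral_mono_interval (by linarith) (by norm_num) hM
        (Eventually.of_forall fun x => mul_nonneg (Real.exp_pos _).le (hL.pow_nonneg x))
        (Continuous.intervalIntegrable (by fun_prop) _ _)
    have h3 : ∫ s in (-M)..M, Real.exp (-s ^ (p + 1)) * growthWeight p s ≤ I := by
      rw [intervalIntegral.integral_of_le (by linarith)]
      exact MeasureTheory.setIntegral_le_integral hint (Eventually.of_forall fun s =>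
        mul_nonneg (Real.exp_pos _).le (growthWeight_pos p s).le)
    have h4 := mul_le_mul_of_nonneg_left h2 hδ
    have h5 := mul_le_mul_of_nonneg_left h3 hρ
    have h6 : Real.exp (-M ^ (p + 1)) * (d M - d (-M)) ≤ Real.exp (-M ^ (p + 1)) * (2 * B) := by
      gcongr
      linarith [(abs_le.1 hdM).2, (abs_le.1 hdM').1]
    have h7 : 0 ≤ B * Real.exp (-M ^ (p + 1)) := by positivity
    have h8 : 0 ≤ I * (B * Real.exp (-M ^ (p + 1))) := by positivity
    rw [div_mul_eq_mul_div, le_div_iff₀ hc0]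
    rw [h1] at key
    nlinarith
  refine ⟨(I + 2) / c, by positivity, fun M ρ B δ d r hM hρ hd hr hdM hdM' => ?_⟩
  rcases le_total 0 δ with h | h
  · rw [abs_of_nonneg h]
    exact pos M ρ B δ d r hM hρ h hd hr hdM hdM'
  · rw [abs_of_nonpos h]
    exact pos M ρ B (-δ) (fun T => -d T) (fun T => -r T) hM hρ (by linarith)
      (fun T hT => (hd T hT).neg.congr_deriv (by ring))
      (fun T hT => by rw [abs_neg]; exact hr T hT) (by rwa [abs_neg]) (by rwa [abs_neg])

/-- A priori estimate for the linear boundary value problem. -/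
theorem exists_apriori_bound {p L : ℕ} (hp : Odd p) (hL : Even L) (hLp : L < p) :
    ∃ A : ℝ, 0 < A ∧ ∀ (M ρ B δ : ℝ) (d r : ℝ → ℝ), 1 ≤ M → 0 ≤ ρ →
      (∀ T ∈ Icc (-M) M, HasDerivWithinAt d
        (((p : ℝ) + 1) * T ^ p * d T + (δ * T ^ L + r T)) (Icc (-M) M) T) →
      (∀ T ∈ Icc (-M) M, |r T| ≤ ρ * growthWeight p T) → |d M| ≤ B → |d (-M)| ≤ B →
      |δ| ≤ A * (ρ + B * Real.exp (-M ^ (p + 1))) ∧ ∀ T ∈ Icc (-M) M,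
        |d T| ≤ A * (ρ + B * Real.exp (-M ^ (p + 1)))
          + B * Real.exp (T ^ (p + 1) - M ^ (p + 1)) := by
  obtain ⟨A, hA, h⟩ := exists_param_bound (p := p) hp hL
  refine ⟨6 * (A + 1), by positivity, fun M ρ B δ d r hM hρ hd hr hdM hdM' => ?_⟩
  have h1 := h M ρ B δ d r hM hρ hd hr hdM hdM'
  have hB : 0 ≤ B := (abs_nonneg _).trans hdM
  have hE : 0 ≤ B * Real.exp (-M ^ (p + 1)) := by positivity
  have hs : 0 ≤ A * (ρ + B * Real.exp (-M ^ (p + 1))) := by positivity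
  refine ⟨by nlinarith, fun T hT => ?_⟩
  -- As $L<p$, the term $\delta T^L$ is itself dominated by $|\delta|(1+|T|^p)$ and can be treated
  -- as forcing.
  refine (abs_le_add_exp_of_hasDerivWithinAt (k := |δ| + ρ) hp (by positivity) hd
    (fun x hx => ?_) hdM hdM' hT).trans ?_
  · refine (abs_add_le _ _).trans ?_
    rw [add_mul, abs_mul, abs_pow]
    gcongr
    · exact abs_pow_le_growthWeight hLp.le x
    · exact hr x hx
  · refine add_le_add ?_ le_rfl
    nlinarith

/-- Variation of constants from $-M$. The solution returns to $0$ at $M$ exactly when the forcing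
has zero integral against $e^{-s^{p+1}}$, and this fixes $\delta$ because $J>0$. -/
theorem exists_linear_bvp_solution {p L : ℕ} (hL : Even L) {g : ℝ → ℝ}
    (hg : Continuous g) {M : ℝ} (hM : 1 ≤ M) :
    ∃ (δ : ℝ) (d : ℝ → ℝ), d (-M) = 0 ∧ d M = 0 ∧
      ∀ T, HasDerivAt d (((p : ℝ) + 1) * T ^ p * d T + (δ * T ^ L + g T)) T := by
  set J := ∫ s in (-M)..M, Real.exp (-s ^ (p + 1)) * s ^ L with hJ
  have hJ0 : 0 < J := lt_of_lt_of_le (integral_exp_neg_pow_mul_pow_pos (p := p) hL)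
    (intervalIntegral.integral_mono_interval (by linarith) (by norm_num) hM
        (Eventually.of_forall fun x => mul_nonneg (Real.exp_pos _).le (hL.pow_nonneg x))
        (Continuous.intervalIntegrable (by fun_prop) _ _))
  set δ := -(∫ s in (-M)..M, Real.exp (-s ^ (p + 1)) * g s) / J with hδ
  have hcont : Continuous fun s : ℝ => Real.exp (-s ^ (p + 1)) * (δ * s ^ L + g s) := by fun_prop
  refine ⟨δ, fun T => Real.exp (T ^ (p + 1)) *
    ∫ s in (-M)..T, Real.exp (-s ^ (p + 1)) * (δ * s ^ L + g s), by simp, ?_, fun T => ?_⟩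
  · have : ∫ s in (-M)..M, Real.exp (-s ^ (p + 1)) * (δ * s ^ L + g s)
        = δ * J + ∫ s in (-M)..M, Real.exp (-s ^ (p + 1)) * g s := by
      rw [hJ, ← intervalIntegral.integral_const_mul,
        ← intervalIntegral.integral_add (Continuous.intervalIntegrable (by fun_prop) _ _)
          (Continuous.intervalIntegrable (by fun_prop) _ _)]
      exact intervalIntegral.integral_congr fun s _ => by ring
    beta_reduce
    rw [this, hδ, div_mul_cancel₀ _ hJ0.ne']
    simp
  · have h1 : HasDerivAt (fun T : ℝ => Real.exp (T ^ (p + 1)))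
        (Real.exp (T ^ (p + 1)) * (((p : ℝ) + 1) * T ^ p)) T := by
      simpa using (hasDerivAt_pow (p + 1) T).exp
    refine (h1.mul (hcont.integral_hasStrictDerivAt (-M) T).hasDerivAt).congr_deriv ?_
    have h2 : Real.exp (T ^ (p + 1)) * Real.exp (-T ^ (p + 1)) = 1 := by
      rw [← Real.exp_add]; simp
    linear_combination (δ * T ^ L + g T) * h2

/-! ### The linear equation on the whole line, within expansions in negative powers. -/

theorem exists_forall_ge_of_eventually_cocompact {Q : ℝ → Prop} (h : ∀ᶠ T in cocompact ℝ, Q T) :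
    ∃ T₀ : ℝ, 1 ≤ T₀ ∧ ∀ T, T₀ ≤ T → Q T ∧ Q (-T) := by
  rw [cocompact_eq_atBot_atTop, eventually_sup] at h
  have h1 := (tendsto_neg_atTop_atBot (G := ℝ)).eventually h.1
  obtain ⟨T₀, hT₀⟩ := eventually_atTop.1 (h.2.and h1)
  exact ⟨max 1 T₀, le_max_left _ _, fun T hT => hT₀ T ((le_max_right _ _).trans hT)⟩

theorem eventually_cocompact_of_forall_ge {Q : ℝ → Prop} {T₀ : ℝ}
    (h : ∀ T, T₀ ≤ T → Q T ∧ Q (-T)) : ∀ᶠ T in cocompact ℝ, Q T := by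
  rw [cocompact_eq_atBot_atTop, eventually_sup]
  refine ⟨eventually_atBot.2 ⟨-T₀, fun T hT => ?_⟩, eventually_atTop.2 ⟨T₀, fun T hT => (h T hT).1⟩⟩
  simpa using (h (-T) (by linarith)).2

theorem InDPow.exists_bound {p : ℕ} {h : ℝ → ℝ} (hh : InDPow p h) :
    ∃ C, ∀ T, |h T| ≤ C * growthWeight p T := by
  have hcont : Continuous fun T => h T / growthWeight p T :=
    hh.1.div (continuous_growthWeight p) fun T => (growthWeight_pos p T).ne'
  have hO : (fun T => h T / growthWeight p T) =O[cocompact ℝ] fun _ => (1 : ℝ) := by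
    refine IsBigO.trans ?_ (hh.2.isBigO_inv.trans (tendsto_inv_cocompact_real.isBigO_one ℝ))
    refine IsBigO.of_bound 1 ?_
    filter_upwards [eventually_ne_zero_cocompact_real] with T hT
    rw [one_mul, Real.norm_eq_abs, Real.norm_eq_abs, abs_div, abs_of_pos (growthWeight_pos p T),
      abs_mul, abs_pow, abs_inv, div_eq_inv_mul, inv_pow]
    gcongr
    exact abs_pow_le_growthWeight le_rfl T
  obtain ⟨C, hC⟩ := isBounded_iff_forall_norm_le.1 (hcont.isBounded_range_iff_isBigO.2 hO)
  refine ⟨C, fun T => ?_⟩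
  have := hC _ (mem_range_self T)
  rwa [Real.norm_eq_abs, abs_div, abs_of_pos (growthWeight_pos p T),
    div_le_iff₀ (growthWeight_pos p T)] at this

/-- Comparison with the decreasing barrier $CT^{-k}$ on $[T,M]$, then $M\to\infty$. The hypothesis
`hlim` excludes the growing homogeneous solution $e^{T^{p+1}}$. -/
theorem le_inv_pow_of_hasDerivAt {p k : ℕ} {d r : ℝ → ℝ} {T₀ C : ℝ} (hT₀ : 0 < T₀) (hC : 0 ≤ C)
    (hd : ∀ T, T₀ ≤ T → HasDerivAt d (((p : ℝ) + 1) * T ^ p * d T + r T) T)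
    (hr : ∀ T, T₀ ≤ T → |r T| ≤ C * (T ^ p * T⁻¹ ^ k))
    (hlim : Tendsto (fun T => Real.exp (-T ^ (p + 1)) * d T) atTop (𝓝 0)) {T : ℝ} (hT : T₀ ≤ T) :
    d T ≤ C * T⁻¹ ^ k := by
  have hW : ∀ x : ℝ, x ≠ 0 → HasDerivAt (fun x => C * x⁻¹ ^ k)
      (C * (k * x⁻¹ ^ (k - 1) * (-(x ^ 2)⁻¹))) x := fun x hx =>
    ((hasDerivAt_inv hx).pow k).const_mul C
  have key : ∀ M, T ≤ M → Real.exp (-T ^ (p + 1)) * (d T - C * T⁻¹ ^ k)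
      ≤ Real.exp (-M ^ (p + 1)) * d M := fun M hM => by
    have h1 := exp_mul_sub_le_of_comparison (p := p) hM
      (fun x hx => (hd x (hT.trans hx.1)).hasDerivWithinAt)
      (fun x hx => (hW x (hT₀.trans_le (hT.trans hx.1)).ne').hasDerivWithinAt) (fun x hx => by
        have hx0 : 0 < x := hT₀.trans_le (hT.trans hx.1)
        have h1 := (abs_le.1 (hr x (hT.trans hx.1))).1
        have h2 : 0 ≤ C * (k * x⁻¹ ^ (k - 1) * (x ^ 2)⁻¹) := by positivity
        have h3 : 0 ≤ (p : ℝ) * (C * (x ^ p * x⁻¹ ^ k)) := by positivity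
        linarith)
    refine h1.trans (mul_le_mul_of_nonneg_left ?_ (Real.exp_pos _).le)
    have : 0 < M := hT₀.trans_le (hT.trans hM)
    have : 0 ≤ C * M⁻¹ ^ k := by positivity
    linarith
  have h1 : Real.exp (-T ^ (p + 1)) * (d T - C * T⁻¹ ^ k) ≤ 0 :=
    ge_of_tendsto hlim (eventually_atTop.2 ⟨T, key⟩)
  have := nonpos_of_mul_nonpos_right h1 (Real.exp_pos _)
  linarith

theorem abs_le_inv_pow_of_hasDerivAt {p k : ℕ} {d r : ℝ → ℝ} {T₀ C : ℝ} (hT₀ : 0 < T₀)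
    (hC : 0 ≤ C)
    (hd : ∀ T, T₀ ≤ T → HasDerivAt d (((p : ℝ) + 1) * T ^ p * d T + r T) T)
    (hr : ∀ T, T₀ ≤ T → |r T| ≤ C * (T ^ p * T⁻¹ ^ k))
    (hlim : Tendsto (fun T => Real.exp (-T ^ (p + 1)) * d T) atTop (𝓝 0)) {T : ℝ} (hT : T₀ ≤ T) :
    |d T| ≤ C * T⁻¹ ^ k := by
  refine abs_le.2 ⟨?_, le_inv_pow_of_hasDerivAt hT₀ hC hd hr hlim hT⟩
  have := le_inv_pow_of_hasDerivAt (d := fun T => -d T) (r := fun T => -r T) (k := k) hT₀ hC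
    (fun x hx => (hd x hx).neg.congr_deriv (by ring)) (fun x hx => by rw [abs_neg]; exact hr x hx)
    (by simpa using hlim.neg) hT
  linarith

/-- The coefficients of the formal solution in powers of `1/T` of
`φ' = (p+1) T^p φ + T^p ∑ e m T^(-m)`. -/
noncomputable def formalCoeff (p : ℕ) (e : ℕ → ℝ) (n : ℕ) : ℝ :=
  -(e n + if _h : p + 2 ≤ n then ((n - p - 1 : ℕ) : ℝ) * formalCoeff p e (n - p - 1) else 0)
    / ((p : ℝ) + 1)
termination_by n
decreasing_by omega

theorem formalCoeff_eq (p : ℕ) (e : ℕ → ℝ) (n : ℕ) :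
    ((p : ℝ) + 1) * formalCoeff p e n + e n
      + (if p + 2 ≤ n then ((n - p - 1 : ℕ) : ℝ) * formalCoeff p e (n - p - 1) else 0) = 0 := by
  have : (p : ℝ) + 1 ≠ 0 := by positivity
  rw [formalCoeff]
  split_ifs <;> field_simp <;> ring

/-- In $X=1/T$ one has $d/dT=-X^2\,d/dX$, so the polynomial here is $T^{-p}$ times the defect of the
truncated formal solution; it vanishes to order $N+1$. -/
theorem coeff_formal_residual (p : ℕ) (e : ℕ → ℝ) (N n : ℕ) (hn : n < N + 1) :
    (Polynomial.C ((p : ℝ) + 1) * truncPoly (formalCoeff p e) N + truncPoly e N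
      + Polynomial.X ^ (p + 2) * (truncPoly (formalCoeff p e) N).derivative).coeff n = 0 := by
  rw [Polynomial.coeff_add, Polynomial.coeff_add, Polynomial.coeff_C_mul,
    Polynomial.coeff_X_pow_mul', Polynomial.coeff_derivative, coeff_truncPoly, coeff_truncPoly,
    coeff_truncPoly]
  rcases Nat.eq_zero_or_pos n with rfl | hpos
  · simp
  · have h0 := formalCoeff_eq p e n
    rw [if_pos ⟨hpos, by omega⟩, if_pos ⟨hpos, by omega⟩]
    by_cases h : p + 2 ≤ n
    · rw [if_pos h] at h0 ⊢
      rw [if_pos (by omega), show n - (p + 2) + 1 = n - p - 1 by omega]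
      have h1 : ((n - (p + 2) : ℕ) : ℝ) + 1 = ((n - p - 1 : ℕ) : ℝ) := by
        rw [show n - p - 1 = n - (p + 2) + 1 by omega]
        push_cast
        ring
      rw [h1]
      linear_combination h0
    · rw [if_neg h] at h0 ⊢
      exact h0

theorem tendsto_exp_neg_pow_cocompact {p : ℕ} (hp : Odd p) :
    Tendsto (fun T : ℝ => Real.exp (-T ^ (p + 1))) (cocompact ℝ) (𝓝 0) := by
  refine Real.tendsto_exp_neg_atTop_nhds_zero.comp ?_
  have h1 : Tendsto (fun T : ℝ => |T| ^ (p + 1)) (cocompact ℝ) atTop :=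
    (tendsto_pow_atTop (by omega)).comp (tendsto_norm_cocompact_atTop (E := ℝ))
  refine h1.congr fun T => hp.add_one.pow_abs T

/-- Subtracting the truncated formal solution leaves a solution of the same equation with forcing
$O(T^{p-N-1})$, and the barrier $CT^{-N-1}$ applies at both ends. The formal solution is the same at
$+\infty$ and $-\infty$, hence so are the coefficients. -/
theorem inD_of_hasDerivAt {p : ℕ} (hp : Odd p) {φ h : ℝ → ℝ} (hh : InDPow p h)
    (hφ : ∀ T, HasDerivAt φ (((p : ℝ) + 1) * T ^ p * φ T + h T) T)
    (hlim : Tendsto (fun T => Real.exp (-T ^ (p + 1)) * φ T) (cocompact ℝ) (𝓝 0)) : InD φ := by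
  refine ⟨continuous_iff_continuousAt.2 fun T => (hφ T).continuousAt, ?_⟩
  obtain ⟨e, he⟩ := hh.2
  refine ⟨formalCoeff p e, fun N => ?_⟩
  set D := truncPoly (formalCoeff p e) N with hD
  set r : ℝ → ℝ := fun T => ((p : ℝ) + 1) * T ^ p * D.eval T⁻¹ + h T
    + D.derivative.eval T⁻¹ * (T ^ 2)⁻¹ with hr
  have hder : ∀ T, T ≠ 0 → HasDerivAt (fun T => φ T - D.eval T⁻¹)
      (((p : ℝ) + 1) * T ^ p * (φ T - D.eval T⁻¹) + r T) T := fun T hT =>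
    ((hφ T).sub ((D.hasDerivAt T⁻¹).comp T (hasDerivAt_inv hT))).congr_deriv (by
      rw [hr]; ring)
  have hDlim : Tendsto (fun T : ℝ => D.eval T⁻¹) (cocompact ℝ) (𝓝 (D.eval 0)) :=
    (D.continuous.tendsto 0).comp tendsto_inv_cocompact_real
  have hlim' : Tendsto (fun T => Real.exp (-T ^ (p + 1)) * (φ T - D.eval T⁻¹)) (cocompact ℝ)
      (𝓝 0) := by
    have := hlim.sub ((tendsto_exp_neg_pow_cocompact hp).mul hDlim)
    simp only [zero_mul, sub_zero, ← mul_sub] at this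
    exact this
  have hO : (fun T => T⁻¹ ^ p * r T) =O[cocompact ℝ] fun T : ℝ => T⁻¹ ^ (N + 1) := by
    have h1 := isBigO_eval_inv_of_coeff_eq_zero _ (N + 1) (fun n hn =>
      coeff_formal_residual p e N n hn)
    refine ((he N).add h1).congr' ?_ EventuallyEq.rfl
    filter_upwards [eventually_ne_zero_cocompact_real] with T hT
    rw [← eval_truncPoly]
    simp only [Polynomial.eval_add, Polynomial.eval_mul, Polynomial.eval_C, Polynomial.eval_pow,
      Polynomial.eval_X, hr, ← hD]
    rw [pow_add T⁻¹ p 2, inv_pow, inv_pow]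
    field_simp
    ring
  obtain ⟨C, hC0, hC⟩ := hO.exists_pos
  obtain ⟨T₀, hT₀, hb⟩ := exists_forall_ge_of_eventually_cocompact hC.bound
  have hrb : ∀ T, T ≠ 0 → ‖T⁻¹ ^ p * r T‖ ≤ C * ‖T⁻¹ ^ (N + 1)‖ →
      |r T| ≤ C * (|T| ^ p * |T|⁻¹ ^ (N + 1)) := fun T hT hb => by
    have h1 : 0 < |T| ^ p := by positivity
    rw [norm_mul, norm_pow, norm_pow, norm_inv, Real.norm_eq_abs, Real.norm_eq_abs] at hb
    calc |r T| = |T| ^ p * (|T|⁻¹ ^ p * |r T|) := by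
          rw [← mul_assoc, ← mul_pow, mul_inv_cancel₀ (abs_pos.2 hT).ne', one_pow, one_mul]
      _ ≤ |T| ^ p * (C * |T|⁻¹ ^ (N + 1)) := by gcongr
      _ = _ := by ring
  rw [cocompact_eq_atBot_atTop, tendsto_sup] at hlim'
  refine IsBigO.of_bound C (eventually_cocompact_of_forall_ge (T₀ := T₀) fun T hT => ?_)
  have hT0 : 0 < T := by linarith
  simp only [← eval_truncPoly, ← hD, norm_pow, norm_inv, norm_neg, Real.norm_eq_abs]
  refine ⟨?_, ?_⟩
  · rw [abs_of_pos hT0]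
    refine abs_le_inv_pow_of_hasDerivAt (d := fun T => φ T - D.eval T⁻¹) (r := r)
      (zero_lt_one.trans_le hT₀) hC0.le (fun x hx => hder x (by linarith)) (fun x hx => ?_)
      hlim'.2 hT
    have hx0 : 0 < x := by linarith
    have := hrb x hx0.ne' (hb x hx).1
    rwa [abs_of_pos hx0] at this
  · rw [abs_of_pos hT0]
    refine abs_le_inv_pow_of_hasDerivAt (p := p) (d := fun T => φ (-T) - D.eval (-T)⁻¹) (r := fun x => -r (-x))
      (zero_lt_one.trans_le hT₀) hC0.le (fun x hx => ?_) (fun x hx => ?_) ?_ hT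
    · have := (hder (-x) (by linarith)).comp x (hasDerivAt_neg x)
      refine this.congr_deriv ?_
      rw [hp.neg_pow]
      ring
    · have hx0 : 0 < x := by linarith
      have := hrb (-x) (by linarith) (hb x hx).2
      rwa [abs_neg, abs_of_pos hx0, ← abs_neg] at this
    · refine (hlim'.1.comp tendsto_neg_atTop_atBot).congr fun x => ?_
      simp only [Function.comp, hp.add_one.neg_pow]

/-- The parameter $a$ makes the integral of $e^{-s^{p+1}}(as^L+\psi)$ over $\mathbb R$ vanish. The
solution with $e^{-T^{p+1}}\phi\to0$ at $-\infty$ then has this property at $+\infty$ as well. -/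
theorem exists_inD_solution {p L : ℕ} (hp : Odd p) (hL : Even L) (hLp : L < p) {ψ : ℝ → ℝ}
    (hψ : InDPow p ψ) : ∃ (a : ℝ) (φ : ℝ → ℝ), InD φ ∧
      ∀ T, HasDerivAt φ (((p : ℝ) + 1) * T ^ p * φ T + (a * T ^ L + ψ T)) T := by
  have hpow : InDPow p fun T => T ^ L := inDPow_pow hLp
  have hint : ∀ {h : ℝ → ℝ}, InDPow p h →
      MeasureTheory.Integrable fun s => Real.exp (-s ^ (p + 1)) * h s := fun {h} hh =>
    let ⟨_, hC⟩ := hh.exists_bound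
    integrable_exp_neg_pow_mul hp hh.1 hC
  set J := ∫ s : ℝ, Real.exp (-s ^ (p + 1)) * s ^ L with hJ
  have hJ0 : 0 < J := by
    refine (integral_exp_neg_pow_mul_pow_pos (p := p) hL).trans_le ?_
    rw [intervalIntegral.integral_of_le (by norm_num)]
    exact MeasureTheory.setIntegral_le_integral (hint hpow) (Eventually.of_forall fun s =>
      mul_nonneg (Real.exp_pos _).le (hL.pow_nonneg s))
  set a := -(∫ s, Real.exp (-s ^ (p + 1)) * ψ s) / J with ha
  set h : ℝ → ℝ := fun T => a * T ^ L + ψ T with hh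
  have hhD : InDPow p h := (hpow.const_mul a).add hψ
  set f : ℝ → ℝ := fun s => Real.exp (-s ^ (p + 1)) * h s with hf
  have hfc : Continuous f := (by fun_prop : Continuous fun s : ℝ => Real.exp (-s ^ (p + 1))).mul hhD.1
  have hfi : MeasureTheory.Integrable f := hint hhD
  have hf0 : ∫ s, f s = 0 := by
    have : ∫ s, f s = a * J + ∫ s, Real.exp (-s ^ (p + 1)) * ψ s := by
      rw [hJ, ← MeasureTheory.integral_const_mul,
        ← MeasureTheory.integral_add ((hint hpow).const_mul a) (hint hψ)]
      congr 1 with s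
      simp only [hf, hh]
      ring
    rw [this, ha, div_mul_cancel₀ _ hJ0.ne']
    ring
  -- This is $\int_{-\infty}^Tf$, split at $0$ so that the fundamental theorem of calculus applies.
  set y : ℝ → ℝ := fun T => (∫ s in Iic 0, f s) + ∫ s in (0 : ℝ)..T, f s with hy
  have hsplit := intervalIntegral.integral_Iic_add_Ioi (b := (0 : ℝ)) hfi.integrableOn hfi.integrableOn
  have hylim : Tendsto y (cocompact ℝ) (𝓝 0) := by
    rw [cocompact_eq_atBot_atTop, tendsto_sup]
    constructor
    · have := (MeasureTheory.intervalIntegral_tendsto_integral_Iic 0 hfi.integrableOn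
        tendsto_id).const_sub (∫ s in Iic 0, f s)
      rw [sub_self] at this
      refine this.congr fun T => ?_
      simp only [hy, id, intervalIntegral.integral_symm 0 T]
      ring
    · have := (MeasureTheory.intervalIntegral_tendsto_integral_Ioi 0 hfi.integrableOn
        tendsto_id).const_add (∫ s in Iic 0, f s)
      rw [hsplit, hf0] at this
      exact this
  have hEE : ∀ T : ℝ, Real.exp (-T ^ (p + 1)) * Real.exp (T ^ (p + 1)) = 1 := fun T => by
    rw [← Real.exp_add]; simp
  have hφ : ∀ T, HasDerivAt (fun T => Real.exp (T ^ (p + 1)) * y T)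
      (((p : ℝ) + 1) * T ^ p * (Real.exp (T ^ (p + 1)) * y T) + h T) T := fun T => by
    have h1 : HasDerivAt (fun T : ℝ => Real.exp (T ^ (p + 1)))
        (Real.exp (T ^ (p + 1)) * (((p : ℝ) + 1) * T ^ p)) T := by
      simpa using (hasDerivAt_pow (p + 1) T).exp
    refine (h1.mul ((hfc.integral_hasStrictDerivAt 0 T).hasDerivAt.const_add _)).congr_deriv ?_
    simp only [hf]
    linear_combination h T * hEE T
  refine ⟨a, _, inD_of_hasDerivAt hp hhD hφ (hylim.congr fun T => ?_), hφ⟩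
  rw [← mul_assoc, hEE, one_mul]

/-! ### The nonlinear boundary value problem by contraction. -/

/-- Fixed point of the linear solution operator on $\mathbb R\times C([-M,M])$. The constant $A$
comes from the a priori estimate and is chosen before $M$, so the smallness condition on $\kappa$ is
uniform as $M\to\infty$. -/
theorem exists_nonlinear_bvp_solution {p L : ℕ} (hp : Odd p) (hL : Even L) (hLp : L < p) :
    ∃ A : ℝ, 0 < A ∧ ∀ (M R κ C₁ : ℝ) (G : ℝ → ℝ → ℝ → ℝ), 1 ≤ M → 0 ≤ R → 0 ≤ κ → 0 ≤ C₁ →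
      ContinuousOn (fun q : ℝ × ℝ × ℝ => G q.1 q.2.1 q.2.2) (Icc (-M) M ×ˢ univ ×ˢ univ) →
      (∀ T ∈ Icc (-M) M, ∀ a x, |a| ≤ R → |x| ≤ R → |G T a x| ≤ C₁ * growthWeight p T) →
      (∀ T ∈ Icc (-M) M, ∀ a b x y, |a| ≤ R → |b| ≤ R → |x| ≤ R → |y| ≤ R →
        |G T a x - G T b y| ≤ κ * (|a - b| + |x - y|) * growthWeight p T) →
      A * C₁ ≤ R → 4 * A * κ ≤ 1 →
      ∃ (α : ℝ) (d : ℝ → ℝ), |α| ≤ R ∧ (∀ T ∈ Icc (-M) M, |d T| ≤ R) ∧ d (-M) = 0 ∧ d M = 0 ∧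
        ∀ T ∈ Icc (-M) M,
          HasDerivAt d (((p : ℝ) + 1) * T ^ p * d T + (α * T ^ L + G T α (d T))) T := by
  obtain ⟨A, hA, hap⟩ := exists_apriori_bound hp hL hLp
  refine ⟨A, hA, fun M R κ C₁ G hM hR hκ hC₁ hG hbound hlip hAC hAκ => ?_⟩
  have hMM : -M ≤ M := by linarith
  have hRR : -R ≤ R := by linarith
  -- The bounds on $G$ hold only for arguments of size at most $R$. Clamping makes the map globally
  -- defined, and the clamp is inactive at the fixed point because $AC_1\le R$.
  set clamp : ℝ → ℝ := fun x => (projIcc (-R) R hRR x : ℝ) with hclamp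
  have hclamp_cont : Continuous clamp := continuous_subtype_val.comp continuous_projIcc
  have hclamp_le : ∀ x, |clamp x| ≤ R := fun x => abs_le.2 (projIcc (-R) R hRR x).2
  have hclamp_eq : ∀ x, |x| ≤ R → clamp x = x := fun x hx => by
    rw [hclamp]; simp only; rw [projIcc_of_mem hRR (abs_le.1 hx)]
  have hclamp_lip : ∀ x y, |clamp x - clamp y| ≤ |x - y| := fun x y => by
    have := (LipschitzWith.projIcc hRR).dist_le_mul x y
    rw [Subtype.dist_eq, Real.dist_eq, Real.dist_eq] at this
    simpa using this
  have hproj_eq : ∀ T (hT : T ∈ Icc (-M) M), projIcc (-M) M hMM T = ⟨T, hT⟩ := fun T hT =>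
    projIcc_of_mem hMM hT
  let g : ℝ × C(Icc (-M) M, ℝ) → ℝ → ℝ := fun z T =>
    G (projIcc (-M) M hMM T) (clamp z.1) (clamp (z.2 (projIcc (-M) M hMM T)))
  have hg : ∀ z, Continuous (g z) := fun z => by
    refine hG.comp_continuous (f := fun T : ℝ => ((projIcc (-M) M hMM T : ℝ), clamp z.1,
      clamp (z.2 (projIcc (-M) M hMM T)))) ?_ fun T => ⟨(projIcc (-M) M hMM T).2, trivial, trivial⟩
    have : Continuous (projIcc (-M) M hMM) := continuous_projIcc
    fun_prop
  have hgb : ∀ z, ∀ T ∈ Icc (-M) M, |g z T| ≤ C₁ * growthWeight p T := fun z T hT => by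
    simp only [g, hproj_eq T hT]
    exact hbound T hT _ _ (hclamp_le _) (hclamp_le _)
  have hgl : ∀ z z', ∀ T ∈ Icc (-M) M,
      |g z T - g z' T| ≤ 2 * κ * dist z z' * growthWeight p T := fun z z' T hT => by
    simp only [g, hproj_eq T hT]
    refine (hlip T hT _ _ _ _ (hclamp_le _) (hclamp_le _) (hclamp_le _) (hclamp_le _)).trans ?_
    refine mul_le_mul_of_nonneg_right ?_ (growthWeight_pos p T).le
    have h1 : |z.1 - z'.1| ≤ dist z z' := (le_max_left (dist z.1 z'.1) (dist z.2 z'.2))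
    have h2 : |z.2 ⟨T, hT⟩ - z'.2 ⟨T, hT⟩| ≤ dist z z' :=
      (ContinuousMap.dist_apply_le_dist _).trans (le_max_right (dist z.1 z'.1) (dist z.2 z'.2))
    have h3 := (hclamp_lip z.1 z'.1).trans h1
    have h4 := (hclamp_lip (z.2 ⟨T, hT⟩) (z'.2 ⟨T, hT⟩)).trans h2
    nlinarith
  choose δ d hdl hdr hd using fun z => exists_linear_bvp_solution (p := p) hL (hg z) hM
  have hdc : ∀ z, Continuous (d z) := fun z =>
    continuous_iff_continuousAt.2 fun T => (hd z T).continuousAt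
  let Φ : ℝ × C(Icc (-M) M, ℝ) → ℝ × C(Icc (-M) M, ℝ) := fun z =>
    (δ z, ⟨fun T => d z T, (hdc z).comp continuous_subtype_val⟩)
  have hΦ : ContractingWith (1 / 2) Φ := by
    refine ⟨by norm_num, LipschitzWith.of_dist_le_mul fun z z' => ?_⟩
    have h := hap M (2 * κ * dist z z') 0 (δ z - δ z') (fun T => d z T - d z' T)
      (fun T => g z T - g z' T) hM (by positivity)
      (fun T _ => (((hd z T).sub (hd z' T)).congr_deriv (by ring)).hasDerivWithinAt)
      (hgl z z') (by simp [hdr]) (by simp [hdl])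
    simp only [zero_mul, add_zero] at h
    -- The $2$ on the left comes from bounding the sum of two differences by the sup distance; with
    -- $4A\kappa\le1$ the contraction factor is $1/2$.
    have h1 : A * (2 * κ * dist z z') ≤ 1 / 2 * dist z z' := by
      nlinarith [dist_nonneg (x := z) (y := z')]
    rw [Prod.dist_eq]
    push_cast
    refine max_le (h.1.trans h1) ((ContinuousMap.dist_le (by positivity)).2 fun T => ?_)
    exact (h.2 T T.2).trans h1
  set z := ContractingWith.fixedPoint Φ hΦ with hz
  have hfix : Φ z = z := hΦ.fixedPoint_isFixedPt
  have hz1 : δ z = z.1 := congrArg Prod.fst hfix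
  have hz2 : ∀ T (hT : T ∈ Icc (-M) M), d z T = z.2 ⟨T, hT⟩ := fun T hT =>
    congrArg (fun w : ℝ × C(Icc (-M) M, ℝ) => w.2 ⟨T, hT⟩) hfix
  have h := hap M C₁ 0 (δ z) (d z) (g z) hM hC₁ (fun T _ => (hd z T).hasDerivWithinAt) (hgb z)
    (by simp [hdr]) (by simp [hdl])
  simp only [zero_mul, add_zero] at h
  refine ⟨δ z, d z, h.1.trans hAC, fun T hT => (h.2 T hT).trans hAC, hdl z, hdr z, fun T hT => ?_⟩
  have h1 : g z T = G T (δ z) (d z T) := by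
    simp only [g, hproj_eq T hT]
    rw [← hz2 T hT, ← hz1, hclamp_eq _ (h.1.trans hAC), hclamp_eq _ ((h.2 T hT).trans hAC)]
  exact h1 ▸ hd z T

/-! ### Hadamard's lemma and smooth extension in one variable. -/

theorem hasDerivAt_integral_pow_mul_comp_mul {g : ℝ → ℝ} (hg : ContDiff ℝ ∞ g) (m : ℕ) (t : ℝ) :
    HasDerivAt (fun t => ∫ s in (0 : ℝ)..1, s ^ m * g (s * t))
      (∫ s in (0 : ℝ)..1, s ^ (m + 1) * deriv g (s * t)) t := by
  have hgc : Continuous g := hg.continuous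
  have hdc : Continuous (deriv g) := (contDiff_infty_iff_deriv.1 hg).2.continuous
  obtain ⟨C, hC⟩ := (isCompact_Icc (a := -(|t| + 1)) (b := |t| + 1)).exists_bound_of_continuousOn
    hdc.continuousOn
  refine (intervalIntegral.hasDerivAt_integral_of_dominated_loc_of_deriv_le
    (F' := fun t s => s ^ (m + 1) * deriv g (s * t)) (bound := fun _ => C)
    (Metric.ball_mem_nhds t one_pos) (Eventually.of_forall fun x => ?_) ?_ ?_ ?_ ?_ ?_).2
  · exact (by fun_prop : Continuous fun s => s ^ m * g (s * x)).aestronglyMeasurable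
  · exact (by fun_prop : Continuous fun s => s ^ m * g (s * t)).intervalIntegrable _ _
  · exact (by fun_prop : Continuous fun s => s ^ (m + 1) * deriv g (s * t)).aestronglyMeasurable
  · refine Eventually.of_forall fun s hs x hx => ?_
    rw [uIoc_of_le zero_le_one] at hs
    have hx' : |x| ≤ |t| + 1 := by
      have h1 : |x - t| < 1 := hx
      linarith [abs_sub_abs_le_abs_sub x t]
    have h2 : |s * x| ≤ |t| + 1 := by
      rw [abs_mul, abs_of_pos hs.1]
      nlinarith [abs_nonneg x, hs.2, hs.1]
    rw [norm_mul, norm_pow, Real.norm_eq_abs, abs_of_pos hs.1]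
    have h3 := hC _ (abs_le.1 h2)
    calc s ^ (m + 1) * ‖deriv g (s * x)‖ ≤ 1 * ‖deriv g (s * x)‖ := by
          gcongr
          exact pow_le_one₀ hs.1.le hs.2
      _ ≤ C := by rw [one_mul]; exact h3
  · exact intervalIntegrable_const
  · refine Eventually.of_forall fun s _ x _ => ?_
    have h1 : HasDerivAt g (deriv g (s * x)) (s * x) :=
      ((contDiff_infty_iff_deriv.1 hg).1 (s * x)).hasDerivAt
    have h2 : HasDerivAt (fun x : ℝ => s * x) s x := by simpa using (hasDerivAt_id x).const_mul s
    refine ((h1.comp x h2).const_mul (s ^ m)).congr_deriv ?_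
    ring

/-- The derivative is an integral of the same kind, with `deriv g` and $m+1$; hence the induction
generalizes over both. -/
theorem contDiff_integral_pow_mul_comp_mul {g : ℝ → ℝ} (hg : ContDiff ℝ ∞ g) (m : ℕ) :
    ContDiff ℝ ∞ fun t => ∫ s in (0 : ℝ)..1, s ^ m * g (s * t) := by
  refine contDiff_infty.2 fun n => ?_
  induction n generalizing g m with
  | zero =>
    exact contDiff_zero.2 (continuous_iff_continuousAt.2 fun t =>
      (hasDerivAt_integral_pow_mul_comp_mul hg m t).continuousAt)
  | succ n ih =>
    push_cast
    refine contDiff_succ_iff_deriv.2 ⟨fun t =>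
      (hasDerivAt_integral_pow_mul_comp_mul hg m t).differentiableAt, by simp, ?_⟩
    rw [funext fun t => (hasDerivAt_integral_pow_mul_comp_mul hg m t).deriv]
    exact ih (contDiff_infty_iff_deriv.1 hg).2 (m + 1)

/-- Hadamard's lemma in one variable. -/
theorem ContDiff.exists_eq_add_mul {U : ℝ → ℝ} (hU : ContDiff ℝ ∞ U) :
    ∃ W : ℝ → ℝ, ContDiff ℝ ∞ W ∧ ∀ t, U t = U 0 + t * W t := by
  obtain ⟨hd, hd'⟩ := contDiff_infty_iff_deriv.1 hU
  refine ⟨_, contDiff_integral_pow_mul_comp_mul hd' 0, fun t => ?_⟩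
  have h1 : ∫ s in (0 : ℝ)..1, t * deriv U (s * t) = U (1 * t) - U (0 * t) := by
    refine intervalIntegral.integral_eq_sub_of_hasDerivAt (f := fun s => U (s * t)) (fun s _ => ?_)
      ((by have := hd'.continuous; fun_prop : Continuous fun s => t * deriv U (s * t)).intervalIntegrable _ _)
    have h2 : HasDerivAt (fun s : ℝ => s * t) t s := by
      simpa using (hasDerivAt_id s).mul_const t
    exact ((hd (s * t)).hasDerivAt.comp s h2).congr_deriv (mul_comm _ _)
  rw [intervalIntegral.integral_const_mul, one_mul, zero_mul] at h1
  simp only [pow_zero, one_mul]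
  linarith

/-- Multiplication by a bump function. At the price of a smaller interval, outer coefficients can be
taken smooth on all of $\mathbb R$. -/
theorem ContDiffOn.exists_contDiff_eqOn {f : ℝ → ℝ} {a b : ℝ} (hf : ContDiffOn ℝ ∞ f (Icc (-a) a))
    (hb : 0 < b) (hba : b < a) : ∃ U : ℝ → ℝ, ContDiff ℝ ∞ U ∧ EqOn U f (Icc (-b) b) := by
  let χ : ContDiffBump (0 : ℝ) := ⟨b, (a + b) / 2, hb, by linarith⟩
  refine ⟨fun x => χ x * f x, contDiff_iff_contDiffAt.2 fun x => ?_, fun x hx => ?_⟩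
  · by_cases hx : x ∈ Ioo (-a) a
    · exact χ.contDiffAt.mul (hf.contDiffAt (Icc_mem_nhds hx.1 hx.2))
    · have hxa : a ≤ |x| := by
        by_contra h
        exact hx (abs_lt.1 (not_le.1 h))
      have h1 : ∀ᶠ y in 𝓝 x, (a + b) / 2 < |y| :=
        continuous_abs.continuousAt.eventually (lt_mem_nhds (by linarith))
      refine (contDiffAt_const (c := (0 : ℝ))).congr_of_eventuallyEq ?_
      filter_upwards [h1] with y hy
      rw [χ.zero_of_le_dist (by simpa using hy.le), zero_mul]
  · beta_reduce
    rw [χ.one_of_mem_closedBall (by simpa using abs_le.2 hx), one_mul]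

/-! ### The algebra of composite expansions. -/

/-- `α η = a₀ + a₁ η + ⋯ + O(η^n)` as `η → 0⁺`, in recursive form. -/
def ScalarExpansion : ℕ → (ℝ → ℝ) → Prop
  | 0, α => ∃ C, ∀ᶠ η in 𝓝[>] (0 : ℝ), |α η| ≤ C
  | n + 1, α => ∃ (a : ℝ) (β : ℝ → ℝ), ScalarExpansion n β ∧
      ∀ᶠ η in 𝓝[>] (0 : ℝ), α η = a + η * β η

/-- `f η t = ∑_{k < n} (U k t + φ k (t/η)) η^k + O(η^n)` uniformly on `[-τ, τ]`, in recursive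
form. -/
def CompositeExpansion (τ : ℝ) : ℕ → (ℝ → ℝ → ℝ) → Prop
  | 0, f => ∃ C, ∀ᶠ η in 𝓝[>] (0 : ℝ), ∀ t ∈ Icc (-τ) τ, |f η t| ≤ C
  | n + 1, f => ∃ (U φ : ℝ → ℝ) (g : ℝ → ℝ → ℝ), ContDiff ℝ ∞ U ∧ InD φ ∧
      CompositeExpansion τ n g ∧
      ∀ᶠ η in 𝓝[>] (0 : ℝ), ∀ t ∈ Icc (-τ) τ, f η t = U t + φ (t / η) + η * g η t

/-- `g η t = ∑_{k < n} ((t/η)^p V k t + ψ k (t/η)) η^k + O(η^n (1 + |t/η|^p))` uniformly on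
`[-τ, τ]`, in recursive form. -/
def SourceExpansion (p : ℕ) (τ : ℝ) : ℕ → (ℝ → ℝ → ℝ) → Prop
  | 0, g => ∃ C, ∀ᶠ η in 𝓝[>] (0 : ℝ), ∀ t ∈ Icc (-τ) τ, |g η t| ≤ C * growthWeight p (t / η)
  | n + 1, g => ∃ (V ψ : ℝ → ℝ) (h : ℝ → ℝ → ℝ), ContDiff ℝ ∞ V ∧ InDPow p ψ ∧
      SourceExpansion p τ n h ∧
      ∀ᶠ η in 𝓝[>] (0 : ℝ), ∀ t ∈ Icc (-τ) τ,
        g η t = (t / η) ^ p * V t + ψ (t / η) + η * h η t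

theorem eventually_pos_nhdsGT_zero : ∀ᶠ η in 𝓝[>] (0 : ℝ), 0 < η := self_mem_nhdsWithin

theorem eventually_lt_nhdsGT_zero {a : ℝ} (ha : 0 < a) : ∀ᶠ η in 𝓝[>] (0 : ℝ), η < a :=
  mem_nhdsWithin_of_mem_nhds (gt_mem_nhds ha)

theorem ScalarExpansion.add_of_abs_le {n : ℕ} {α β : ℝ → ℝ} (hα : ScalarExpansion n α) {C : ℝ}
    (h : ∀ᶠ η in 𝓝[>] (0 : ℝ), |β η - α η| ≤ C * η ^ n) : ScalarExpansion n β := by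
  induction n generalizing α β with
  | zero =>
    obtain ⟨D, hD⟩ := hα
    refine ⟨C + D, ?_⟩
    filter_upwards [hD, h] with η h1 h2
    rw [pow_zero, mul_one] at h2
    linarith [abs_sub_abs_le_abs_sub (β η) (α η)]
  | succ n ih =>
    obtain ⟨a, γ, hγ, h1⟩ := hα
    refine ⟨a, fun η => (β η - a) / η, ih hγ ?_, ?_⟩
    · filter_upwards [h1, h, eventually_pos_nhdsGT_zero] with η h1 h2 h3
      have : (β η - a) / η - γ η = (β η - α η) / η := by rw [h1]; field_simp; ring
      rw [this, abs_div, abs_of_pos h3, div_le_iff₀ h3]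
      exact h2.trans_eq (by ring)
    · filter_upwards [eventually_pos_nhdsGT_zero] with η h3
      field_simp
      ring

theorem CompositeExpansion.congr {τ : ℝ} {n : ℕ} {f g : ℝ → ℝ → ℝ} (hf : CompositeExpansion τ n f)
    (h : ∀ᶠ η in 𝓝[>] (0 : ℝ), ∀ t ∈ Icc (-τ) τ, g η t = f η t) : CompositeExpansion τ n g := by
  cases n with
  | zero =>
    obtain ⟨C, hC⟩ := hf
    exact ⟨C, by filter_upwards [hC, h] with η h1 h2 t ht; rw [h2 t ht]; exact h1 t ht⟩
  | succ n =>
    obtain ⟨U, φ, f', hU, hφ, hf', h1⟩ := hf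
    exact ⟨U, φ, f', hU, hφ, hf', by
      filter_upwards [h1, h] with η h1 h2 t ht; rw [h2 t ht]; exact h1 t ht⟩

theorem CompositeExpansion.mono {σ τ : ℝ} (hτ : τ ≤ σ) {n : ℕ} {f : ℝ → ℝ → ℝ}
    (hf : CompositeExpansion σ n f) : CompositeExpansion τ n f := by
  have hsub : Icc (-τ) τ ⊆ Icc (-σ) σ := Icc_subset_Icc (neg_le_neg hτ) hτ
  induction n generalizing f with
  | zero =>
    obtain ⟨C, hC⟩ := hf
    exact ⟨C, hC.mono fun η h t ht => h t (hsub ht)⟩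
  | succ n ih =>
    obtain ⟨U, φ, g, hU, hφ, hg, h⟩ := hf
    exact ⟨U, φ, g, hU, hφ, ih hg, h.mono fun η h t ht => h t (hsub ht)⟩

theorem CompositeExpansion.of_abs_le {τ : ℝ} {n : ℕ} {f : ℝ → ℝ → ℝ} {C : ℝ}
    (h : ∀ᶠ η in 𝓝[>] (0 : ℝ), ∀ t ∈ Icc (-τ) τ, |f η t| ≤ C * η ^ n) :
    CompositeExpansion τ n f := by
  induction n generalizing f with
  | zero => exact ⟨C, by simpa using h⟩
  | succ n ih =>
    refine ⟨fun _ => 0, fun _ => 0, fun η t => f η t / η, contDiff_const, InD.zero, ih ?_, ?_⟩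
    · filter_upwards [h, eventually_pos_nhdsGT_zero] with η h1 h2 t ht
      rw [abs_div, abs_of_pos h2, div_le_iff₀ h2]
      exact (h1 t ht).trans_eq (by ring)
    · filter_upwards [eventually_pos_nhdsGT_zero] with η h2 t ht
      field_simp
      ring

theorem CompositeExpansion.zero {τ : ℝ} {n : ℕ} : CompositeExpansion τ n fun _ _ => 0 :=
  CompositeExpansion.of_abs_le (C := 0) (Eventually.of_forall fun η t _ => by simp)

theorem exists_bound_add_inD {τ : ℝ} {U φ : ℝ → ℝ} (hU : ContDiff ℝ ∞ U) (hφ : InD φ) :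
    ∃ C, ∀ (η : ℝ), ∀ t ∈ Icc (-τ) τ, |U t + φ (t / η)| ≤ C := by
  obtain ⟨C, hC⟩ := (isCompact_Icc (a := -τ) (b := τ)).exists_bound_of_continuousOn
    hU.continuous.continuousOn
  obtain ⟨D, hD⟩ := hφ.exists_bound
  exact ⟨C + D, fun η t ht => (abs_add_le _ _).trans (add_le_add (hC t ht) (hD _))⟩

theorem CompositeExpansion.of_succ {τ : ℝ} {n : ℕ} {f : ℝ → ℝ → ℝ}
    (hf : CompositeExpansion τ (n + 1) f) : CompositeExpansion τ n f := by
  induction n generalizing f with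
  | zero =>
    obtain ⟨U, φ, g, hU, hφ, ⟨C, hC⟩, h⟩ := hf
    obtain ⟨D, hD⟩ := exists_bound_add_inD (τ := τ) hU hφ
    refine ⟨D + C, ?_⟩
    filter_upwards [h, hC, eventually_pos_nhdsGT_zero, eventually_lt_nhdsGT_zero one_pos]
      with η h1 h2 h3 h4 t ht
    rw [h1 t ht]
    refine (abs_add_le _ _).trans (add_le_add (hD η t ht) ?_)
    rw [abs_mul, abs_of_pos h3]
    exact (mul_le_of_le_one_left (abs_nonneg _) h4.le).trans (h2 t ht)
  | succ n ih =>
    obtain ⟨U, φ, g, hU, hφ, hg, h⟩ := hf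
    exact ⟨U, φ, g, hU, hφ, ih hg, h⟩

theorem CompositeExpansion.add {τ : ℝ} {n : ℕ} {f g : ℝ → ℝ → ℝ} (hf : CompositeExpansion τ n f)
    (hg : CompositeExpansion τ n g) : CompositeExpansion τ n fun η t => f η t + g η t := by
  induction n generalizing f g with
  | zero =>
    obtain ⟨C, hC⟩ := hf
    obtain ⟨D, hD⟩ := hg
    exact ⟨C + D, by
      filter_upwards [hC, hD] with η h1 h2 t ht
      exact (abs_add_le _ _).trans (add_le_add (h1 t ht) (h2 t ht))⟩
  | succ n ih =>
    obtain ⟨U, φ, f', hU, hφ, hf', h1⟩ := hf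
    obtain ⟨V, ψ, g', hV, hψ, hg', h2⟩ := hg
    refine ⟨fun t => U t + V t, fun T => φ T + ψ T, _, hU.add hV, hφ.add hψ, ih hf' hg', ?_⟩
    filter_upwards [h1, h2] with η h1 h2 t ht
    rw [h1 t ht, h2 t ht]
    ring

theorem CompositeExpansion.eta_mul {τ : ℝ} {n : ℕ} {f : ℝ → ℝ → ℝ}
    (hf : CompositeExpansion τ n f) : CompositeExpansion τ (n + 1) fun η t => η * f η t :=
  ⟨fun _ => 0, fun _ => 0, f, contDiff_const, InD.zero, hf, Eventually.of_forall fun η t _ => by simp⟩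

theorem CompositeExpansion.of_contDiff {τ : ℝ} {n : ℕ} {U : ℝ → ℝ} (hU : ContDiff ℝ ∞ U) :
    CompositeExpansion τ n fun _ t => U t := by
  refine of_succ ⟨U, fun _ => 0, _, hU, InD.zero, zero, Eventually.of_forall fun η t _ => by simp⟩

theorem CompositeExpansion.of_inD {τ : ℝ} {n : ℕ} {φ : ℝ → ℝ} (hφ : InD φ) :
    CompositeExpansion τ n fun η t => φ (t / η) := by
  refine of_succ ⟨fun _ => 0, φ, _, contDiff_const, hφ, zero,
    Eventually.of_forall fun η t _ => by simp⟩

/-- With $U=U(0)+tW$ and $T\phi=c+\chi$, $\chi\in\mathcal D$, one has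
$U\phi=U(0)\phi+\eta(W\chi+cW)$: the mixed product reappears one order higher, next to a purely
outer term. -/
theorem CompositeExpansion.contDiff_mul_inD {τ : ℝ} {n : ℕ} {U φ : ℝ → ℝ} (hU : ContDiff ℝ ∞ U)
    (hφ : InD φ) : CompositeExpansion τ n fun η t => U t * φ (t / η) := by
  refine of_succ ?_
  induction n generalizing U φ with
  | zero =>
    obtain ⟨W, hW, hUW⟩ := hU.exists_eq_add_mul
    obtain ⟨c, hc⟩ := hφ.exists_mul_sub
    obtain ⟨C, hC⟩ := exists_bound_add_inD (τ := τ) hW InD.zero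
    obtain ⟨D, hD⟩ := hc.exists_bound
    refine ⟨fun _ => 0, fun T => U 0 * φ T, fun η t => W t * ((t / η * φ (t / η) - c) + c),
      contDiff_const, hφ.const_mul _, ⟨C * (D + |c|), ?_⟩, ?_⟩
    · refine Eventually.of_forall fun η t ht => ?_
      have h1 := hC η t ht
      rw [add_zero] at h1
      rw [abs_mul]
      exact mul_le_mul h1 ((abs_add_le _ _).trans (add_le_add_left (hD _) _)) (abs_nonneg _)
        ((abs_nonneg _).trans h1)
    · filter_upwards [eventually_pos_nhdsGT_zero] with η h2 t ht
      rw [hUW t]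
      field_simp
      ring
  | succ n ih =>
    obtain ⟨W, hW, hUW⟩ := hU.exists_eq_add_mul
    obtain ⟨c, hc⟩ := hφ.exists_mul_sub
    refine ⟨fun _ => 0, fun T => U 0 * φ T, _,
      contDiff_const, hφ.const_mul _, (ih hW hc).add (of_contDiff (hW.mul (contDiff_const (c := c)))),
      ?_⟩
    filter_upwards [eventually_pos_nhdsGT_zero] with η h2 t ht
    rw [hUW t]
    field_simp
    ring

theorem CompositeExpansion.mul {τ : ℝ} {n : ℕ} {f g : ℝ → ℝ → ℝ} (hf : CompositeExpansion τ n f)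
    (hg : CompositeExpansion τ n g) : CompositeExpansion τ n fun η t => f η t * g η t := by
  induction n generalizing f g with
  | zero =>
    obtain ⟨C, hC⟩ := hf
    obtain ⟨D, hD⟩ := hg
    refine ⟨C * D, ?_⟩
    filter_upwards [hC, hD] with η h1 h2 t ht
    rw [abs_mul]
    exact mul_le_mul (h1 t ht) (h2 t ht) (abs_nonneg _) ((abs_nonneg _).trans (h1 t ht))
  | succ n ih =>
    have hg0 := hg.of_succ
    obtain ⟨U, φ, f', hU, hφ, hf', h1⟩ := hf
    obtain ⟨V, ψ, g', hV, hψ, hg', h2⟩ := hg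
    have hmain : CompositeExpansion τ (n + 1) fun η t =>
        (U t * V t + φ (t / η) * ψ (t / η)) + (U t * ψ (t / η) + V t * φ (t / η)) :=
      ((of_contDiff (hU.mul hV)).add (of_inD (hφ.mul hψ))).add
        ((contDiff_mul_inD hU hψ).add (contDiff_mul_inD hV hφ))
    -- The cross terms $f'g$ and $(U+\phi)g'$ already carry a factor $\eta$, so $g$ is needed only
    -- to order $n$.
    have hrest := ((ih hf' hg0).add (ih ((of_contDiff hU).add (of_inD hφ)) hg')).eta_mul
    refine (hmain.add hrest).congr ?_
    filter_upwards [h1, h2] with η h1 h2 t ht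
    rw [h1 t ht, h2 t ht]
    ring

theorem CompositeExpansion.pow {τ : ℝ} {n : ℕ} {f : ℝ → ℝ → ℝ} (hf : CompositeExpansion τ n f)
    (k : ℕ) : CompositeExpansion τ n fun η t => f η t ^ k := by
  induction k with
  | zero => simpa using of_contDiff (τ := τ) (n := n) (U := fun _ => 1) contDiff_const
  | succ k ih => simpa only [pow_succ] using ih.mul hf

theorem CompositeExpansion.sum {τ : ℝ} {n : ℕ} {ι : Type*} (s : Finset ι) {f : ι → ℝ → ℝ → ℝ}
    (hf : ∀ i ∈ s, CompositeExpansion τ n (f i)) :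
    CompositeExpansion τ n fun η t => ∑ i ∈ s, f i η t := by
  classical
  induction s using Finset.induction_on with
  | empty => simpa using zero
  | insert i s hi ih =>
    simp only [Finset.sum_insert hi]
    exact (hf i (Finset.mem_insert_self i s)).add
      (ih fun j hj => hf j (Finset.mem_insert_of_mem hj))

theorem CompositeExpansion.eta_pow {τ : ℝ} {n : ℕ} (k : ℕ) :
    CompositeExpansion τ n fun η _ => η ^ k := by
  have h1 : CompositeExpansion τ n fun η _ => η * 1 :=
    of_succ (of_contDiff (U := fun _ => 1) contDiff_const).eta_mul
  simpa using h1.pow k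

theorem ScalarExpansion.compositeExpansion {τ : ℝ} {n : ℕ} {α : ℝ → ℝ}
    (hα : ScalarExpansion n α) : CompositeExpansion τ n fun η _ => α η := by
  induction n generalizing α with
  | zero =>
    obtain ⟨C, hC⟩ := hα
    exact ⟨C, hC.mono fun η h t _ => h⟩
  | succ n ih =>
    obtain ⟨a, β, hβ, h⟩ := hα
    exact ⟨fun _ => a, fun _ => 0, _, contDiff_const, InD.zero, ih hβ, h.mono fun η h t _ => by
      simpa using h⟩

theorem SourceExpansion.congr {p : ℕ} {τ : ℝ} {n : ℕ} {f g : ℝ → ℝ → ℝ}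
    (hf : SourceExpansion p τ n f)
    (h : ∀ᶠ η in 𝓝[>] (0 : ℝ), ∀ t ∈ Icc (-τ) τ, g η t = f η t) : SourceExpansion p τ n g := by
  cases n with
  | zero =>
    obtain ⟨C, hC⟩ := hf
    exact ⟨C, by filter_upwards [hC, h] with η h1 h2 t ht; rw [h2 t ht]; exact h1 t ht⟩
  | succ n =>
    obtain ⟨U, φ, f', hU, hφ, hf', h1⟩ := hf
    exact ⟨U, φ, f', hU, hφ, hf', by
      filter_upwards [h1, h] with η h1 h2 t ht; rw [h2 t ht]; exact h1 t ht⟩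

theorem SourceExpansion.of_abs_le {p : ℕ} {τ : ℝ} {n : ℕ} {f : ℝ → ℝ → ℝ} {C : ℝ}
    (h : ∀ᶠ η in 𝓝[>] (0 : ℝ), ∀ t ∈ Icc (-τ) τ,
      |f η t| ≤ C * η ^ n * growthWeight p (t / η)) : SourceExpansion p τ n f := by
  induction n generalizing f with
  | zero => exact ⟨C, by simpa using h⟩
  | succ n ih =>
    refine ⟨fun _ => 0, fun _ => 0, fun η t => f η t / η, contDiff_const, InDPow.zero, ih ?_, ?_⟩
    · filter_upwards [h, eventually_pos_nhdsGT_zero] with η h1 h2 t ht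
      rw [abs_div, abs_of_pos h2, div_le_iff₀ h2]
      exact (h1 t ht).trans_eq (by ring)
    · filter_upwards [eventually_pos_nhdsGT_zero] with η h2 t ht
      field_simp
      ring

theorem SourceExpansion.zero {p : ℕ} {τ : ℝ} {n : ℕ} : SourceExpansion p τ n fun _ _ => 0 :=
  SourceExpansion.of_abs_le (C := 0) (Eventually.of_forall fun η t _ => by simp)

theorem SourceExpansion.add {p : ℕ} {τ : ℝ} {n : ℕ} {f g : ℝ → ℝ → ℝ}
    (hf : SourceExpansion p τ n f) (hg : SourceExpansion p τ n g) :
    SourceExpansion p τ n fun η t => f η t + g η t := by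
  induction n generalizing f g with
  | zero =>
    obtain ⟨C, hC⟩ := hf
    obtain ⟨D, hD⟩ := hg
    refine ⟨C + D, ?_⟩
    filter_upwards [hC, hD] with η h1 h2 t ht
    rw [add_mul]
    exact (abs_add_le _ _).trans (add_le_add (h1 t ht) (h2 t ht))
  | succ n ih =>
    obtain ⟨U, φ, f', hU, hφ, hf', h1⟩ := hf
    obtain ⟨V, ψ, g', hV, hψ, hg', h2⟩ := hg
    refine ⟨fun t => U t + V t, fun T => φ T + ψ T, _, hU.add hV, hφ.add hψ, ih hf' hg', ?_⟩
    filter_upwards [h1, h2] with η h1 h2 t ht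
    rw [h1 t ht, h2 t ht]
    ring

theorem SourceExpansion.eta_mul {p : ℕ} {τ : ℝ} {n : ℕ} {f : ℝ → ℝ → ℝ}
    (hf : SourceExpansion p τ n f) : SourceExpansion p τ (n + 1) fun η t => η * f η t :=
  ⟨fun _ => 0, fun _ => 0, f, contDiff_const, InDPow.zero, hf,
    Eventually.of_forall fun η t _ => by simp⟩

theorem SourceExpansion.sum {p : ℕ} {τ : ℝ} {n : ℕ} {ι : Type*} (s : Finset ι)
    {f : ι → ℝ → ℝ → ℝ} (hf : ∀ i ∈ s, SourceExpansion p τ n (f i)) :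
    SourceExpansion p τ n fun η t => ∑ i ∈ s, f i η t := by
  classical
  induction s using Finset.induction_on with
  | empty => simpa using zero
  | insert i s hi ih =>
    simp only [Finset.sum_insert hi]
    exact (hf i (Finset.mem_insert_self i s)).add
      (ih fun j hj => hf j (Finset.mem_insert_of_mem hj))

/-- For $i<p$, $T^iU(t)=U(0)T^i+\eta\,T^{i+1}W(t)$, where $T^i$ is an admissible inner term; the
exponent climbs with the order until $i=p$, where $T^pU(t)$ is itself an admissible outer term. -/
theorem CompositeExpansion.pow_mul {p i : ℕ} (hi : i ≤ p) {τ : ℝ} {n : ℕ} {f : ℝ → ℝ → ℝ}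
    (hf : CompositeExpansion τ n f) : SourceExpansion p τ n fun η t => (t / η) ^ i * f η t := by
  have base : ∀ {i : ℕ} {f : ℝ → ℝ → ℝ}, i ≤ p → CompositeExpansion τ 0 f →
      SourceExpansion p τ 0 fun η t => (t / η) ^ i * f η t := by
    rintro i f hi ⟨C, hC⟩
    refine ⟨C, hC.mono fun η h t ht => ?_⟩
    rw [abs_mul, abs_pow, mul_comm]
    exact mul_le_mul (h t ht) (abs_pow_le_growthWeight hi _) (by positivity)
      ((abs_nonneg _).trans (h t ht))
  have smooth : ∀ (n i : ℕ) (U : ℝ → ℝ), i ≤ p → ContDiff ℝ ∞ U →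
      SourceExpansion p τ n fun η t => (t / η) ^ i * U t := by
    intro n
    induction n with
    | zero => exact fun i U hi hU => base hi (of_contDiff hU)
    | succ n ih =>
      intro i U hi hU
      rcases hi.lt_or_eq with hlt | rfl
      · obtain ⟨W, hW, hUW⟩ := hU.exists_eq_add_mul
        refine ⟨fun _ => 0, fun T => U 0 * T ^ i, _, contDiff_const, (inDPow_pow hlt).const_mul _,
          ih (i + 1) W hlt hW, ?_⟩
        filter_upwards [eventually_pos_nhdsGT_zero] with η h2 t ht
        rw [hUW t, pow_succ]
        field_simp
        ring
      · exact ⟨U, fun _ => 0, _, hU, InDPow.zero, SourceExpansion.zero,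
          Eventually.of_forall fun η t _ => by simp⟩
  induction n generalizing f with
  | zero => exact base hi hf
  | succ n ih =>
    obtain ⟨U, φ, g, hU, hφ, hg, h⟩ := hf
    have h1 : SourceExpansion p τ (n + 1) fun η t => (t / η) ^ i * φ (t / η) :=
      ⟨fun _ => 0, _, _, contDiff_const, hφ.pow_mul hi, SourceExpansion.zero,
        Eventually.of_forall fun η t _ => by simp⟩
    refine (((smooth (n + 1) i U hi hU).add h1).add (ih hg).eta_mul).congr ?_
    filter_upwards [h] with η h t ht
    rw [h t ht]
    ring

theorem CompositeExpansion.sourceExpansion {p : ℕ} {τ : ℝ} {n : ℕ} {f : ℝ → ℝ → ℝ}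
    (hf : CompositeExpansion τ n f) : SourceExpansion p τ n f := by
  simpa using hf.pow_mul (Nat.zero_le p)

/-! ### Approximate solutions of the linear equation. -/

/-- Approximate solutions of the linear equation, to any order, within composite expansions. -/
theorem SourceExpansion.exists_approx_solution {p L : ℕ} (hp : Odd p) (hL : Even L) (hLp : L < p)
    {τ : ℝ} {n : ℕ} {g : ℝ → ℝ → ℝ} (hg : SourceExpansion p τ n g) :
    ∃ (b : ℝ → ℝ) (v v' : ℝ → ℝ → ℝ), ScalarExpansion n b ∧ CompositeExpansion τ n v ∧
      (∀ η, 0 < η → ∀ t, HasDerivAt (v η) (v' η t) t) ∧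
      ∃ C, ∀ᶠ η in 𝓝[>] (0 : ℝ), ∀ t ∈ Icc (-τ) τ,
        |η * v' η t - ((p : ℝ) + 1) * (t / η) ^ p * v η t - b η * (t / η) ^ L - g η t|
          ≤ C * η ^ n * growthWeight p (t / η) := by
  induction n generalizing g with
  | zero =>
    obtain ⟨C, hC⟩ := hg
    refine ⟨fun _ => 0, fun _ _ => 0, fun _ _ => 0, ⟨0, by simp⟩, CompositeExpansion.zero,
      fun η _ t => hasDerivAt_const _ _, C, hC.mono fun η h t ht => ?_⟩
    simpa using h t ht
  | succ n ih =>
    obtain ⟨V, ψ, h, hV, hψ, hh, hg⟩ := hg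
    obtain ⟨a, φ, hφ, hφ'⟩ := exists_inD_solution hp hL hLp hψ
    have hp1 : (p : ℝ) + 1 ≠ 0 := by positivity
    obtain ⟨hVd, hVs⟩ := contDiff_infty_iff_deriv.1 hV
    -- The outer term $-V/(p+1)$ cancels $T^pV$ but leaves $-\eta V'/(p+1)$, which is passed to the
    -- source of the next order.
    have hsrc : SourceExpansion p τ n fun η t => h η t + ((p : ℝ) + 1)⁻¹ * deriv V t :=
      hh.add (CompositeExpansion.of_contDiff (contDiff_const.mul hVs)).sourceExpansion
    obtain ⟨b, v, v', hb, hv, hv', C, hC⟩ := ih hsrc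
    refine ⟨fun η => a + η * b η, fun η t => -((p : ℝ) + 1)⁻¹ * V t + φ (t / η) + η * v η t,
      fun η t => -((p : ℝ) + 1)⁻¹ * deriv V t
        + (((p : ℝ) + 1) * (t / η) ^ p * φ (t / η) + (a * (t / η) ^ L + ψ (t / η))) * η⁻¹
        + η * v' η t, ⟨a, b, hb, Eventually.of_forall fun η => rfl⟩,
      ⟨_, φ, v, contDiff_const.mul hV, hφ, hv, Eventually.of_forall fun η t _ => rfl⟩,
      fun η hη t => ?_, C, ?_⟩
    · have h1 : HasDerivAt (fun t : ℝ => t / η) η⁻¹ t := by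
        simpa using (hasDerivAt_id t).div_const η
      exact (((hVd t).hasDerivAt.const_mul _).add ((hφ' (t / η)).comp t h1)).add
        ((hv' η hη t).const_mul η)
    · filter_upwards [hC, hg, eventually_pos_nhdsGT_zero] with η h1 h2 h3 t ht
      rw [h2 t ht]
      have h4 := mul_le_mul_of_nonneg_left (h1 t ht) h3.le
      rw [← abs_of_pos h3, ← abs_mul, abs_of_pos h3] at h4
      refine (le_of_eq ?_).trans (h4.trans_eq (by ring))
      congr 1
      field_simp
      ring

/-! ### Directional Taylor expansion and composition with smooth functions. -/

section DirectionalTaylor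

variable {E : Type*} [NormedAddCommGroup E] [NormedSpace ℝ E]

/-- The derivative of `F` within `s` in the direction `e`. -/
noncomputable def dirDerivWithin (s : Set E) (e : E) (F : E → ℝ) (q : E) : ℝ :=
  fderivWithin ℝ F s q e

theorem ContDiffOn.dirDerivWithin {s : Set E} (hs : UniqueDiffOn ℝ s) {F : E → ℝ}
    (hF : ContDiffOn ℝ ∞ F s) (e : E) : ContDiffOn ℝ ∞ (dirDerivWithin s e F) s :=
  (hF.fderivWithin hs (by simp)).clm_apply contDiffOn_const

theorem ContDiffOn.iterate_dirDerivWithin {s : Set E} (hs : UniqueDiffOn ℝ s) {F : E → ℝ}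
    (hF : ContDiffOn ℝ ∞ F s) (e : E) (k : ℕ) :
    ContDiffOn ℝ ∞ ((_root_.dirDerivWithin s e)^[k] F) s := by
  induction k generalizing F with
  | zero => exact hF
  | succ k ih => exact ih (hF.dirDerivWithin hs e)

theorem hasDerivWithinAt_comp_add_smul {s : Set E} {F : E → ℝ} (hF : ContDiffOn ℝ ∞ F s)
    {q e : E} {h x : ℝ} {I : Set ℝ} (hI : ∀ y ∈ I, q + y • h • e ∈ s) (hx : x ∈ I) :
    HasDerivWithinAt (fun y : ℝ => F (q + y • h • e))
      (h * dirDerivWithin s e F (q + x • h • e)) I x := by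
  have h1 : HasDerivWithinAt (fun y : ℝ => q + y • h • e) (h • e) I x := by
    simpa using (((hasDerivAt_id x).smul_const (h • e)).const_add q).hasDerivWithinAt
  have h2 := ((hF.differentiableOn (by simp)) _ (hI x hx)).hasFDerivWithinAt
  have h3 := HasFDerivWithinAt.comp_hasDerivWithinAt x h2 h1 hI
  simpa [dirDerivWithin, Function.comp_def] using h3

theorem hasDerivAt_taylor_sum (a : ℕ → ℝ) (n : ℕ) (h x : ℝ) :
    HasDerivAt (fun x : ℝ => ∑ i ∈ Finset.range (n + 1), a i * (x * h) ^ i / (i.factorial : ℝ))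
      (h * ∑ i ∈ Finset.range n, a (i + 1) * (x * h) ^ i / (i.factorial : ℝ)) x := by
  simp_rw [Finset.sum_range_succ']
  rw [Finset.mul_sum]
  simp only [pow_zero]
  refine HasDerivAt.add_const _ (HasDerivAt.fun_sum fun i _ => ?_)
  have h1 : HasDerivAt (fun x : ℝ => x * h) h x := by simpa using (hasDerivAt_id x).mul_const h
  refine (((h1.pow (i + 1)).const_mul (a (i + 1))).div_const _).congr_deriv ?_
  rw [Nat.factorial_succ]
  push_cast
  have : (i.factorial : ℝ) ≠ 0 := by positivity
  field_simp

/-- Taylor's formula in a fixed direction, uniformly on a compact convex set. -/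
theorem exists_taylor_bound {s K : Set E} (hs : UniqueDiffOn ℝ s) (hK : IsCompact K)
    (hKc : Convex ℝ K) (hKs : K ⊆ s) (e : E) (n : ℕ) {F : E → ℝ} (hF : ContDiffOn ℝ ∞ F s) :
    ∃ C, 0 ≤ C ∧ ∀ q ∈ K, ∀ h : ℝ, q + h • e ∈ K →
      |F (q + h • e) - ∑ i ∈ Finset.range n,
        (dirDerivWithin s e)^[i] F q * h ^ i / (i.factorial : ℝ)| ≤ C * |h| ^ n := by
  induction n generalizing F with
  | zero =>
    obtain ⟨C, hC⟩ := hK.exists_bound_of_continuousOn (hF.continuousOn.mono hKs)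
    refine ⟨max C 0, le_max_right _ _, fun q _ h hh => ?_⟩
    simpa using Or.inl (hC _ hh)
  | succ n ih =>
    obtain ⟨C, hC0, hC⟩ := ih (hF.dirDerivWithin hs e)
    refine ⟨C, hC0, fun q hq h hh => ?_⟩
    have hmem : ∀ x ∈ Icc (0 : ℝ) 1, q + x • h • e ∈ K := fun x hx => hKc.add_smul_mem hq hh hx
    -- Along the segment, the derivative of the remainder is $h$ times the remainder of one order
    -- less for the directional derivative of $F$.
    have key := norm_image_sub_le_of_norm_deriv_le_segment_01' (C := C * |h| ^ (n + 1))
      (f := fun x : ℝ => F (q + x • h • e) - ∑ i ∈ Finset.range (n + 1),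
        (dirDerivWithin s e)^[i] F q * (x * h) ^ i / (i.factorial : ℝ))
      (fun x hx => (hasDerivWithinAt_comp_add_smul hF (fun y hy => hKs (hmem y hy)) hx).sub
        (hasDerivAt_taylor_sum _ n h x).hasDerivWithinAt) (fun x hx => by
        have h1 := hC q hq (x * h) (by rw [mul_smul]; exact hmem x ⟨hx.1, hx.2.le⟩)
        rw [mul_smul] at h1
        rw [← mul_sub, norm_mul, Real.norm_eq_abs, Real.norm_eq_abs]
        have h2 : |x * h| ^ n ≤ |h| ^ n := by
          rw [abs_mul, abs_of_nonneg hx.1]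
          exact pow_le_pow_left₀ (mul_nonneg hx.1 (abs_nonneg h))
            (mul_le_of_le_one_left (abs_nonneg h) hx.2.le) n
        calc |h| * _ ≤ |h| * (C * |h| ^ n) := by
              gcongr
              exact h1.trans (by gcongr)
          _ = C * |h| ^ (n + 1) := by ring)
    have h0 : ∑ i ∈ Finset.range (n + 1),
        (dirDerivWithin s e)^[i] F q * (0 * h) ^ i / (i.factorial : ℝ) = F q := by
      rw [Finset.sum_eq_single_of_mem 0 (by simp)]
      · simp
      · intro i _ hi
        simp [hi]
    simp only [one_smul, one_mul, zero_smul, add_zero, h0, sub_self, sub_zero] at key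
    exact key

/-- Composite expansions are stable under a smooth shift of the base point in a fixed direction. -/
theorem CompositeExpansion.comp_add_smul {s K : Set E} (hs : UniqueDiffOn ℝ s) (hK : IsCompact K)
    (hKc : Convex ℝ K) (hKs : K ⊆ s) (e : E) {τ C : ℝ} {n : ℕ} {q : ℝ → ℝ → E} {x : ℝ → ℝ → ℝ}
    (hq : ∀ F : E → ℝ, ContDiffOn ℝ ∞ F s → CompositeExpansion τ n fun η t => F (q η t))
    (hx : CompositeExpansion τ n x)
    (hxC : ∀ᶠ η in 𝓝[>] (0 : ℝ), ∀ t ∈ Icc (-τ) τ, |x η t| ≤ C * η)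
    (hqK : ∀ᶠ η in 𝓝[>] (0 : ℝ), ∀ t ∈ Icc (-τ) τ, q η t ∈ K ∧ q η t + x η t • e ∈ K)
    {F : E → ℝ} (hF : ContDiffOn ℝ ∞ F s) :
    CompositeExpansion τ n fun η t => F (q η t + x η t • e) := by
  obtain ⟨D, hD0, hD⟩ := exists_taylor_bound hs hK hKc hKs e n hF
  have hmain : CompositeExpansion τ n fun η t => ∑ i ∈ Finset.range n,
      (dirDerivWithin s e)^[i] F (q η t) * x η t ^ i / (i.factorial : ℝ) := by
    refine CompositeExpansion.sum _ fun i _ => ?_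
    refine (((hq _ (hF.iterate_dirDerivWithin hs e i)).mul (hx.pow i)).mul
      (of_contDiff (U := fun _ => (i.factorial : ℝ)⁻¹) contDiff_const)).congr ?_
    exact Eventually.of_forall fun η t _ => div_eq_mul_inv _ _
  have hrem : CompositeExpansion τ n fun η t => F (q η t + x η t • e) - ∑ i ∈ Finset.range n,
      (dirDerivWithin s e)^[i] F (q η t) * x η t ^ i / (i.factorial : ℝ) := by
    -- The shift is $O(\eta)$, so the Taylor remainder of order $n$ is $O(\eta^n)$.
    refine of_abs_le (C := D * C ^ n) ?_
    filter_upwards [hxC, hqK] with η h1 h2 t ht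
    refine (hD _ (h2 t ht).1 _ (h2 t ht).2).trans ?_
    rw [mul_assoc, ← mul_pow]
    gcongr
    exact h1 t ht
  refine (hmain.add hrem).congr (Eventually.of_forall fun η t _ => ?_)
  ring

end DirectionalTaylor

/-! ### The term S: Taylor coefficients, Lipschitz bound and expansion. -/

theorem iteratedDeriv_pow_mul_zero (m : ℕ) {W : ℝ → ℝ} (hW : ContDiff ℝ ∞ W) :
    iteratedDeriv m (fun t => t ^ m * W t) 0 = m.factorial * W 0 := by
  induction m generalizing W with
  | zero => simp
  | succ m ih =>
    obtain ⟨hd, hs⟩ := contDiff_infty_iff_deriv.1 hW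
    have h1 : deriv (fun t => t ^ (m + 1) * W t)
        = fun t => t ^ m * (((m : ℝ) + 1) * W t + t * deriv W t) := by
      ext t
      refine (((hasDerivAt_pow (m + 1) t).mul (hd t).hasDerivAt).congr_deriv ?_).deriv
      push_cast
      ring
    rw [iteratedDeriv_succ', h1, ih (W := fun t => ((m : ℝ) + 1) * W t + t * deriv W t)
      ((contDiff_const.mul hW).add (contDiff_id.mul hs)),
      Nat.factorial_succ]
    push_cast
    ring

theorem ContDiff.exists_eq_pow_mul {U : ℝ → ℝ} (hU : ContDiff ℝ ∞ U) (m : ℕ)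
    (h : ∀ i < m, iteratedDeriv i U 0 = 0) :
    ∃ W : ℝ → ℝ, ContDiff ℝ ∞ W ∧ ∀ t, U t = t ^ m * W t := by
  induction m with
  | zero => exact ⟨U, hU, fun t => by simp⟩
  | succ m ih =>
    obtain ⟨W, hW, hUW⟩ := ih fun i hi => h i (by omega)
    have h1 := h m (by omega)
    rw [funext hUW, iteratedDeriv_pow_mul_zero m hW] at h1
    have hW0 : W 0 = 0 := by
      have : (m.factorial : ℝ) ≠ 0 := by positivity
      exact (mul_eq_zero.1 h1).resolve_left this
    obtain ⟨W', hW', hWW'⟩ := hW.exists_eq_add_mul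
    refine ⟨W', hW', fun t => ?_⟩
    rw [hUW, hWW', hW0]
    ring

/-- Lines in direction $(0,1)$ stay in the strip, so ordinary and within-derivatives agree along
them. This links the valuation hypothesis, stated with `iteratedDeriv`, to smoothness on the closed
strip. -/
theorem iteratedDeriv_eq_iterate_dirDerivWithin {I : Set ℝ} {F : ℝ × ℝ → ℝ} (hI : UniqueDiffOn ℝ I)
    (hF : ContDiffOn ℝ ∞ F (I ×ˢ univ)) (j : ℕ) {t : ℝ} (ht : t ∈ I) (y : ℝ) :
    iteratedDeriv j (fun y => F (t, y)) y
      = (dirDerivWithin (I ×ˢ univ) ((0, 1) : ℝ × ℝ))^[j] F (t, y) := by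
  induction j generalizing F y with
  | zero => simp
  | succ j ih =>
    have h1 : deriv (fun y => F (t, y))
        = fun y => dirDerivWithin (I ×ˢ univ) ((0, 1) : ℝ × ℝ) F (t, y) := by
      ext y
      have := hasDerivWithinAt_comp_add_smul hF (q := (t, 0)) (e := (0, 1)) (h := 1) (x := y)
        (I := univ) (fun y _ => by simpa using ht) trivial
      simpa using (hasDerivWithinAt_univ.1 this).deriv
    rw [iteratedDeriv_succ', h1, ih (hF.dirDerivWithin (hI.prod uniqueDiffOn_univ) _)]
    rfl

theorem uniqueDiffOn_strip {t₀ : ℝ} (ht₀ : 0 < t₀) :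
    UniqueDiffOn ℝ (Icc (-t₀) t₀ ×ˢ (univ : Set ℝ)) :=
  (uniqueDiffOn_Icc (by linarith)).prod uniqueDiffOn_univ

/-- The `j`-th derivative of `S t y` in `y` at `y = 0`, on the strip `[-t₀, t₀] × ℝ`. -/
noncomputable def stripCoeff (S : ℝ → ℝ → ℝ) (t₀ : ℝ) (j : ℕ) (t : ℝ) : ℝ :=
  (dirDerivWithin (Icc (-t₀) t₀ ×ˢ univ) ((0, 1) : ℝ × ℝ))^[j] (fun q : ℝ × ℝ => S q.1 q.2) (t, 0)

theorem contDiffOn_stripCoeff {S : ℝ → ℝ → ℝ} {t₀ : ℝ} (ht₀ : 0 < t₀)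
    (hS : ContDiffOn ℝ ∞ (fun q : ℝ × ℝ => S q.1 q.2) (Icc (-t₀) t₀ ×ˢ univ)) (j : ℕ) :
    ContDiffOn ℝ ∞ (stripCoeff S t₀ j) (Icc (-t₀) t₀) :=
  (hS.iterate_dirDerivWithin (uniqueDiffOn_strip ht₀) (0, 1) j).comp
    (f := fun t : ℝ => (t, (0 : ℝ))) (by fun_prop) fun _ ht => ⟨ht, trivial⟩

section StripFactor

variable {p q : ℕ} {S : ℝ → ℝ → ℝ} {t₀ : ℝ}

/-- The valuation hypothesis kills the $t$-derivatives of order $i<p+2-qj$ at $0$. The subtraction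
is truncated: for $qj\ge p+2$ nothing is claimed to vanish. -/
theorem exists_stripCoeff_eq_pow_mul
    (hS : ContDiffOn ℝ ∞ (fun q : ℝ × ℝ => S q.1 q.2) (Icc (-t₀) t₀ ×ˢ univ))
    (hval : ∀ i j : ℕ, i + q * j ≤ p + 1 →
      iteratedDeriv i (fun t => iteratedDeriv j (fun α => S t α) 0) 0 = 0)
    {τ : ℝ} (hτ : 0 < τ) (hτt : τ < t₀) (j : ℕ) :
    ∃ W : ℝ → ℝ, ContDiff ℝ ∞ W ∧
      ∀ t ∈ Icc (-τ) τ, stripCoeff S t₀ j t = t ^ (p + 2 - q * j) * W t := by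
  have ht₀ : 0 < t₀ := hτ.trans hτt
  obtain ⟨U, hU, hUS⟩ := (contDiffOn_stripCoeff ht₀ hS j).exists_contDiff_eqOn hτ hτt
  have hU' : U =ᶠ[𝓝 0] fun t => iteratedDeriv j (fun α => S t α) 0 := by
    filter_upwards [Icc_mem_nhds (neg_lt_zero.2 hτ) hτ] with t ht
    rw [hUS ht, stripCoeff]
    exact (iteratedDeriv_eq_iterate_dirDerivWithin (uniqueDiffOn_Icc (by linarith)) hS j
      ⟨by linarith [ht.1], by linarith [ht.2]⟩ 0).symm
  obtain ⟨W, hW, hUW⟩ := hU.exists_eq_pow_mul (p + 2 - q * j) fun i hi => by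
    rw [hU'.iteratedDeriv_eq]
    exact hval i j (by omega)
  exact ⟨W, hW, fun t ht => by rw [← hUS ht, hUW]⟩

/-- The factorization gives the bound near $0$; away from $0$ compactness suffices, and this reaches
the endpoints $\pm t_0$, which the factorization does not. -/
theorem exists_abs_stripCoeff_le (ht₀ : 0 < t₀)
    (hS : ContDiffOn ℝ ∞ (fun q : ℝ × ℝ => S q.1 q.2) (Icc (-t₀) t₀ ×ˢ univ))
    (hval : ∀ i j : ℕ, i + q * j ≤ p + 1 →
      iteratedDeriv i (fun t => iteratedDeriv j (fun α => S t α) 0) 0 = 0) (j : ℕ) :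
    ∃ C, 0 ≤ C ∧ ∀ t ∈ Icc (-t₀) t₀, |stripCoeff S t₀ j t| ≤ C * |t| ^ (p + 2 - q * j) := by
  obtain ⟨W, hW, hSW⟩ := exists_stripCoeff_eq_pow_mul hS hval (half_pos ht₀) (half_lt_self ht₀) j
  obtain ⟨C, hC⟩ := (isCompact_Icc (a := -t₀) (b := t₀)).exists_bound_of_continuousOn
    hW.continuous.continuousOn
  obtain ⟨D, hD⟩ := (isCompact_Icc (a := -t₀) (b := t₀)).exists_bound_of_continuousOn
    (contDiffOn_stripCoeff ht₀ hS j).continuousOn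
  set m := p + 2 - q * j
  have hmem : (0 : ℝ) ∈ Icc (-t₀) t₀ := ⟨by linarith, ht₀.le⟩
  have hC0 : 0 ≤ C := (norm_nonneg _).trans (hC 0 hmem)
  have hD0 : 0 ≤ D := (norm_nonneg _).trans (hD 0 hmem)
  refine ⟨C + D / (t₀ / 2) ^ m, by positivity, fun t ht => ?_⟩
  rw [add_mul]
  by_cases h : |t| ≤ t₀ / 2
  · rw [hSW t (abs_le.1 h), abs_mul, abs_pow, mul_comm]
    have h1 : 0 ≤ D / (t₀ / 2) ^ m * |t| ^ m := by positivity
    have h2 : |W t| * |t| ^ m ≤ C * |t| ^ m := by gcongr; exact hC t ht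
    linarith
  · have h1 : (t₀ / 2) ^ m ≤ |t| ^ m := by gcongr; exact (not_le.1 h).le
    have h2 : 0 ≤ C * |t| ^ m := by positivity
    have h3 : D ≤ D / (t₀ / 2) ^ m * |t| ^ m := by
      rw [div_mul_eq_mul_div, le_div_iff₀ (by positivity)]
      gcongr
    have h4 : |stripCoeff S t₀ j t| ≤ D := hD t ht
    linarith

theorem isCompact_strip : IsCompact (Icc (-t₀) t₀ ×ˢ Icc (-1 : ℝ) 1) := isCompact_Icc.prod isCompact_Icc

theorem convex_strip : Convex ℝ (Icc (-t₀) t₀ ×ˢ Icc (-1 : ℝ) 1) :=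
  (convex_Icc _ _).prod (convex_Icc _ _)

theorem strip_subset : Icc (-t₀) t₀ ×ˢ Icc (-1 : ℝ) 1 ⊆ Icc (-t₀) t₀ ×ˢ univ :=
  prod_mono_right (subset_univ _)

theorem pow_mul_pow_le_growthWeight {i k m : ℕ} (hi : i ≤ p) (hik : m ≤ i + k) {η t : ℝ}
    (hη : 0 < η) (hη1 : η ≤ 1) : |t| ^ i * η ^ k ≤ η ^ m * growthWeight p (t / η) := by
  have h1 : |t| ^ i * η ^ k = η ^ (i + k) * |t / η| ^ i := by
    rw [abs_div, abs_of_pos hη, div_pow, pow_add]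
    field_simp
  rw [h1]
  exact mul_le_mul (pow_le_pow_of_le_one hη.le hη1 hik) (abs_pow_le_growthWeight hi _)
    (by positivity) (by positivity)

theorem eventually_pow_mul_le_one {q : ℕ} (hq : q ≠ 0) (R : ℝ) :
    ∀ᶠ η in 𝓝[>] (0 : ℝ), η ^ q * R ≤ 1 := by
  have h : Tendsto (fun η : ℝ => η ^ q * R) (𝓝 0) (𝓝 (0 ^ q * R)) :=
    Continuous.tendsto (by fun_prop) 0
  rw [zero_pow hq, zero_mul] at h
  exact mem_nhdsWithin_of_mem_nhds (h.eventually (ge_mem_nhds one_pos))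

theorem abs_pow_mul_le {η a R : ℝ} (hη : 0 ≤ η) (q : ℕ) (ha : |a| ≤ R) :
    |η ^ q * a| ≤ η ^ q * R := by
  rw [abs_mul, abs_of_nonneg (pow_nonneg hη q)]
  gcongr

/-- By Taylor expansion in the second variable, its partial derivative at $(t,\eta^qc)$ is
$O(\eta^{L+1}(1+|T|^p))$. The mean value inequality adds a factor $\eta^q$, and $q+L+1=p+2$ leaves
one $\eta$ after division by $\eta^{p+1}$. -/
theorem exists_strip_lipschitz {L : ℕ} (hq : q ≠ 0) (hpq : p + 2 = q + (L + 1)) (hLp : L < p)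
    (ht₀ : 0 < t₀) (hS : ContDiffOn ℝ ∞ (fun q : ℝ × ℝ => S q.1 q.2) (Icc (-t₀) t₀ ×ˢ univ))
    (hval : ∀ i j : ℕ, i + q * j ≤ p + 1 →
      iteratedDeriv i (fun t => iteratedDeriv j (fun α => S t α) 0) 0 = 0) {R : ℝ} (hR : 0 ≤ R) :
    ∃ C, 0 ≤ C ∧ ∀ᶠ η in 𝓝[>] (0 : ℝ), ∀ t ∈ Icc (-t₀) t₀, ∀ a b, |a| ≤ R → |b| ≤ R →
      |S t (η ^ q * a) / η ^ (p + 1) - S t (η ^ q * b) / η ^ (p + 1)|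
        ≤ C * η * |a - b| * growthWeight p (t / η) := by
  set s := Icc (-t₀) t₀ ×ˢ (univ : Set ℝ) with hs
  set F : ℝ × ℝ → ℝ := fun q => S q.1 q.2 with hF
  have hus := uniqueDiffOn_strip ht₀
  choose B hB0 hB using exists_abs_stripCoeff_le ht₀ hS hval
  obtain ⟨D, hD0, hD⟩ := exists_taylor_bound hus isCompact_strip convex_strip strip_subset
    (0, 1) (L + 1) (hS.dirDerivWithin hus (0, 1))
  set C := D * R ^ (L + 1) + ∑ j ∈ Finset.range (L + 1), B (j + 1) * R ^ j with hC
  have hC0 : 0 ≤ C := add_nonneg (by positivity)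
    (Finset.sum_nonneg fun j _ => mul_nonneg (hB0 _) (by positivity))
  refine ⟨C, hC0, ?_⟩
  filter_upwards [eventually_pos_nhdsGT_zero, eventually_lt_nhdsGT_zero one_pos,
    eventually_pow_mul_le_one hq R] with η hη hη1 hηR t ht a b ha hb
  set w := growthWeight p (t / η)
  have hw1 : 1 ≤ w := one_le_growthWeight _ _
  have hder : ∀ c, |c| ≤ R → |dirDerivWithin s (0, 1) F (t, η ^ q * c)| ≤ C * (η ^ (L + 1) * w) := by
    intro c hc
    have hy := abs_pow_mul_le hη.le q hc
    have hfst : ((t, 0) : ℝ × ℝ) + (η ^ q * c) • ((0, 1) : ℝ × ℝ) = (t, η ^ q * c) := by simp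
    have h1 := hD (t, 0) ⟨ht, by simp⟩ (η ^ q * c) (by
      rw [hfst]
      exact ⟨ht, abs_le.1 (hy.trans hηR)⟩)
    rw [hfst] at h1
    have h2 : |∑ i ∈ Finset.range (L + 1), (dirDerivWithin s ((0, 1) : ℝ × ℝ))^[i]
        (dirDerivWithin s (0, 1) F) (t, 0) * (η ^ q * c) ^ i / (i.factorial : ℝ)|
        ≤ ∑ j ∈ Finset.range (L + 1), B (j + 1) * R ^ j * (η ^ (L + 1) * w) := by
      refine (Finset.abs_sum_le_sum_abs _ _).trans (Finset.sum_le_sum fun j _ => ?_)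
      have h3 : |stripCoeff S t₀ (j + 1) t| ≤ B (j + 1) * |t| ^ (p + 2 - q * (j + 1)) := hB _ t ht
      have h4 : |(η ^ q * c) ^ j / (j.factorial : ℝ)| ≤ R ^ j * η ^ (q * j) := by
        have hf : (1 : ℝ) ≤ j.factorial := by exact_mod_cast Nat.factorial_pos j
        rw [abs_div, abs_pow, abs_of_pos (by positivity : (0 : ℝ) < j.factorial)]
        refine (div_le_self (by positivity) hf).trans ?_
        rw [pow_mul, ← mul_pow, mul_comm R]
        gcongr
      -- The total degree in $(t,\eta)$ is at least $p+2-q=L+1$, and the $t$-exponent is at most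
      -- $L+1\le p$.
      have h5 : |t| ^ (p + 2 - q * (j + 1)) * η ^ (q * j) ≤ η ^ (L + 1) * w :=
        pow_mul_pow_le_growthWeight (by rw [mul_add]; omega) (by rw [mul_add]; omega) hη hη1.le
      rw [mul_div_assoc, abs_mul]
      calc _ ≤ (B (j + 1) * |t| ^ (p + 2 - q * (j + 1))) * (R ^ j * η ^ (q * j)) :=
            mul_le_mul h3 h4 (abs_nonneg _) ((abs_nonneg _).trans h3)
        _ = B (j + 1) * R ^ j * (|t| ^ (p + 2 - q * (j + 1)) * η ^ (q * j)) := by ring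
        _ ≤ _ := by
          have := hB0 (j + 1)
          gcongr
    have h3 : D * |η ^ q * c| ^ (L + 1) ≤ D * R ^ (L + 1) * (η ^ (L + 1) * w) := by
      have h4 : |η ^ q * c| ^ (L + 1) ≤ R ^ (L + 1) * η ^ (L + 1) := by
        rw [← mul_pow]
        refine pow_le_pow_left₀ (abs_nonneg _) (hy.trans ?_) _
        rw [mul_comm R]
        gcongr
        exact pow_le_of_le_one hη.le hη1.le hq
      calc _ ≤ D * (R ^ (L + 1) * η ^ (L + 1)) * 1 := by rw [mul_one]; gcongr
        _ ≤ D * (R ^ (L + 1) * η ^ (L + 1)) * w := by gcongr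
        _ = _ := by ring
    rw [← Finset.sum_mul] at h2
    rw [hC, add_mul]
    have h4 := abs_sub_abs_le_abs_sub (dirDerivWithin s (0, 1) F (t, η ^ q * c))
      (∑ i ∈ Finset.range (L + 1), (dirDerivWithin s ((0, 1) : ℝ × ℝ))^[i]
        (dirDerivWithin s (0, 1) F) (t, 0) * (η ^ q * c) ^ i / (i.factorial : ℝ))
    linarith
  have hmv := (convex_Icc (-R) R).norm_image_sub_le_of_norm_hasDerivWithin_le
    (f := fun c => S t (η ^ q * c)) (f' := fun c => η ^ q * dirDerivWithin s (0, 1) F (t, η ^ q * c))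
    (C := η ^ q * (C * (η ^ (L + 1) * w))) (x := b) (y := a) (fun c _ => by
      have := hasDerivWithinAt_comp_add_smul hS (q := (t, 0)) (e := (0, 1)) (h := η ^ q) (x := c)
        (I := Icc (-R) R) (fun y _ => ⟨by simpa using ht, trivial⟩) (by assumption)
      simpa [mul_comm] using this) (fun c hc => by
      rw [norm_mul, Real.norm_eq_abs, abs_of_pos (by positivity)]
      gcongr
      exact hder c (abs_le.2 hc)) (abs_le.1 hb) (abs_le.1 ha)
  rw [← sub_div, abs_div, abs_of_pos (by positivity : 0 < η ^ (p + 1)), div_le_iff₀ (by positivity)]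
  refine hmv.trans_eq ?_
  rw [Real.norm_eq_abs]
  have : η * η ^ (p + 1) = η ^ q * η ^ (L + 1) := by
    rw [← pow_add, ← hpq, pow_succ' _ (p + 1)]
  linear_combination (-C * |a - b| * w) * this

theorem sourceExpansion_strip {n : ℕ} (hq : 2 ≤ q) {τ : ℝ} (hτ : 0 < τ) (hτt : τ < t₀)
    (hS : ContDiffOn ℝ ∞ (fun q : ℝ × ℝ => S q.1 q.2) (Icc (-t₀) t₀ ×ˢ univ))
    (hS0 : ∀ t ∈ Icc (-t₀) t₀, S t 0 = 0)
    (hval : ∀ i j : ℕ, i + q * j ≤ p + 1 →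
      iteratedDeriv i (fun t => iteratedDeriv j (fun α => S t α) 0) 0 = 0)
    {α : ℝ → ℝ} (hα : ScalarExpansion n α) {R : ℝ} (hαR : ∀ᶠ η in 𝓝[>] (0 : ℝ), |α η| ≤ R) :
    SourceExpansion p τ (n + 1) fun η t => S t (η ^ q * α η) / η ^ (p + 1) := by
  have ht₀ : 0 < t₀ := hτ.trans hτt
  set s := Icc (-t₀) t₀ ×ˢ (univ : Set ℝ) with hs
  -- The Taylor remainder is $O(\eta^m)$, hence still $O(\eta^{n+1})$ after division by
  -- $\eta^{p+1}$.
  set m := n + 1 + (p + 1) with hm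
  obtain ⟨D, hD0, hD⟩ := exists_taylor_bound (uniqueDiffOn_strip ht₀) isCompact_strip convex_strip
    strip_subset (0, 1) m hS
  have hterm : ∀ j, SourceExpansion p τ (n + 1) fun η t =>
      stripCoeff S t₀ j t * (η ^ q * α η) ^ j / (j.factorial : ℝ) / η ^ (p + 1) := by
    intro j
    rcases Nat.eq_zero_or_pos j with rfl | hj
    -- For $j=0$ the valuation alone would leave a factor $T^{p+2}$, beyond the weight; here
    -- $S(t,0)=0$ is needed.
    · refine SourceExpansion.zero.congr (Eventually.of_forall fun η t ht => ?_)
      have : stripCoeff S t₀ 0 t = 0 := hS0 t ⟨by linarith [ht.1], by linarith [ht.2]⟩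
      simp [this]
    · obtain ⟨W, hW, hSW⟩ := exists_stripCoeff_eq_pow_mul hS hval hτ hτt j
      have hqj : q ≤ q * j := Nat.le_mul_of_pos_right q hj
      -- One has $\eta^{qj}t^{p+2-qj}/\eta^{p+1}=\eta\cdot\eta^k\,T^{p+2-qj}$ with $k$ the excess of
      -- $qj$ over $p+2$, and the $T$-exponent is at most $p$ because $qj\ge q\ge2$.
      have h1 : CompositeExpansion τ n fun η t =>
          (j.factorial : ℝ)⁻¹ * W t * (η ^ (q * j + (p + 2 - q * j) - (p + 2)) * α η ^ j) :=
        (CompositeExpansion.of_contDiff (contDiff_const.mul hW)).mul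
          ((CompositeExpansion.eta_pow _).mul (hα.compositeExpansion.pow j))
      refine (h1.pow_mul (p := p) (i := p + 2 - q * j) (by omega)).eta_mul.congr ?_
      filter_upwards [eventually_pos_nhdsGT_zero] with η hη t ht
      rw [hSW t ht]
      obtain ⟨k, hk⟩ : ∃ k, q * j + (p + 2 - q * j) = p + 2 + k :=
        Nat.exists_eq_add_of_le (by omega)
      rw [hk, Nat.add_sub_cancel_left, mul_pow, ← pow_mul, div_pow]
      have h2 : η ^ (q * j) * η ^ (p + 2 - q * j) = η * η ^ (p + 1) * η ^ k := by
        rw [← pow_add, hk]; ring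
      have h3 : (j.factorial : ℝ) ≠ 0 := by positivity
      field_simp
      linear_combination (t ^ (p + 2 - q * j) * W t * α η ^ j) * h2
  have hrem : SourceExpansion p τ (n + 1) fun η t => (S t (η ^ q * α η) - ∑ j ∈ Finset.range m,
      stripCoeff S t₀ j t * (η ^ q * α η) ^ j / (j.factorial : ℝ)) / η ^ (p + 1) := by
    refine SourceExpansion.of_abs_le (C := D * |R| ^ m) ?_
    filter_upwards [eventually_pos_nhdsGT_zero, eventually_lt_nhdsGT_zero one_pos,
      eventually_pow_mul_le_one (by omega : q ≠ 0) R, hαR] with η hη hη1 hηR hαη t ht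
    have hy := abs_pow_mul_le hη.le q hαη
    have hR : R = |R| := (abs_of_nonneg ((abs_nonneg _).trans hαη)).symm
    have hfst : ((t, 0) : ℝ × ℝ) + (η ^ q * α η) • ((0, 1) : ℝ × ℝ) = (t, η ^ q * α η) := by simp
    have ht' : t ∈ Icc (-t₀) t₀ := ⟨by linarith [ht.1], by linarith [ht.2]⟩
    have h1 := hD (t, 0) ⟨ht', by simp⟩ (η ^ q * α η) (by
      rw [hfst]
      exact ⟨ht', abs_le.1 (hy.trans hηR)⟩)
    rw [hfst] at h1
    rw [abs_div, abs_of_pos (by positivity : 0 < η ^ (p + 1)), div_le_iff₀ (by positivity)]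
    refine (h1.trans ?_)
    have h2 : |η ^ q * α η| ^ m ≤ η ^ m * |R| ^ m := by
      rw [← mul_pow]
      refine pow_le_pow_left₀ (abs_nonneg _) (hy.trans ?_) _
      rw [← hR]
      have : 0 ≤ R := (abs_nonneg _).trans hαη
      gcongr
      exact pow_le_of_le_one hη.le hη1.le (by omega)
    calc D * |η ^ q * α η| ^ m ≤ D * (η ^ m * |R| ^ m) * 1 := by rw [mul_one]; gcongr
      _ ≤ D * (η ^ m * |R| ^ m) * growthWeight p (t / η) := by
        gcongr
        exact one_le_growthWeight _ _
      _ = _ := by rw [hm, pow_add η]; ring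
  refine ((SourceExpansion.sum (Finset.range m) fun j _ => hterm j).add hrem).congr
    (Eventually.of_forall fun η t _ => ?_)
  rw [← Finset.sum_div]
  ring

end StripFactor

/-! ### The boundary value problem in the stretched variable. -/

theorem mul_mem_Icc_of_mem_div {τ η T : ℝ} (hη : 0 < η) (hT : T ∈ Icc (-(τ / η)) (τ / η)) :
    η * T ∈ Icc (-τ) τ := by
  have h2 := hT.1
  have h3 := hT.2
  rw [le_div_iff₀ hη] at h3
  rw [← neg_div, div_le_iff₀ hη] at h2
  exact ⟨by linarith, by linarith⟩

/-- The standing hypotheses on the data of the boundary value problem. -/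
structure IsCanardProblem (p L : ℕ) (t₀ η₀ : ℝ) (S : ℝ → ℝ → ℝ) (P : ℝ → ℝ → ℝ → ℝ → ℝ) :
    Prop where
  odd : Odd p
  even : Even L
  lt : L < p
  t₀_pos : 0 < t₀
  η₀_pos : 0 < η₀
  smooth_S : ContDiffOn ℝ ∞ (fun q : ℝ × ℝ => S q.1 q.2) (Icc (-t₀) t₀ ×ˢ univ)
  S_zero : ∀ t ∈ Icc (-t₀) t₀, S t 0 = 0
  valuation : ∀ i j : ℕ, i + (p - L + 1) * j ≤ p + 1 →
    iteratedDeriv i (fun t => iteratedDeriv j (fun α => S t α) 0) 0 = 0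
  smooth_P : ContDiffOn ℝ ∞ (fun q : ℝ × ℝ × ℝ × ℝ => P q.1 q.2.1 q.2.2.1 q.2.2.2)
    (Icc (-t₀) t₀ ×ˢ univ ×ˢ univ ×ˢ Ico 0 η₀)

/-- The inhomogeneous term of the equation after division by `η^(p+1)`. -/
noncomputable def canardSource (p L : ℕ) (S : ℝ → ℝ → ℝ) (P : ℝ → ℝ → ℝ → ℝ → ℝ)
    (η t a x : ℝ) : ℝ :=
  S t (η ^ (p - L + 1) * a) / η ^ (p + 1) + P t (η * x) (η ^ (p - L + 1) * a) η

theorem canardRHS_eq {p L : ℕ} (hLp : L < p) (S : ℝ → ℝ → ℝ) (P : ℝ → ℝ → ℝ → ℝ → ℝ)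
    {η : ℝ} (hη : η ≠ 0) (a t x : ℝ) :
    canardRHS p L S P η a t x = η ^ (p + 1) *
      (((p : ℝ) + 1) * (t / η) ^ p * x + (a * (t / η) ^ L + canardSource p L S P η t a x)) := by
  obtain ⟨k, rfl⟩ := Nat.exists_eq_add_of_lt hLp
  unfold canardRHS canardSource
  rw [show L + k + 1 - L + 1 = k + 2 by omega]
  generalize S t _ = s
  generalize P t _ _ _ = r
  rw [div_pow, div_pow]
  field_simp
  ring

/-! ### Smooth functions of four variables at small arguments. -/

section FourVariables

variable {t₀ η₀ : ℝ}

theorem uniqueDiffOn_box (ht₀ : 0 < t₀) :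
    UniqueDiffOn ℝ (Icc (-t₀) t₀ ×ˢ (univ : Set ℝ) ×ˢ (univ : Set ℝ) ×ˢ Ico 0 η₀) :=
  (uniqueDiffOn_Icc (by linarith)).prod
    (uniqueDiffOn_univ.prod (uniqueDiffOn_univ.prod (uniqueDiffOn_Ico 0 η₀)))

/-- A compact convex box of values of `(t, x, y, η)`. -/
def compactBox (t₀ η₀ : ℝ) : Set (ℝ × ℝ × ℝ × ℝ) :=
  Icc (-t₀) t₀ ×ˢ Icc (-1) 1 ×ˢ Icc (-1) 1 ×ˢ Icc 0 (η₀ / 2)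

theorem isCompact_compactBox : IsCompact (compactBox t₀ η₀) :=
  isCompact_Icc.prod (isCompact_Icc.prod (isCompact_Icc.prod isCompact_Icc))

theorem convex_compactBox : Convex ℝ (compactBox t₀ η₀) :=
  (convex_Icc _ _).prod ((convex_Icc _ _).prod ((convex_Icc _ _).prod (convex_Icc _ _)))

theorem compactBox_subset (hη₀ : 0 < η₀) :
    compactBox t₀ η₀ ⊆ Icc (-t₀) t₀ ×ˢ univ ×ˢ univ ×ˢ Ico 0 η₀ :=
  fun _ hq => ⟨hq.1, trivial, trivial, hq.2.2.2.1, by linarith [hq.2.2.2.2]⟩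

theorem mem_compactBox {t x y η : ℝ} (ht : t ∈ Icc (-t₀) t₀) (hx : |x| ≤ 1) (hy : |y| ≤ 1)
    (hη : 0 ≤ η) (hη' : η ≤ η₀ / 2) : (t, x, y, η) ∈ compactBox t₀ η₀ :=
  ⟨ht, abs_le.1 hx, abs_le.1 hy, hη, hη'⟩

theorem exists_box_lipschitz (ht₀ : 0 < t₀) (hη₀ : 0 < η₀) {F : ℝ × ℝ × ℝ × ℝ → ℝ}
    (hF : ContDiffOn ℝ ∞ F (Icc (-t₀) t₀ ×ˢ univ ×ˢ univ ×ˢ Ico 0 η₀)) :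
    ∃ C, 0 ≤ C ∧ ∀ t x x' y y' η, t ∈ Icc (-t₀) t₀ → |x| ≤ 1 → |x'| ≤ 1 → |y| ≤ 1 → |y'| ≤ 1 →
      0 ≤ η → η ≤ η₀ / 2 →
      |F (t, x, y, η) - F (t, x', y', η)| ≤ C * (|x - x'| + |y - y'|) := by
  obtain ⟨C, hC0, hC⟩ := exists_taylor_bound (uniqueDiffOn_box ht₀) isCompact_compactBox
    convex_compactBox (compactBox_subset hη₀) (0, 1, 0, 0) 1 hF
  obtain ⟨D, hD0, hD⟩ := exists_taylor_bound (uniqueDiffOn_box ht₀) isCompact_compactBox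
    convex_compactBox (compactBox_subset hη₀) (0, 0, 1, 0) 1 hF
  refine ⟨C + D, by positivity, fun t x x' y y' η ht hx hx' hy hy' hη hη' => ?_⟩
  have h1 := hC (t, x', y, η) (mem_compactBox ht hx' hy hη hη') (x - x')
    (by simpa using mem_compactBox ht hx hy hη hη')
  have h2 := hD (t, x', y', η) (mem_compactBox ht hx' hy' hη hη') (y - y')
    (by simpa using mem_compactBox ht hx' hy hη hη')
  simp only [Finset.range_one, Finset.sum_singleton, Function.iterate_zero, id, pow_zero, mul_one,
    Nat.factorial_zero, Nat.cast_one, div_one, pow_one, Prod.smul_mk, smul_eq_mul, mul_zero,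
    Prod.mk_add_mk, add_zero, add_sub_cancel] at h1 h2
  calc |F (t, x, y, η) - F (t, x', y', η)|
      = |(F (t, x, y, η) - F (t, x', y, η)) + (F (t, x', y, η) - F (t, x', y', η))| := by ring_nf
    _ ≤ C * |x - x'| + D * |y - y'| := (abs_add_le _ _).trans (add_le_add h1 h2)
    _ ≤ _ := by nlinarith [abs_nonneg (x - x'), abs_nonneg (y - y')]

/-- The last three arguments are $O(\eta)$ and are moved away from $0$ one at a time. Each stage is
proved for all smooth `F`, as the next one applies it to directional derivatives. -/
theorem CompositeExpansion.comp_box {n : ℕ} {τ C : ℝ} (hτ : 0 < τ) (hτt : τ < t₀) (hη₀ : 0 < η₀)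
    {x y : ℝ → ℝ → ℝ} (hx : CompositeExpansion τ n x) (hy : CompositeExpansion τ n y)
    (hxC : ∀ᶠ η in 𝓝[>] (0 : ℝ), ∀ t ∈ Icc (-τ) τ, |x η t| ≤ C * η)
    (hyC : ∀ᶠ η in 𝓝[>] (0 : ℝ), ∀ t ∈ Icc (-τ) τ, |y η t| ≤ C * η)
    {F : ℝ × ℝ × ℝ × ℝ → ℝ} (hF : ContDiffOn ℝ ∞ F (Icc (-t₀) t₀ ×ˢ univ ×ˢ univ ×ˢ Ico 0 η₀)) :
    CompositeExpansion τ n fun η t => F (t, x η t, y η t, η) := by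
  have ht₀ : 0 < t₀ := hτ.trans hτt
  have hu := uniqueDiffOn_box (η₀ := η₀) ht₀
  have hsub : ∀ t ∈ Icc (-τ) τ, t ∈ Icc (-t₀) t₀ := fun t ht =>
    ⟨by linarith [ht.1], by linarith [ht.2]⟩
  have hsmall : ∀ᶠ η in 𝓝[>] (0 : ℝ), η ^ 1 * C ≤ 1 := eventually_pow_mul_le_one one_ne_zero C
  have hmem : ∀ᶠ η in 𝓝[>] (0 : ℝ), (0 ≤ η ∧ η ≤ η₀ / 2) ∧ ∀ t ∈ Icc (-τ) τ,
      |x η t| ≤ 1 ∧ |y η t| ≤ 1 := by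
    filter_upwards [hsmall, hxC, hyC, eventually_pos_nhdsGT_zero,
      eventually_lt_nhdsGT_zero (half_pos hη₀)] with η h1 h2 h3 h4 h5
    rw [pow_one, mul_comm] at h1
    exact ⟨⟨h4.le, h5.le⟩, fun t ht => ⟨(h2 t ht).trans h1, (h3 t ht).trans h1⟩⟩
  have base : ∀ F : ℝ × ℝ × ℝ × ℝ → ℝ,
      ContDiffOn ℝ ∞ F (Icc (-t₀) t₀ ×ˢ univ ×ˢ univ ×ˢ Ico 0 η₀) →
      CompositeExpansion τ n fun η t => F (t, 0, 0, 0) := fun F hF => by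
    have h1 : ContDiffOn ℝ ∞ (fun t : ℝ => F (t, 0, 0, 0)) (Icc (-t₀) t₀) :=
      hF.comp (f := fun t : ℝ => (t, (0 : ℝ), (0 : ℝ), (0 : ℝ))) (by fun_prop)
        fun t ht => ⟨ht, trivial, trivial, le_rfl, hη₀⟩
    obtain ⟨U, hU, hUF⟩ := h1.exists_contDiff_eqOn hτ hτt
    exact (of_contDiff hU).congr (Eventually.of_forall fun η t ht => (hUF ht).symm)
  have step1 : ∀ F : ℝ × ℝ × ℝ × ℝ → ℝ,
      ContDiffOn ℝ ∞ F (Icc (-t₀) t₀ ×ˢ univ ×ˢ univ ×ˢ Ico 0 η₀) →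
      CompositeExpansion τ n fun η t => F (t, x η t, 0, 0) := fun F hF => by
    refine (comp_add_smul hu isCompact_compactBox convex_compactBox (compactBox_subset hη₀)
      (0, 1, 0, 0) base hx hxC ?_ hF).congr (Eventually.of_forall fun η t _ => by simp)
    filter_upwards [hmem] with η h t ht
    have h0 : (0 : ℝ) ≤ η₀ / 2 := by linarith
    exact ⟨mem_compactBox (hsub t ht) (by simp) (by simp) le_rfl h0,
      by simpa using mem_compactBox (hsub t ht) (h.2 t ht).1 (y := 0) (by simp) le_rfl h0⟩
  have step2 : ∀ F : ℝ × ℝ × ℝ × ℝ → ℝ,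
      ContDiffOn ℝ ∞ F (Icc (-t₀) t₀ ×ˢ univ ×ˢ univ ×ˢ Ico 0 η₀) →
      CompositeExpansion τ n fun η t => F (t, x η t, y η t, 0) := fun F hF => by
    refine (comp_add_smul hu isCompact_compactBox convex_compactBox (compactBox_subset hη₀)
      (0, 0, 1, 0) step1 hy hyC ?_ hF).congr (Eventually.of_forall fun η t _ => by simp)
    filter_upwards [hmem] with η h t ht
    have h0 : (0 : ℝ) ≤ η₀ / 2 := by linarith
    exact ⟨mem_compactBox (hsub t ht) (h.2 t ht).1 (by simp) le_rfl h0,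
      by simpa using mem_compactBox (hsub t ht) (h.2 t ht).1 (h.2 t ht).2 le_rfl h0⟩
  refine (comp_add_smul hu isCompact_compactBox convex_compactBox (compactBox_subset hη₀)
      (0, 0, 0, 1) (x := fun η _ => η) (C := 1) step2 (by simpa using eta_pow (τ := τ) (n := n) 1)
      ?_ ?_ hF).congr (Eventually.of_forall fun η t _ => by simp)
  · filter_upwards [eventually_pos_nhdsGT_zero] with η h t _
    rw [one_mul, abs_of_pos h]
  · filter_upwards [hmem] with η h t ht
    have h0 : (0 : ℝ) ≤ η₀ / 2 := by linarith
    exact ⟨mem_compactBox (hsub t ht) (h.2 t ht).1 (h.2 t ht).2 le_rfl h0,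
      by simpa using mem_compactBox (hsub t ht) (h.2 t ht).1 (h.2 t ht).2 h.1.1 h.1.2⟩

end FourVariables

/-! ### Estimates and expansion of the source term. -/

namespace IsCanardProblem

variable {p L : ℕ} {t₀ η₀ : ℝ} {S : ℝ → ℝ → ℝ} {P : ℝ → ℝ → ℝ → ℝ → ℝ}

theorem exists_source_lipschitz (h : IsCanardProblem p L t₀ η₀ S P) {R : ℝ} (hR : 0 ≤ R) :
    ∃ C, 0 ≤ C ∧ ∀ᶠ η in 𝓝[>] (0 : ℝ), ∀ t ∈ Icc (-t₀) t₀, ∀ a b x y,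
      |a| ≤ R → |b| ≤ R → |x| ≤ R → |y| ≤ R →
      |canardSource p L S P η t a x - canardSource p L S P η t b y|
        ≤ C * η * (|a - b| + |x - y|) * growthWeight p (t / η) := by
  have hlt := h.lt
  obtain ⟨C, hC0, hC⟩ := exists_strip_lipschitz (q := p - L + 1) (by omega) (by omega) h.lt h.t₀_pos
    h.smooth_S h.valuation hR
  obtain ⟨D, hD0, hD⟩ := exists_box_lipschitz h.t₀_pos h.η₀_pos h.smooth_P
  refine ⟨C + D, by positivity, ?_⟩
  filter_upwards [hC, eventually_pos_nhdsGT_zero, eventually_lt_nhdsGT_zero one_pos,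
    eventually_lt_nhdsGT_zero (half_pos h.η₀_pos), eventually_pow_mul_le_one one_ne_zero R,
    eventually_pow_mul_le_one (by omega : p - L + 1 ≠ 0) R]
    with η hη hη0 hη1 hη2 hη3 hη4 t ht a b x y ha hb hx hy
  have h1 := hη t ht a b ha hb
  have hx' := (abs_pow_mul_le hη0.le 1 hx).trans hη3
  have hy' := (abs_pow_mul_le hη0.le 1 hy).trans hη3
  rw [pow_one] at hx' hy'
  have h2 := hD t (η * x) (η * y) _ _ η ht hx' hy'
    ((abs_pow_mul_le hη0.le _ ha).trans hη4) ((abs_pow_mul_le hη0.le _ hb).trans hη4) hη0.le hη2.le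
  have hw := one_le_growthWeight p (t / η)
  have h3 : |η ^ (p - L + 1) * a - η ^ (p - L + 1) * b| ≤ η * |a - b| := by
    rw [← mul_sub, abs_mul, abs_of_pos (pow_pos hη0 _)]
    gcongr
    exact pow_le_of_le_one hη0.le hη1.le (by omega)
  rw [← mul_sub, abs_mul, abs_of_pos hη0] at h2
  unfold canardSource
  rw [add_sub_add_comm]
  refine (abs_add_le _ _).trans ?_
  have h4 : C * η * |a - b| * growthWeight p (t / η)
      ≤ C * η * (|a - b| + |x - y|) * growthWeight p (t / η) := by
    gcongr
    linarith [abs_nonneg (x - y)]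
  have h5 : D * (η * |x - y| + |η ^ (p - L + 1) * a - η ^ (p - L + 1) * b|)
      ≤ D * η * (|a - b| + |x - y|) * growthWeight p (t / η) := by
    calc _ ≤ D * (η * |x - y| + η * |a - b|) := by gcongr
      _ = D * η * (|a - b| + |x - y|) * 1 := by ring
      _ ≤ _ := by gcongr
  dsimp only at h2
  linarith

/-- The order of quantifiers matters: $C$ does not depend on $R$. At $a=x=0$ the source is a bounded
value of $P$, and the $O(\eta)$ Lipschitz bound makes the rest at most $1$ times the weight for
small $\eta$. -/
theorem exists_source_bound (h : IsCanardProblem p L t₀ η₀ S P) :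
    ∃ C, 0 ≤ C ∧ ∀ R, 0 ≤ R → ∀ᶠ η in 𝓝[>] (0 : ℝ), ∀ t ∈ Icc (-t₀) t₀, ∀ a x,
      |a| ≤ R → |x| ≤ R → |canardSource p L S P η t a x| ≤ C * growthWeight p (t / η) := by
  obtain ⟨C, hC⟩ := (isCompact_compactBox (t₀ := t₀) (η₀ := η₀)).exists_bound_of_continuousOn
    (h.smooth_P.continuousOn.mono (compactBox_subset h.η₀_pos))
  have hη₀ := h.η₀_pos
  have ht₀ := h.t₀_pos
  have hC0 : 0 ≤ C := (norm_nonneg _).trans (hC (0, 0, 0, 0) (mem_compactBox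
    ⟨by linarith, h.t₀_pos.le⟩ (by simp) (by simp) le_rfl (by linarith)))
  refine ⟨C + 1, by positivity, fun R hR => ?_⟩
  obtain ⟨D, hD0, hD⟩ := h.exists_source_lipschitz hR
  filter_upwards [hD, eventually_pos_nhdsGT_zero, eventually_lt_nhdsGT_zero (half_pos hη₀),
    eventually_pow_mul_le_one one_ne_zero (D * (R + R))] with η hη hη0 hη2 hη3 t ht a x ha hx
  have h1 := hη t ht a 0 x 0 ha (by simpa using hR) hx (by simpa using hR)
  have h2 : |canardSource p L S P η t 0 0| ≤ C := by
    have := hC (t, 0, 0, η) (mem_compactBox ht (by simp) (by simp) hη0.le hη2.le)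
    simpa [canardSource, h.S_zero t ht] using this
  have hw := one_le_growthWeight p (t / η)
  rw [sub_zero, sub_zero] at h1
  have h3 : D * η * (|a| + |x|) * growthWeight p (t / η) ≤ 1 * growthWeight p (t / η) := by
    gcongr
    calc D * η * (|a| + |x|) ≤ D * η * (R + R) := by gcongr
      _ ≤ 1 := by linarith
  have h4 := abs_sub_abs_le_abs_sub (canardSource p L S P η t a x) (canardSource p L S P η t 0 0)
  nlinarith

theorem continuousOn_source (h : IsCanardProblem p L t₀ η₀ S P) {η : ℝ} (hη : 0 < η)
    (hη' : η < η₀) : ContinuousOn (fun q : ℝ × ℝ × ℝ => canardSource p L S P η (η * q.1) q.2.1 q.2.2)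
      (Icc (-(t₀ / η)) (t₀ / η) ×ˢ univ ×ˢ univ) := by
  have hmem : ∀ q ∈ Icc (-(t₀ / η)) (t₀ / η) ×ˢ (univ : Set ℝ) ×ˢ (univ : Set ℝ),
      η * q.1 ∈ Icc (-t₀) t₀ := fun q hq => mul_mem_Icc_of_mem_div hη hq.1
  have h1 := h.smooth_S.continuousOn.comp
    (f := fun q : ℝ × ℝ × ℝ => (η * q.1, η ^ (p - L + 1) * q.2.1)) (Continuous.continuousOn
      (by fun_prop)) fun q hq => ⟨hmem q hq, trivial⟩
  have h2 := h.smooth_P.continuousOn.comp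
    (f := fun q : ℝ × ℝ × ℝ => (η * q.1, η * q.2.2, η ^ (p - L + 1) * q.2.1, η))
      (Continuous.continuousOn (by fun_prop)) fun q hq => ⟨hmem q hq, trivial, trivial, hη.le, hη'⟩
  exact (h1.div_const _).add h2

/-- The gain of one order drives the bootstrap: $u$ enters only through $\eta u$, and $\alpha$ only
through $\eta^{p-L+1}\alpha$ in $P$ and through $S/\eta^{p+1}$, whose valuation leaves a spare
factor $\eta$. -/
theorem sourceExpansion (h : IsCanardProblem p L t₀ η₀ S P) {n : ℕ} {τ : ℝ} (hτ : 0 < τ)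
    (hτt : τ < t₀) {α : ℝ → ℝ} {u : ℝ → ℝ → ℝ} (hα : ScalarExpansion n α)
    (hu : CompositeExpansion τ n u) {R : ℝ}
    (hb : ∀ᶠ η in 𝓝[>] (0 : ℝ), |α η| ≤ R ∧ ∀ t ∈ Icc (-t₀) t₀, |u η t| ≤ R) :
    SourceExpansion p τ (n + 1) fun η t => canardSource p L S P η t (α η) (u η t) := by
  have hlt := h.lt
  refine (sourceExpansion_strip (q := p - L + 1) (by omega) hτ hτt h.smooth_S h.S_zero h.valuation
    hα (hb.mono fun η hη => hη.1)).add (CompositeExpansion.sourceExpansion ?_)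
  have hy : CompositeExpansion τ (n + 1) fun η t => η ^ (p - L + 1) * α η := by
    refine (((CompositeExpansion.eta_pow (p - L)).mul hα.compositeExpansion).eta_mul).congr
      (Eventually.of_forall fun η t _ => ?_)
    ring
  refine CompositeExpansion.comp_box (C := R) hτ hτt h.η₀_pos hu.eta_mul hy ?_ ?_ h.smooth_P
  · filter_upwards [hb, eventually_pos_nhdsGT_zero] with η h1 h2 t ht
    rw [abs_mul, abs_of_pos h2, mul_comm]
    gcongr
    exact h1.2 t ⟨by linarith [ht.1], by linarith [ht.2]⟩
  · filter_upwards [hb, eventually_pos_nhdsGT_zero, eventually_lt_nhdsGT_zero one_pos]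
      with η h1 h2 h3 t ht
    refine (abs_pow_mul_le h2.le _ h1.1).trans ?_
    rw [mul_comm]
    have : 0 ≤ R := (abs_nonneg _).trans h1.1
    gcongr
    exact pow_le_of_le_one h2.le h3.le (by omega)

end IsCanardProblem

/-! ### Existence, uniqueness and expansion of canard solutions. -/

theorem hasDerivWithinAt_comp_mul_left {u : ℝ → ℝ} {d τ η T : ℝ} (hη : 0 < η)
    (h : HasDerivWithinAt u d (Icc (-τ) τ) (η * T)) :
    HasDerivWithinAt (fun T => u (η * T)) (η * d) (Icc (-(τ / η)) (τ / η)) T := by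
  have h1 : HasDerivWithinAt (fun T : ℝ => η * T) η (Icc (-(τ / η)) (τ / η)) T := by
    simpa using ((hasDerivAt_id T).const_mul η).hasDerivWithinAt
  have := h.scomp (h := fun T : ℝ => η * T) T h1 fun x hx => mul_mem_Icc_of_mem_div hη hx
  simpa [Function.comp_def] using this

theorem div_mem_Icc_div {τ η t : ℝ} (hη : 0 < η) (ht : t ∈ Icc (-τ) τ) :
    t / η ∈ Icc (-(τ / η)) (τ / η) := by
  rw [← neg_div]
  exact ⟨div_le_div_of_nonneg_right ht.1 hη.le, div_le_div_of_nonneg_right ht.2 hη.le⟩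

theorem exp_neg_div_pow_le {c η : ℝ} (hc : 0 < c) (hη : 0 < η) (hη1 : η ≤ 1) (p n : ℕ) :
    Real.exp (-(c / η ^ (p + 1))) ≤ n.factorial / c ^ n * η ^ n := by
  have h1 := Real.pow_div_factorial_le_exp (c / η ^ (p + 1)) (by positivity) n
  rw [Real.exp_neg]
  have h2 : (0 : ℝ) < (c / η ^ (p + 1)) ^ n / n.factorial := by positivity
  refine (inv_anti₀ h2 h1).trans ?_
  rw [div_pow, inv_div, div_div_eq_mul_div, div_mul_eq_mul_div]
  gcongr
  exact pow_le_of_le_one hη.le hη1 (by omega)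

namespace IsCanardProblem

variable {p L : ℕ} {t₀ η₀ : ℝ} {S : ℝ → ℝ → ℝ} {P : ℝ → ℝ → ℝ → ℝ → ℝ}

theorem solves_iff (h : IsCanardProblem p L t₀ η₀ S P) {η α : ℝ} (hη : 0 < η) {u : ℝ → ℝ} :
    SolvesCanardBVP p L S P t₀ η α u ↔ (u (-t₀) = 0 ∧ u t₀ = 0 ∧ ∀ t ∈ Icc (-t₀) t₀,
      ∃ d, HasDerivWithinAt u d (Icc (-t₀) t₀) t ∧
        η * d = ((p : ℝ) + 1) * (t / η) ^ p * u t
          + (α * (t / η) ^ L + canardSource p L S P η t α (u t))) := by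
  have key : ∀ t d : ℝ, η ^ (p + 2) * d = canardRHS p L S P η α t (u t) ↔
      η * d = ((p : ℝ) + 1) * (t / η) ^ p * u t
          + (α * (t / η) ^ L + canardSource p L S P η t α (u t)) := fun t d => by
    rw [canardRHS_eq h.lt S P hη.ne', pow_succ η (p + 1), mul_assoc,
      mul_right_inj' (pow_ne_zero _ hη.ne')]
  constructor
  · intro hs
    exact ⟨hs.left, hs.right, fun t ht => (hs.ode t ht).imp fun d hd => ⟨hd.1, (key t d).1 hd.2⟩⟩
  · rintro ⟨h1, h2, h3⟩
    exact ⟨fun t ht => (h3 t ht).imp fun d hd => ⟨hd.1, (key t d).2 hd.2⟩, h1, h2⟩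

theorem eventually_eq_of_isCanardSolution (h : IsCanardProblem p L t₀ η₀ S P)
    {α β : ℝ → ℝ} {u v : ℝ → ℝ → ℝ} (hu : IsCanardSolution p L S P t₀ α u)
    (hv : IsCanardSolution p L S P t₀ β v) :
    ∀ᶠ η in 𝓝[>] (0 : ℝ), α η = β η ∧ EqOn (u η) (v η) (Icc (-t₀) t₀) := by
  obtain ⟨A, hA, hap⟩ := exists_apriori_bound h.odd h.even h.lt
  obtain ⟨R₁, hR₁⟩ := hu.bounded
  obtain ⟨R₂, hR₂⟩ := hv.bounded
  set R := max (max R₁ R₂) 0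
  obtain ⟨C, hC0, hC⟩ := h.exists_source_lipschitz (le_max_right (max R₁ R₂) 0)
  have ht₀ := h.t₀_pos
  filter_upwards [hu.solves, hv.solves, hR₁, hR₂, hC, eventually_pos_nhdsGT_zero,
    eventually_lt_nhdsGT_zero ht₀, eventually_pow_mul_le_one one_ne_zero (4 * A * C)]
    with η hsu hsv hbu hbv hlip hη hηt hηC
  rw [h.solves_iff hη] at hsu hsv
  have hR1 : R₁ ≤ R := (le_max_left _ _).trans (le_max_left _ _)
  have hR2 : R₂ ≤ R := (le_max_right _ _).trans (le_max_left _ _)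
  have hcont : ContinuousOn (fun t => |u η t - v η t|) (Icc (-t₀) t₀) := fun t ht =>
    (((hsu.2.2 t ht).choose_spec.1.continuousWithinAt).sub
      ((hsv.2.2 t ht).choose_spec.1.continuousWithinAt)).abs
  obtain ⟨s, hs, hmax⟩ := isCompact_Icc.exists_isMaxOn
    (nonempty_Icc.2 (by linarith : -t₀ ≤ t₀)) hcont
  set m := |u η s - v η s| with hm
  have hm' : ∀ t ∈ Icc (-t₀) t₀, |u η t - v η t| ≤ m := fun t ht => hmax ht
  choose! du hdu hdu' using hsu.2.2
  choose! dv hdv hdv' using hsv.2.2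
  set M := t₀ / η with hM
  have hηM : η * M = t₀ := by rw [hM]; field_simp
  -- The difference solves the linear problem with zero boundary values and a forcing bounded by the
  -- difference itself, times $C\eta$.
  have hest := hap M (C * η * (|α η - β η| + m)) 0 (α η - β η) (fun T => u η (η * T) - v η (η * T))
    (fun T => canardSource p L S P η (η * T) (α η) (u η (η * T))
      - canardSource p L S P η (η * T) (β η) (v η (η * T)))
    (by rw [hM, one_le_div hη]; exact hηt.le) (by positivity)
    (fun T hT => by
      have hT' := mul_mem_Icc_of_mem_div hη hT
      refine ((hasDerivWithinAt_comp_mul_left hη (hdu _ hT')).sub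
        (hasDerivWithinAt_comp_mul_left hη (hdv _ hT'))).congr_deriv ?_
      rw [hdu' _ hT', hdv' _ hT', mul_div_cancel_left₀ _ hη.ne']
      ring)
    (fun T hT => by
      have hT' := mul_mem_Icc_of_mem_div hη hT
      refine (hlip _ hT' _ _ _ _ (hbu.1.trans hR1) (hbv.1.trans hR2) ((hbu.2 _ hT').trans hR1)
        ((hbv.2 _ hT').trans hR2)).trans ?_
      rw [mul_div_cancel_left₀ _ hη.ne']
      have := (growthWeight_pos p T).le
      gcongr
      exact hm' _ hT')
    (by simp [hηM, hsu.2.1, hsv.2.1]) (by simp [hηM, hsu.1, hsv.1])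
  simp only [zero_mul, add_zero] at hest
  have h1 := hest.1
  have h2 : m ≤ A * (C * η * (|α η - β η| + m)) := by
    have := hest.2 (s / η) (div_mem_Icc_div hη hs)
    rwa [mul_div_cancel₀ _ hη.ne'] at this
  have hm0 : 0 ≤ m := abs_nonneg _
  -- Each summand is at most a quarter of the sum once $4AC\eta\le1$.
  have hsum : |α η - β η| + m ≤ 0 := by
    have h3 : 4 * (A * (C * η * (|α η - β η| + m))) ≤ 1 * (|α η - β η| + m) := by
      calc _ = η ^ 1 * (4 * A * C) * (|α η - β η| + m) := by ring
        _ ≤ _ := by gcongr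
    linarith [abs_nonneg (α η - β η)]
  have hα0 : |α η - β η| = 0 := le_antisymm (by linarith) (abs_nonneg _)
  refine ⟨sub_eq_zero.1 (abs_eq_zero.1 hα0), fun t ht => ?_⟩
  have : |u η t - v η t| = 0 := le_antisymm (by linarith [hm' t ht, abs_nonneg (α η - β η)])
    (abs_nonneg _)
  exact sub_eq_zero.1 (abs_eq_zero.1 this)

theorem exists_isCanardSolution (h : IsCanardProblem p L t₀ η₀ S P) :
    ∃ (α : ℝ → ℝ) (u : ℝ → ℝ → ℝ), IsCanardSolution p L S P t₀ α u := by
  obtain ⟨A, hA, hex⟩ := exists_nonlinear_bvp_solution h.odd h.even h.lt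
  obtain ⟨C₁, hC₁, hbound⟩ := h.exists_source_bound
  -- The radius $AC_1$ can be fixed first because $C_1$ is independent of it; the Lipschitz constant
  -- is taken for that radius, and $\eta$ is made small last.
  have hR : 0 ≤ A * C₁ := by positivity
  obtain ⟨C, hC0, hC⟩ := h.exists_source_lipschitz hR
  have ht₀ := h.t₀_pos
  have key : ∀ᶠ η in 𝓝[>] (0 : ℝ), ∃ z : ℝ × (ℝ → ℝ), SolvesCanardBVP p L S P t₀ η z.1 z.2 ∧
      |z.1| ≤ A * C₁ ∧ ∀ t ∈ Icc (-t₀) t₀, |z.2 t| ≤ A * C₁ := by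
    filter_upwards [hbound _ hR, hC, eventually_pos_nhdsGT_zero, eventually_lt_nhdsGT_zero ht₀,
      eventually_lt_nhdsGT_zero h.η₀_pos, eventually_pow_mul_le_one one_ne_zero (4 * A * C)]
      with η hb hl hη hηt hηη hηC
    set M := t₀ / η with hM
    obtain ⟨α, d, hα, hd, hdl, hdr, hode⟩ := hex M (A * C₁) (C * η) C₁
      (fun T a x => canardSource p L S P η (η * T) a x) (by rw [hM, one_le_div hη]; exact hηt.le)
      hR (by positivity) hC₁ (h.continuousOn_source hη hηη)
      (fun T hT a x ha hx => by
        simpa [mul_div_cancel_left₀ _ hη.ne'] using hb _ (mul_mem_Icc_of_mem_div hη hT) a x ha hx)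
      (fun T hT a b x y ha hb hx hy => by
        simpa [mul_div_cancel_left₀ _ hη.ne'] using
          hl _ (mul_mem_Icc_of_mem_div hη hT) a b x y ha hb hx hy)
      le_rfl (by linarith)
    refine ⟨(α, fun t => d (t / η)), (h.solves_iff hη).2 ⟨?_, hdr, fun t ht => ?_⟩, hα,
      fun t ht => hd _ (div_mem_Icc_div hη ht)⟩
    · simp only [neg_div]
      exact hdl
    · have h1 := hode _ (div_mem_Icc_div hη ht)
      have h2 : HasDerivAt (fun t : ℝ => t / η) η⁻¹ t := by
        simpa using (hasDerivAt_id t).div_const η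
      refine ⟨_, (h1.comp t h2).hasDerivWithinAt, ?_⟩
      rw [mul_div_cancel₀ _ hη.ne']
      field_simp
  obtain ⟨z, hz⟩ := key.choice
  exact ⟨fun η => (z η).1, fun η => (z η).2, hz.mono fun η hη => hη.1, A * C₁,
    hz.mono fun η hη => hη.2⟩

/-- Bootstrap on the order. The induction carries all $\tau<t_0$ at once because each step uses the
previous order on a slightly larger interval $[-\sigma,\sigma]$. -/
theorem scalarExpansion_and_compositeExpansion (h : IsCanardProblem p L t₀ η₀ S P) {α : ℝ → ℝ}
    {u : ℝ → ℝ → ℝ} (hu : IsCanardSolution p L S P t₀ α u) (n : ℕ) :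
    ∀ τ, 0 < τ → τ < t₀ → ScalarExpansion n α ∧ CompositeExpansion τ n u := by
  obtain ⟨R, hR⟩ := hu.bounded
  induction n with
  | zero =>
    exact fun τ hτ hτt => ⟨⟨R, hR.mono fun η hη => hη.1⟩, R, hR.mono fun η hη t ht =>
      hη.2 t ⟨by linarith [ht.1], by linarith [ht.2]⟩⟩
  | succ n ih =>
    intro τ hτ hτt
    set σ := (τ + t₀) / 2 with hσ
    have hτσ : τ < σ := by rw [hσ]; linarith
    have hσt : σ < t₀ := by rw [hσ]; linarith
    have hσ0 : 0 < σ := hτ.trans hτσ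
    obtain ⟨hα, hun⟩ := ih σ hσ0 hσt
    obtain ⟨b, v, v', hb, hv, hv', C, hC⟩ :=
      (h.sourceExpansion hσ0 hσt hα hun hR).exists_approx_solution h.odd h.even h.lt
    obtain ⟨A, hA, hap⟩ := exists_apriori_bound h.odd h.even h.lt
    have hv0 : CompositeExpansion σ 0 v := by
      have : ∀ m, CompositeExpansion σ m v → CompositeExpansion σ 0 v := fun m => by
        induction m with
        | zero => exact id
        | succ m ih => exact fun h => ih h.of_succ
      exact this _ hv
    obtain ⟨D, hD⟩ := hv0
    set B := |R| + |D| with hB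
    have hB0 : 0 ≤ B := by positivity
    set c := σ ^ (p + 1) - τ ^ (p + 1) with hc
    have hc0 : 0 < c := sub_pos.2 (pow_lt_pow_left₀ hτσ hτ.le (by omega))
    have hcσ : 0 < σ ^ (p + 1) := by positivity
    set k₁ := ((n + 1).factorial : ℝ) / (σ ^ (p + 1)) ^ (n + 1)
    set k₂ := ((n + 1).factorial : ℝ) / c ^ (n + 1)
    have key : ∀ᶠ η in 𝓝[>] (0 : ℝ), |α η - b η| ≤ A * (|C| + B * k₁) * η ^ (n + 1) ∧
        ∀ t ∈ Icc (-τ) τ, |u η t - v η t| ≤ (A * (|C| + B * k₁) + B * k₂) * η ^ (n + 1) := by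
      filter_upwards [hu.solves, hR, hC, hD, eventually_pos_nhdsGT_zero,
        eventually_lt_nhdsGT_zero one_pos, eventually_lt_nhdsGT_zero hσ0] with η hs hRη hCη hDη hη hη1 hησ
      rw [h.solves_iff hη] at hs
      choose! d hd hd' using hs.2.2
      have hsub : Icc (-σ) σ ⊆ Icc (-t₀) t₀ := Icc_subset_Icc (by linarith) hσt.le
      -- At $\pm\sigma$ only boundedness of $u-v$ is known; this suffices, since boundary values
      -- enter with exponentially small factors.
      have hbd : ∀ t ∈ Icc (-σ) σ, |u η t - v η t| ≤ B := fun t ht =>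
        (abs_sub _ _).trans (add_le_add ((hRη.2 t (hsub ht)).trans (le_abs_self R))
          ((hDη t ht).trans (le_abs_self D)))
      set M := σ / η with hM
      have hηM : η * M = σ := by rw [hM]; field_simp
      have hest := hap M (|C| * η ^ (n + 1)) B (α η - b η) (fun T => u η (η * T) - v η (η * T))
        (fun T => -(η * v' η (η * T) - ((p : ℝ) + 1) * T ^ p * v η (η * T) - b η * T ^ L
          - canardSource p L S P η (η * T) (α η) (u η (η * T))))
        (by rw [hM, one_le_div hη]; exact hησ.le) (by positivity)
        (fun T hT => by
          have hT' := mul_mem_Icc_of_mem_div hη hT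
          refine ((hasDerivWithinAt_comp_mul_left hη ((hd _ (hsub hT')).mono hsub)).sub
            (hasDerivWithinAt_comp_mul_left hη (hv' η hη (η * T)).hasDerivWithinAt)).congr_deriv ?_
          rw [hd' _ (hsub hT'), mul_div_cancel_left₀ _ hη.ne']
          ring)
        (fun T hT => by
          have hT' := mul_mem_Icc_of_mem_div hη hT
          have h1 := hCη _ hT'
          rw [mul_div_cancel_left₀ _ hη.ne'] at h1
          rw [abs_neg]
          refine h1.trans ?_
          have := (growthWeight_pos p T).le
          gcongr
          exact le_abs_self C)
        (by
          rw [hηM]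
          exact hbd σ ⟨by linarith, le_rfl⟩)
        (by
          rw [mul_neg, hηM]
          exact hbd (-σ) ⟨le_rfl, by linarith⟩)
      have hk₁ : Real.exp (-M ^ (p + 1)) ≤ k₁ * η ^ (n + 1) := by
        rw [hM, div_pow]
        exact exp_neg_div_pow_le hcσ hη hη1.le p (n + 1)
      have h1 : A * (|C| * η ^ (n + 1) + B * Real.exp (-M ^ (p + 1)))
          ≤ A * (|C| + B * k₁) * η ^ (n + 1) := by
        calc _ ≤ A * (|C| * η ^ (n + 1) + B * (k₁ * η ^ (n + 1))) := by gcongr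
          _ = _ := by ring
      refine ⟨hest.1.trans h1, fun t ht => ?_⟩
      have h2 := hest.2 (t / η) (div_mem_Icc_div hη ⟨by linarith [ht.1], by linarith [ht.2]⟩)
      rw [mul_div_cancel₀ _ hη.ne'] at h2
      -- For $|t|\le\tau<\sigma$ the exponent is at most $-c/\eta^{p+1}$ with
      -- $c=\sigma^{p+1}-\tau^{p+1}>0$.
      have h3 : Real.exp ((t / η) ^ (p + 1) - M ^ (p + 1)) ≤ k₂ * η ^ (n + 1) := by
        refine le_trans (Real.exp_le_exp.2 ?_) (exp_neg_div_pow_le hc0 hη hη1.le p (n + 1))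
        rw [hM, div_pow, div_pow, hc, ← sub_div, ← neg_div]
        gcongr
        have h4 : t ^ (p + 1) ≤ τ ^ (p + 1) := by
          rw [← h.odd.add_one.pow_abs t]
          exact pow_le_pow_left₀ (abs_nonneg t) (abs_le.2 ht) _
        linarith
      calc |u η t - v η t| ≤ _ := h2
        _ ≤ A * (|C| + B * k₁) * η ^ (n + 1) + B * (k₂ * η ^ (n + 1)) := by gcongr
        _ = _ := by ring
    refine ⟨hb.add_of_abs_le (key.mono fun η hη => hη.1), ?_⟩
    have hvτ : CompositeExpansion τ (n + 1) v := hv.mono hτσ.le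
    have hd : CompositeExpansion τ (n + 1) fun η t => u η t - v η t :=
      CompositeExpansion.of_abs_le (key.mono fun η hη => hη.2)
    exact (hvτ.add hd).congr (Eventually.of_forall fun η t _ => by ring)

end IsCanardProblem

/-! ### Coefficient sequences and their uniqueness. -/

/-- `∑ (U k t + φ k (t/η)) η^k` approximates `f` on `[-τ, τ]` to all orders up to `n`. -/
def ApproxUpTo (τ : ℝ) (n : ℕ) (f : ℝ → ℝ → ℝ) (U φ : ℕ → ℝ → ℝ) : Prop :=
  ∀ K ≤ n, ∃ C : ℝ, ∀ᶠ η in 𝓝[>] (0 : ℝ), ∀ t ∈ Icc (-τ) τ,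
    |f η t - ∑ k ∈ Finset.range K, (U k t + φ k (t / η)) * η ^ k| ≤ C * η ^ K

theorem CompositeExpansion.exists_approxUpTo {τ : ℝ} {n : ℕ} {f : ℝ → ℝ → ℝ}
    (hf : CompositeExpansion τ n f) : ∃ U φ : ℕ → ℝ → ℝ, (∀ k, ContDiff ℝ ∞ (U k)) ∧
      (∀ k, InD (φ k)) ∧ ApproxUpTo τ n f U φ := by
  induction n generalizing f with
  | zero =>
    obtain ⟨C, hC⟩ := hf
    refine ⟨fun _ _ => 0, fun _ _ => 0, fun _ => contDiff_const, fun _ => InD.zero, fun K hK => ?_⟩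
    obtain rfl := Nat.le_zero.1 hK
    exact ⟨C, hC.mono fun η h t ht => by simpa using h t ht⟩
  | succ n ih =>
    have hf0 : ApproxUpTo τ 0 f (fun _ _ => 0) fun _ _ => 0 := by
      have : ∀ m g, CompositeExpansion τ m g → CompositeExpansion τ 0 g := fun m => by
        induction m with
        | zero => exact fun g h => h
        | succ m ih => exact fun g h => ih g h.of_succ
      obtain ⟨C, hC⟩ := this _ _ hf
      intro K hK
      obtain rfl := Nat.le_zero.1 hK
      exact ⟨C, hC.mono fun η h t ht => by simpa using h t ht⟩
    obtain ⟨U, φ, g, hU, hφ, hg, h⟩ := hf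
    obtain ⟨V, ψ, hV, hψ, hgV⟩ := ih hg
    refine ⟨fun k => Nat.casesOn k U V, fun k => Nat.casesOn k φ ψ, fun k => ?_, fun k => ?_,
      fun K hK => ?_⟩
    · cases k with
      | zero => exact hU
      | succ k => exact hV k
    · cases k with
      | zero => exact hφ
      | succ k => exact hψ k
    · cases K with
      | zero =>
        obtain ⟨C, hC⟩ := hf0 0 le_rfl
        exact ⟨C, by simpa using hC⟩
      | succ K =>
        obtain ⟨C, hC⟩ := hgV K (by omega)
        refine ⟨C, ?_⟩
        filter_upwards [hC, h, eventually_pos_nhdsGT_zero] with η h1 h2 h3 t ht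
        rw [h2 t ht, Finset.sum_range_succ']
        have h4 := mul_le_mul_of_nonneg_left (h1 t ht) h3.le
        rw [← abs_of_pos h3, ← abs_mul, abs_of_pos h3] at h4
        refine (le_of_eq ?_).trans (h4.trans_eq (by ring))
        congr 1
        change U t + φ (t / η) + η * g η t - ((∑ k ∈ Finset.range K,
          (V k t + ψ k (t / η)) * η ^ (k + 1)) + (U t + φ (t / η)) * η ^ 0) = _
        rw [mul_sub, Finset.mul_sum]
        have h5 : ∀ k, (V k t + ψ k (t / η)) * η ^ (k + 1) = η * ((V k t + ψ k (t / η)) * η ^ k) :=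
          fun k => by ring
        simp only [h5, pow_zero, mul_one]
        ring

theorem tendsto_div_nhdsGT_zero_cocompact {t : ℝ} (ht : t ≠ 0) :
    Tendsto (fun η : ℝ => t / η) (𝓝[>] 0) (cocompact ℝ) := by
  rw [cocompact_eq_atBot_atTop]
  simp only [div_eq_mul_inv]
  rcases ht.lt_or_gt with h | h
  · exact (tendsto_inv_nhdsGT_zero.const_mul_atTop_of_neg h).mono_right le_sup_left
  · exact (tendsto_inv_nhdsGT_zero.const_mul_atTop h).mono_right le_sup_right

/-- Uniqueness of the coefficients of composite expansions. -/
theorem ApproxUpTo.unique {τ : ℝ} (hτ : 0 < τ) {n : ℕ} {f : ℝ → ℝ → ℝ} {U V φ ψ : ℕ → ℝ → ℝ}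
    (hU : ∀ k, ContinuousOn (U k) (Icc (-τ) τ)) (hV : ∀ k, ContinuousOn (V k) (Icc (-τ) τ))
    (hφ : ∀ k, Tendsto (φ k) (cocompact ℝ) (𝓝 0)) (hψ : ∀ k, Tendsto (ψ k) (cocompact ℝ) (𝓝 0))
    (h₁ : ApproxUpTo τ n f U φ) (h₂ : ApproxUpTo τ n f V ψ) :
    ∀ k < n, EqOn (U k) (V k) (Icc (-τ) τ) ∧ φ k = ψ k := by
  intro k
  induction k using Nat.strong_induction_on with
  | _ k ih =>
  intro hk
  obtain ⟨C, hC⟩ := h₁ (k + 1) hk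
  obtain ⟨D, hD⟩ := h₂ (k + 1) hk
  have key : ∀ᶠ η in 𝓝[>] (0 : ℝ), ∀ t ∈ Icc (-τ) τ,
      |(U k t - V k t) + (φ k (t / η) - ψ k (t / η))| ≤ (C + D) * η := by
    filter_upwards [hC, hD, eventually_pos_nhdsGT_zero] with η h1 h2 h3 t ht
    have h4 := h1 t ht
    have h5 := h2 t ht
    have h6 : ∑ j ∈ Finset.range k, (U j t + φ j (t / η)) * η ^ j
        = ∑ j ∈ Finset.range k, (V j t + ψ j (t / η)) * η ^ j :=
      Finset.sum_congr rfl fun j hj => by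
        have hj' := Finset.mem_range.1 hj
        obtain ⟨h7, h8⟩ := ih j hj' (hj'.trans hk)
        rw [h7 ht, h8]
    rw [Finset.sum_range_succ] at h4 h5
    rw [h6] at h4
    have h9 := (abs_sub _ _).trans (add_le_add h5 h4)
    have h10 : 0 < η ^ k := by positivity
    rw [← mul_le_mul_iff_left₀ h10, ← abs_of_pos h10, ← abs_mul, abs_of_pos h10]
    refine (le_of_eq ?_).trans (h9.trans_eq (by ring))
    congr 1
    ring
  have hlim : Tendsto (fun η : ℝ => (C + D) * η) (𝓝[>] 0) (𝓝 0) := by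
    have : Tendsto (fun η : ℝ => (C + D) * η) (𝓝 0) (𝓝 ((C + D) * 0)) :=
      Continuous.tendsto (by fun_prop) 0
    rw [mul_zero] at this
    exact this.mono_left nhdsWithin_le_nhds
  -- At fixed $t\ne0$, $t/\eta$ leaves every compact set as $\eta\to0^+$, so the inner functions
  -- disappear in the limit. The point $t=0$ follows by continuity.
  have hne : ∀ t ∈ Icc (-τ) τ, t ≠ 0 → U k t = V k t := fun t ht ht0 => by
    have h1 := ((hφ k).comp (tendsto_div_nhdsGT_zero_cocompact ht0)).sub
      ((hψ k).comp (tendsto_div_nhdsGT_zero_cocompact ht0))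
    have h2 := (h1.const_add (U k t - V k t)).abs
    rw [sub_self, add_zero] at h2
    have h3 := le_of_tendsto_of_tendsto h2 hlim (key.mono fun η h => h t ht)
    exact sub_eq_zero.1 (abs_eq_zero.1 (le_antisymm h3 (abs_nonneg _)))
  have h0 : U k 0 = V k 0 := by
    have hnhds : Icc (-τ) τ ∈ 𝓝 (0 : ℝ) := Icc_mem_nhds (by linarith) hτ
    have h1 := ((hU k).continuousAt hnhds).tendsto.mono_left (nhdsWithin_le_nhds (s := {0}ᶜ))
    have h2 := ((hV k).continuousAt hnhds).tendsto.mono_left (nhdsWithin_le_nhds (s := {0}ᶜ))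
    refine tendsto_nhds_unique_of_eventuallyEq h1 h2 ?_
    filter_upwards [self_mem_nhdsWithin, mem_nhdsWithin_of_mem_nhds hnhds] with t ht ht'
    exact hne t ht' ht
  have hEq : EqOn (U k) (V k) (Icc (-τ) τ) := fun t ht => by
    by_cases ht0 : t = 0
    · rw [ht0, h0]
    · exact hne t ht ht0
  refine ⟨hEq, funext fun T => ?_⟩
  -- Evaluation at $t=\eta T$ with $T$ fixed, the outer coefficients being already equal.
  have h1 : ∀ᶠ η in 𝓝[>] (0 : ℝ), |φ k T - ψ k T| ≤ (C + D) * η := by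
    filter_upwards [key, eventually_pos_nhdsGT_zero,
      eventually_pow_mul_le_one one_ne_zero (|T| / τ)] with η h2 h3 h4
    have hT : η * T ∈ Icc (-τ) τ := abs_le.1 (by
      rw [abs_mul, abs_of_pos h3]
      rw [pow_one, mul_div_assoc', div_le_one hτ] at h4
      exact h4)
    have h5 := h2 _ hT
    rwa [hEq hT, sub_self, zero_add, mul_div_cancel_left₀ _ h3.ne'] at h5
  have h2 := ge_of_tendsto hlim h1
  exact sub_eq_zero.1 (abs_eq_zero.1 (le_antisymm h2 (abs_nonneg _)))

/-- Expansions chosen separately for each order need not be related a priori; uniqueness makes their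
common coefficients agree, so the diagonal choice works. -/
theorem exists_coefficients_of_forall_compositeExpansion {τ : ℝ} (hτ : 0 < τ) {f : ℝ → ℝ → ℝ}
    (hf : ∀ n, CompositeExpansion τ n f) : ∃ U φ : ℕ → ℝ → ℝ, (∀ k, ContDiff ℝ ∞ (U k)) ∧
      (∀ k, InD (φ k)) ∧ ∀ n, ApproxUpTo τ n f U φ := by
  choose U φ hU hφ h using fun n => (hf n).exists_approxUpTo
  refine ⟨fun k => U (k + 1) k, fun k => φ (k + 1) k, fun k => hU _ _, fun k => hφ _ _,
    fun n K _ => ?_⟩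
  obtain ⟨C, hC⟩ := h K K le_rfl
  refine ⟨C, ?_⟩
  filter_upwards [hC] with η h1 t ht
  refine (le_of_eq ?_).trans (h1 t ht)
  congr 2
  refine Finset.sum_congr rfl fun k hk => ?_
  have hk' := Finset.mem_range.1 hk
  obtain ⟨h2, h3⟩ := ApproxUpTo.unique hτ (fun j => (hU (k + 1) j).continuous.continuousOn)
    (fun j => (hU K j).continuous.continuousOn) (fun j => (hφ (k + 1) j).2.tendsto)
    (fun j => (hφ K j).2.tendsto) (h (k + 1)) (fun J hJ => h K J (by omega)) k (Nat.lt_succ_self k)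
  rw [h2 ht, h3]

theorem ScalarExpansion.exists_approx {n : ℕ} {α : ℝ → ℝ} (hα : ScalarExpansion n α) :
    ∃ a : ℕ → ℝ, ∀ K ≤ n, ∃ C : ℝ, ∀ᶠ η in 𝓝[>] (0 : ℝ),
      |α η - ∑ k ∈ Finset.range K, a k * η ^ k| ≤ C * η ^ K := by
  have hbdd : ∀ m β, ScalarExpansion m β → ∃ C : ℝ, ∀ᶠ η in 𝓝[>] (0 : ℝ), |β η| ≤ C := fun m => by
    induction m with
    | zero => exact fun β h => h
    | succ m ih =>
      rintro β ⟨a, γ, hγ, h⟩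
      obtain ⟨C, hC⟩ := ih γ hγ
      refine ⟨|a| + C, ?_⟩
      filter_upwards [h, hC, eventually_pos_nhdsGT_zero, eventually_lt_nhdsGT_zero one_pos]
        with η h1 h2 h3 h4
      rw [h1]
      refine (abs_add_le _ _).trans ?_
      rw [abs_mul, abs_of_pos h3]
      linarith [mul_le_of_le_one_left (abs_nonneg (γ η)) h4.le]
  induction n generalizing α with
  | zero =>
    obtain ⟨C, hC⟩ := hα
    refine ⟨fun _ => 0, fun K hK => ?_⟩
    obtain rfl := Nat.le_zero.1 hK
    exact ⟨C, by simpa using hC⟩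
  | succ n ih =>
    obtain ⟨C, hC⟩ := hbdd _ _ hα
    obtain ⟨a, β, hβ, h⟩ := hα
    obtain ⟨b, hb⟩ := ih hβ
    refine ⟨fun k => Nat.casesOn k a b, fun K hK => ?_⟩
    cases K with
    | zero => exact ⟨C, by simpa using hC⟩
    | succ K =>
      obtain ⟨D, hD⟩ := hb K (by omega)
      refine ⟨D, ?_⟩
      filter_upwards [hD, h, eventually_pos_nhdsGT_zero] with η h1 h2 h3
      rw [h2, Finset.sum_range_succ']
      have h4 := mul_le_mul_of_nonneg_left h1 h3.le
      rw [← abs_of_pos h3, ← abs_mul, abs_of_pos h3] at h4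
      refine (le_of_eq ?_).trans (h4.trans_eq (by ring))
      congr 1
      change a + η * β η - ((∑ k ∈ Finset.range K, b k * η ^ (k + 1)) + a * η ^ 0) = _
      rw [mul_sub, Finset.mul_sum]
      have h5 : ∀ k, b k * η ^ (k + 1) = η * (b k * η ^ k) := fun k => by ring
      simp only [h5, pow_zero, mul_one]
      ring

/-- A scalar expansion is a composite one that is constant in $t$, so uniqueness for scalars needs
no separate proof. -/
theorem approxUpTo_const {n : ℕ} {α : ℝ → ℝ} {a : ℕ → ℝ}
    (h : ∀ K ≤ n, ∃ C : ℝ, ∀ᶠ η in 𝓝[>] (0 : ℝ),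
      |α η - ∑ k ∈ Finset.range K, a k * η ^ k| ≤ C * η ^ K) :
    ApproxUpTo 1 n (fun η _ => α η) (fun k _ => a k) fun _ _ => 0 := fun K hK =>
  (h K hK).imp fun C hC => hC.mono fun η hη t _ => by simpa using hη

theorem approx_scalar_unique {n : ℕ} {α : ℝ → ℝ} {a b : ℕ → ℝ}
    (ha : ∀ K ≤ n, ∃ C : ℝ, ∀ᶠ η in 𝓝[>] (0 : ℝ),
      |α η - ∑ k ∈ Finset.range K, a k * η ^ k| ≤ C * η ^ K)
    (hb : ∀ K ≤ n, ∃ C : ℝ, ∀ᶠ η in 𝓝[>] (0 : ℝ),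
      |α η - ∑ k ∈ Finset.range K, b k * η ^ k| ≤ C * η ^ K) {k : ℕ} (hk : k < n) : a k = b k :=
  (ApproxUpTo.unique one_pos (fun _ => continuousOn_const) (fun _ => continuousOn_const)
    (fun _ => tendsto_const_nhds) (fun _ => tendsto_const_nhds) (approxUpTo_const ha)
    (approxUpTo_const hb) k hk).1 ⟨by norm_num, zero_le_one⟩

theorem exists_coefficients_of_forall_scalarExpansion {α : ℝ → ℝ}
    (hα : ∀ n, ScalarExpansion n α) : ∃ a : ℕ → ℝ, ∀ K, ∃ C : ℝ, ∀ᶠ η in 𝓝[>] (0 : ℝ),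
      |α η - ∑ k ∈ Finset.range K, a k * η ^ k| ≤ C * η ^ K := by
  choose a ha using fun n => (hα n).exists_approx
  refine ⟨fun k => a (k + 1) k, fun K => ?_⟩
  obtain ⟨C, hC⟩ := ha K K le_rfl
  refine ⟨C, hC.mono fun η h1 => (le_of_eq ?_).trans h1⟩
  congr 2
  refine Finset.sum_congr rfl fun k hk => ?_
  have hk' := Finset.mem_range.1 hk
  beta_reduce
  rw [approx_scalar_unique (ha (k + 1)) (fun J hJ => ha K J (by omega)) (Nat.lt_succ_self k)]

/-- Indices shift by one: `K` here counts the terms kept, and the case of no terms is supplied by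
boundedness of `u`. -/
theorem IsCompositeExpansion.approxUpTo {t₁ : ℝ} {α : ℝ → ℝ} {u : ℝ → ℝ → ℝ} {a : ℕ → ℝ}
    {U φ : ℕ → ℝ → ℝ} (h : IsCompositeExpansion t₁ α u a U φ) {R : ℝ}
    (hR : ∀ᶠ η in 𝓝[>] (0 : ℝ), ∀ t ∈ Icc (-t₁) t₁, |u η t| ≤ R) (n : ℕ) :
    ApproxUpTo t₁ n u U φ := fun K _ => by
  cases K with
  | zero => exact ⟨R, by simpa using hR⟩
  | succ K => exact h.func K

theorem IsCompositeExpansion.approx_scalar {t₁ : ℝ} {α : ℝ → ℝ} {u : ℝ → ℝ → ℝ} {a : ℕ → ℝ}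
    {U φ : ℕ → ℝ → ℝ} (h : IsCompositeExpansion t₁ α u a U φ) {R : ℝ}
    (hR : ∀ᶠ η in 𝓝[>] (0 : ℝ), |α η| ≤ R) (K : ℕ) : ∃ C : ℝ, ∀ᶠ η in 𝓝[>] (0 : ℝ),
      |α η - ∑ k ∈ Finset.range K, a k * η ^ k| ≤ C * η ^ K := by
  cases K with
  | zero => exact ⟨R, by simpa using hR⟩
  | succ K =>
    obtain ⟨C, hC⟩ := (h.param K).bound
    refine ⟨C, ?_⟩
    filter_upwards [hC, eventually_pos_nhdsGT_zero] with η h1 h2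
    rwa [Real.norm_eq_abs, Real.norm_eq_abs, abs_of_pos (pow_pos h2 (K + 1))] at h1

/-! ### The main theorem. -/

theorem theorem4 (p L : ℕ) (hp : Odd p) (hp3 : 3 ≤ p) (hL : Even L) (hLp : L < p)
    (t₀ t₁ η₀ : ℝ) (ht₁ : 0 < t₁) (ht : t₁ < t₀) (hη₀ : 0 < η₀)
    (S : ℝ → ℝ → ℝ) (P : ℝ → ℝ → ℝ → ℝ → ℝ)
    (hS : ContDiffOn ℝ ∞ (fun q : ℝ × ℝ => S q.1 q.2) (Icc (-t₀) t₀ ×ˢ univ))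
    (hS0 : ∀ t ∈ Icc (-t₀) t₀, S t 0 = 0)
    -- the Taylor monomials `t^i α^j` of `S` at the origin have `i + (p-L+1) j > p + 1`
    (hSval : ∀ i j : ℕ, i + (p - L + 1) * j ≤ p + 1 →
      iteratedDeriv i (fun t => iteratedDeriv j (fun α => S t α) 0) 0 = 0)
    (hP : ContDiffOn ℝ ∞ (fun q : ℝ × ℝ × ℝ × ℝ => P q.1 q.2.1 q.2.2.1 q.2.2.2)
      (Icc (-t₀) t₀ ×ˢ univ ×ˢ univ ×ˢ Ico 0 η₀)) :
    -- the canard solution exists and is unique for small `η`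
    (∃ (α : ℝ → ℝ) (u : ℝ → ℝ → ℝ), IsCanardSolution p L S P t₀ α u) ∧
    (∀ (α β : ℝ → ℝ) (u v : ℝ → ℝ → ℝ), IsCanardSolution p L S P t₀ α u →
      IsCanardSolution p L S P t₀ β v →
      ∀ᶠ η in 𝓝[>] (0 : ℝ), α η = β η ∧ EqOn (u η) (v η) (Icc (-t₀) t₀)) ∧
    -- it has an asymptotic expansion of the stated kind, and only one
    (∀ (α : ℝ → ℝ) (u : ℝ → ℝ → ℝ), IsCanardSolution p L S P t₀ α u →
      (∃ (a : ℕ → ℝ) (U φ : ℕ → ℝ → ℝ), IsCompositeExpansion t₁ α u a U φ) ∧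
      (∀ (a b : ℕ → ℝ) (U V φ χ : ℕ → ℝ → ℝ), IsCompositeExpansion t₁ α u a U φ →
        IsCompositeExpansion t₁ α u b V χ →
        ∀ k, a k = b k ∧ EqOn (U k) (V k) (Icc (-t₁) t₁) ∧ φ k = χ k)) := by
  have h : IsCanardProblem p L t₀ η₀ S P :=
    ⟨hp, hL, hLp, ht₁.trans ht, hη₀, hS, hS0, hSval, hP⟩
  refine ⟨h.exists_isCanardSolution, fun α β u v hu hv => h.eventually_eq_of_isCanardSolution hu hv,
    fun α u hu => ⟨?_, fun a b U V φ χ h₁ h₂ k => ?_⟩⟩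
  · obtain ⟨a, ha⟩ := exists_coefficients_of_forall_scalarExpansion fun n =>
      (h.scalarExpansion_and_compositeExpansion hu n t₁ ht₁ ht).1
    obtain ⟨U, φ, hU, hφ, hUφ⟩ := exists_coefficients_of_forall_compositeExpansion ht₁ fun n =>
      (h.scalarExpansion_and_compositeExpansion hu n t₁ ht₁ ht).2
    refine ⟨a, U, φ, fun k => (hU k).contDiffOn, fun k => hasInvExpansion_iff_mem_classD.1 (hφ k).2,
      fun k => (hφ k).2.tendsto.mono_left ?_, fun k => (hφ k).2.tendsto.mono_left ?_,
      fun K => ?_, fun K => hUφ (K + 1) (K + 1) le_rfl⟩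
    · rw [cocompact_eq_atBot_atTop]
      exact le_sup_right
    · rw [cocompact_eq_atBot_atTop]
      exact le_sup_left
    · obtain ⟨C, hC⟩ := ha (K + 1)
      refine IsBigO.of_bound C ?_
      filter_upwards [hC, eventually_pos_nhdsGT_zero] with η h1 h2
      rwa [Real.norm_eq_abs, Real.norm_eq_abs, abs_of_pos (pow_pos h2 (K + 1))]
  · obtain ⟨R, hR⟩ := hu.bounded
    have hRα : ∀ᶠ η in 𝓝[>] (0 : ℝ), |α η| ≤ R := hR.mono fun η hη => hη.1
    have hRu : ∀ᶠ η in 𝓝[>] (0 : ℝ), ∀ t ∈ Icc (-t₁) t₁, |u η t| ≤ R :=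
      hR.mono fun η hη t ht' => hη.2 t ⟨by linarith [ht'.1], by linarith [ht'.2]⟩
    refine ⟨approx_scalar_unique (n := k + 1) (fun K _ => h₁.approx_scalar hRα K)
      (fun K _ => h₂.approx_scalar hRα K) (Nat.lt_succ_self k), ?_⟩
    exact ApproxUpTo.unique ht₁ (fun j => (h₁.smooth j).continuousOn)
      (fun j => (h₂.smooth j).continuousOn)
      (fun j => (hasInvExpansion_iff_mem_classD.2 (h₁.mem_classD j)).tendsto)
      (fun j => (hasInvExpansion_iff_mem_classD.2 (h₂.mem_classD j)).tendsto)
      (h₁.approxUpTo hRu (k + 1)) (h₂.approxUpTo hRu (k + 1)) k (Nat.lt_succ_self k)
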